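/- Let $k$ be a field, $S$ a finite-dimensional $k$-algebra and $L(\lambda)$, $\lambda\in\Lambda$, a full set of simple $S$-modules (one for each isomorphism class), labelled by a partially ordered set $(\Lambda,\le)$; all modules are finite-dimensional left modules. Let $\Delta(\lambda)$ be the largest quotient of the projective cover $P(\lambda)$ of $L(\lambda)$, and $\nabla(\lambda)$ the largest submodule of the injective hull of $L(\lambda)$, all of whose composition factors are of the form $L(\mu)$ with $\mu\le\lambda$. Suppose that $S$ is quasi-hereditary: for every $\lambda$, $L(\lambda)$ occurs exactly once as a composition factor of $\Delta(\lambda)$, and $P(\lambda)$ has a filtration whose sections are modules $\Delta(\mu)$ with $\mu\ge\lambda$, with $\Delta(\lambda)$ occurring exactly once. For a module $X$ let $\mathrm{gfd}(X)$ be the least $d$ for which there is an exact sequence $0\to X\to M_0\to\cdots\to M_d\to0$ in which each $M_i$ has a filtration with sections of the form $\nabla(\mu)$, and let $\mathrm{wfd}(X)$ be the least $d$ for which there is an exact sequence $0\to M_d\to\cdots\to M_0\to X\to0$ in which each $M_i$ has a filtration with sections of the form $\Delta(\mu)$. Let $\mathrm{gfd}(S)$ and $\mathrm{wfd}(S)$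 be the suprema of $\mathrm{gfd}(X)$ and $\mathrm{wfd}(X)$ over all $S$-modules $X$. A tilting module is a module that has both a filtration by modules $\nabla(\mu)$ and one by modules $\Delta(\mu)$; $T(\lambda)$ denotes the indecomposable tilting module in which $L(\lambda)$ occurs exactly once as a composition factor and all other composition factors $L(\mu)$ satisfy $\mu<\lambda$. Let $T$ be a full tilting module, that is, a tilting module having every $T(\lambda)$, $\lambda\in\Lambda$, as a direct summand, and let $S'=\mathrm{End}_S(T)^{\mathrm{op}}$ be the corresponding Ringel dual. For $\lambda\in\Lambda$ let $L'(\lambda)$ be the largest semisimple quotient of the left $S'$-module $\mathrm{Hom}_S(T,T(\lambda))$. Then $S'$ is quasi-hereditary with respect to the simple modules $L'(\lambda)$, $\lambda\in\Lambda$, and the opposite order on $\Lambda$, and for these quasi-hereditary structures (i) $\mathrm{gfd}(S)=\mathrm{wfd}(S')$, and (ii) $\mathrm{wfd}(S)=\mathrm{gfd}(S')$. If moreover $S$ has a simple-preserving duality, that is, a contravariant self-equivalence $M\mapsto M^\circ$ of the category of finite-dimensional $S$-modules with $L(\lambda)^\circ\cong L(\lambda)$ for all $\lambda$, then $\mathrm{gfd}(S)=\mathrm{wfd}(S)=\mathrm{wfd}(S')=\mathrm{gfd}(S')$.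 -/

import Mathlib

open CategoryTheory

universe u v

namespace RingelDuality

section Modules

variable {S : Type u} [Ring S]

/-- A surjection `p : P → M` from a projective module with superfluous kernel: a projective
cover of `M`. -/
def IsProjectiveCover {P M : ModuleCat.{u} S} (p : P →ₗ[S] M) : Prop :=
  Module.Projective S P ∧ Function.Surjective p ∧
    ∀ N : Submodule S P, N ⊔ LinearMap.ker p = ⊤ → N = ⊤

/-- An embedding `j : M → I` with essential image into a finitely generated injective module:
an injective hull of `M` in the category of finitely generated modules. -/
def IsInjectiveHull {M I : ModuleCat.{u} S} (j : M →ₗ[S] I) : Prop :=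
  Module.Finite S I ∧ Module.Injective S I ∧ Function.Injective j ∧
    ∀ N : Submodule S I, N ⊓ LinearMap.range j = ⊥ → N = ⊥

/-- Given isomorphism classes of modules `X a` for `a : Λ` (as predicates), the module `M` has a
finite filtration `0 = F 0 ≤ F 1 ≤ ⋯ ≤ F n = M` whose `i`-th section `F (i + 1) / F i` belongs to
the class `X (s i)`. -/
def HasFiltration {Λ : Type v} (X : Λ → ModuleCat.{u} S → Prop) (M : ModuleCat.{u} S)
    {n : ℕ} (s : Fin n → Λ) : Prop :=
  ∃ F : Fin (n + 1) → Submodule S M, Monotone F ∧ F 0 = ⊥ ∧ F (Fin.last n) = ⊤ ∧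
    ∀ i : Fin n,
      X (s i) (ModuleCat.of S (F i.succ ⧸ (F i.castSucc).submoduleOf (F i.succ)))

variable {Λ : Type v} (L : Λ → ModuleCat.{u} S)

/-- `L` is a full set of simple modules: up to isomorphism, each simple module is `L a` for exactly
one label `a`. -/
structure IsFullSetOfSimples : Prop where
  simple : ∀ a, IsSimpleModule S (L a)
  injective : ∀ a b, Nonempty (L a ≃ₗ[S] L b) → a = b
  exhaustive : ∀ M : ModuleCat.{u} S, IsSimpleModule S M → ∃ a, Nonempty (M ≃ₗ[S] L a)

/-- `M` has a composition series whose successive factors are `L (s 0), …, L (s (n - 1))`. -/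
def HasCompositionFactors (M : ModuleCat.{u} S) {n : ℕ} (s : Fin n → Λ) : Prop :=
  HasFiltration (fun a N => Nonempty (N ≃ₗ[S] L a)) M s

/-- `M` has finite length and all its composition factors are of the form `L b` with `b ≤ a`. -/
def FactorsLE [PartialOrder Λ] (a : Λ) (M : ModuleCat.{u} S) : Prop :=
  ∃ (n : ℕ) (s : Fin n → Λ), HasCompositionFactors L M s ∧ ∀ i, s i ≤ a

/-- `M` has finite length and `L a` occurs exactly once among its composition factors. -/
def OccursOnce (a : Λ) (M : ModuleCat.{u} S) : Prop :=
  ∃ (n : ℕ) (s : Fin n → Λ), HasCompositionFactors L M s ∧ ∃! i, s i = a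

variable [PartialOrder Λ]

/-- `D` is (isomorphic to) the standard module `Δ(a)`: the largest quotient of the projective cover
of `L a` all of whose composition factors are of the form `L b` with `b ≤ a`. -/
def IsStandard (a : Λ) (D : ModuleCat.{u} S) : Prop :=
  ∃ (P : ModuleCat.{u} S) (p : P →ₗ[S] L a) (q : P →ₗ[S] D),
    IsProjectiveCover p ∧ Function.Surjective q ∧ FactorsLE L a D ∧
    ∀ N : Submodule S P, FactorsLE L a (ModuleCat.of S (P ⧸ N)) → LinearMap.ker q ≤ N

/-- `C` is (isomorphic to) the costandard module `∇(a)`: the largest submodule of the injective hull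
of `L a` all of whose composition factors are of the form `L b` with `b ≤ a`. -/
def IsCostandard (a : Λ) (C : ModuleCat.{u} S) : Prop :=
  ∃ (I : ModuleCat.{u} S) (j : L a →ₗ[S] I) (i : C →ₗ[S] I),
    IsInjectiveHull j ∧ Function.Injective i ∧ FactorsLE L a C ∧
    ∀ N : Submodule S I, FactorsLE L a (ModuleCat.of S N) → N ≤ LinearMap.range i

/-- The (finite-dimensional) algebra `S` is quasi-hereditary with respect to the partially ordered
set `Λ` labelling its simple modules `L a`. -/
structure IsQuasiHereditary : Prop where
  full : IsFullSetOfSimples L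
  standard : ∀ a, ∃ D : ModuleCat.{u} S, IsStandard L a D ∧ OccursOnce L a D
  projective : ∀ a, ∃ (P : ModuleCat.{u} S) (p : P →ₗ[S] L a), IsProjectiveCover p ∧
    ∃ (n : ℕ) (s : Fin n → Λ), HasFiltration (IsStandard L) P s ∧
      (∃! i, s i = a) ∧ ∀ i, a ≤ s i

/-- `M` has a `Δ`-filtration. -/
def HasDeltaFiltration (M : ModuleCat.{u} S) : Prop :=
  ∃ (n : ℕ) (s : Fin n → Λ), HasFiltration (IsStandard L) M s

/-- `M` has a `∇`-filtration. -/
def HasNablaFiltration (M : ModuleCat.{u} S) : Prop :=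
  ∃ (n : ℕ) (s : Fin n → Λ), HasFiltration (IsCostandard L) M s

/-- There is an exact sequence `0 → X → M 0 → M 1 → ⋯ → M d → 0` in which every `M i` has a
`∇`-filtration. -/
def HasNablaResolution (X : ModuleCat.{u} S) (d : ℕ) : Prop :=
  ∃ (M : ℕ → ModuleCat.{u} S) (e : X →ₗ[S] M 0) (f : ∀ i, M i →ₗ[S] M (i + 1)),
    Function.Injective e ∧ Function.Exact e (f 0) ∧ (∀ i, Function.Exact (f i) (f (i + 1))) ∧
    (∀ i ≤ d, HasNablaFiltration L (M i)) ∧ ∀ i > d, Subsingleton (M i)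

/-- There is an exact sequence `0 → M d → ⋯ → M 1 → M 0 → X → 0` in which every `M i` has a
`Δ`-filtration. -/
def HasDeltaResolution (X : ModuleCat.{u} S) (d : ℕ) : Prop :=
  ∃ (M : ℕ → ModuleCat.{u} S) (e : M 0 →ₗ[S] X) (f : ∀ i, M (i + 1) →ₗ[S] M i),
    Function.Surjective e ∧ Function.Exact (f 0) e ∧ (∀ i, Function.Exact (f (i + 1)) (f i)) ∧
    (∀ i ≤ d, HasDeltaFiltration L (M i)) ∧ ∀ i > d, Subsingleton (M i)

/-- The `∇`-filtration dimension of a module: the least length of a `∇`-resolution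
(`⊤` if there is none). -/
noncomputable def moduleGfd (X : ModuleCat.{u} S) : ℕ∞ :=
  ⨅ (d : ℕ) (_ : HasNablaResolution L X d), (d : ℕ∞)

/-- The `Δ`-filtration dimension of a module: the least length of a `Δ`-resolution
(`⊤` if there is none). -/
noncomputable def moduleWfd (X : ModuleCat.{u} S) : ℕ∞ :=
  ⨅ (d : ℕ) (_ : HasDeltaResolution L X d), (d : ℕ∞)

/-- The `∇`-filtration dimension of the algebra: the supremum of the `∇`-filtration dimensions of
its finitely generated (that is, finite-dimensional) modules. -/
noncomputable def gfd : ℕ∞ :=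
  ⨆ (X : ModuleCat.{u} S) (_ : Module.Finite S X), moduleGfd L X

/-- The `Δ`-filtration dimension of the algebra: the supremum of the `Δ`-filtration dimensions of
its finitely generated (that is, finite-dimensional) modules. -/
noncomputable def wfd : ℕ∞ :=
  ⨆ (X : ModuleCat.{u} S) (_ : Module.Finite S X), moduleWfd L X

/-- A tilting module has both a `∇`-filtration and a `Δ`-filtration. -/
def IsTilting (M : ModuleCat.{u} S) : Prop :=
  HasNablaFiltration L M ∧ HasDeltaFiltration L M

/-- A nonzero module with no nontrivial direct sum decomposition. -/
def IsIndecomposable (M : ModuleCat.{u} S) : Prop :=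
  Nontrivial M ∧ ∀ N N' : Submodule S M, IsCompl N N' → N = ⊥ ∨ N' = ⊥

/-- `M` is (isomorphic to) `T(a)`: an indecomposable tilting module in which `L a` occurs exactly
once as a composition factor, all other composition factors `L b` satisfying `b < a`. -/
def IsIndecomposableTilting (a : Λ) (M : ModuleCat.{u} S) : Prop :=
  IsTilting L M ∧ IsIndecomposable M ∧
    ∃ (n : ℕ) (s : Fin n → Λ), HasCompositionFactors L M s ∧
      (∃! i, s i = a) ∧ ∀ i, s i ≠ a → s i < a

/-- `M` is isomorphic to a direct summand of `T`. -/
def IsDirectSummand (M T : ModuleCat.{u} S) : Prop :=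
  ∃ (i : M →ₗ[S] T) (r : T →ₗ[S] M), r ∘ₗ i = LinearMap.id

/-- `S` has a simple-preserving duality: a contravariant self-equivalence of the category of
finitely generated (that is, finite-dimensional) modules that sends each simple module `L a` to a
module isomorphic to `L a`. -/
def HasSimplePreservingDuality : Prop :=
  ∃ D : (FGModuleCat.{u} S)ᵒᵖ ≌ FGModuleCat.{u} S,
    ∀ (a : Λ) (M : FGModuleCat.{u} S), Nonempty (M ≃ₗ[S] L a) →
      Nonempty (D.functor.obj (Opposite.op M) ≃ₗ[S] L a)

/-- The algebra `End_S(T)ᵒᵖ`. It acts from the left on `Hom_S(T, M)` by precomposition. -/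
abbrev RingelDual (T : ModuleCat.{u} S) : Type u := (Module.End S T)ᵈᵐᵃ

/-- Given modules `Tl a` labelled by `a : Λ` (in practice `Tl a = T(a)`), the `End_S(T)ᵒᵖ`-modules
`L'(a)`, the largest semisimple quotient of `Hom_S(T, Tl a)`; the labels carry the opposite order. -/
noncomputable def ringelSimple (T : ModuleCat.{u} S) (Tl : Λ → ModuleCat.{u} S) :
    Λᵒᵈ → ModuleCat.{u} (RingelDual T) := fun a =>
  ModuleCat.of (RingelDual T)
    ((T →ₗ[S] Tl (OrderDual.ofDual a)) ⧸
      Module.jacobson (RingelDual T) (T →ₗ[S] Tl (OrderDual.ofDual a)))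

end Modules

end RingelDuality

/-!
# Filtration dimensions of a quasi-hereditary algebra and of its Ringel dual

Write `Δ a`, `C a` for the standard and costandard modules. Both filtration dimensions are measured
by Ext groups: `Ext^j(Δ a, C b) = 0` for `j > 0`, conversely a finitely generated module has a
costandard filtration as soon as `Ext¹(Δ a, -)` vanishes on it for all `a` (`filtC_of_extVanish`),
and dimension shifting gives `gfd S ≤ d` if and only if `Ext^j(Δ a, X) = 0` for all `a`, all `X` and
all `j > d` (`gfd_le_iff`); dually for standard filtrations and `wfd` (`wfd_le_iff`). Because the
global dimension is finite, it suffices to test `X = S`, respectively an injective cogenerator `I`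
(`gfd_le_iff_self`, `wfd_le_iff_cogenerator`).

Let `S' = End(T)ᵒᵖ` for a full tilting module `T`. A costandardly filtered module is a quotient of a
module in `add T` by a costandardly filtered submodule, so `Hom(T, -)` is exact and fully faithful
on costandardly filtered modules. It takes `T(a)` to the projective cover of `L'(a)` and `C a` to
the standard module of `S'` labelled by `a` for the opposite order, and the costandard filtration of
`T(a)` to a standard filtration; so `S'` is quasi-hereditary (`FullTilting.isQuasiHereditary`).

All four dimensions are homological dimensions of the single `S'`-module `Hom(T, I)`.

* `wfd S` is its projective dimension: for `M` with a costandard filtration, `Hom(T, M)` is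
  projective exactly if `M` has a standard filtration as well (`extVanish_C_iff`). So is `gfd S'`,
  since an injective resolution of `C a` gives a coresolution of `Hom(T, C a)` by summands of powers
  of `Hom(T, I)` (`extVanish_hom_of_cogenerator`). Hence `wfd S = gfd S'` (`FullTilting.wfd_eq`).
* `gfd S` is its injective dimension: the functor `Hom_k(Hom(-, T), k)` is exact on modules with a
  standard filtration, the image of such a module `M` is injective exactly if `M` has a costandard
  filtration as well (`extVanish_Δ_iff`), and `S` is mapped to `Hom_k(T, k) = Hom(T, I)` for
  `I = Hom_k(S, k)`. So is `wfd S'`: the modules `Y` with `Ext^j(Y, Hom(T, I)) = 0` for `j > 0` are of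
  the form `Hom(T, N)` with `N` costandardly filtered, so they have standard filtrations
  (`exists_equiv_of_extVanish`). Hence `gfd S = wfd S'` (`FullTilting.gfd_eq`).

A simple-preserving duality is exact, interchanges projective and injective modules and takes `Δ a`
to `C a`. So the projective dimension of `Δ a` is the injective dimension of `C a`, and
`gfd S = wfd S` (`HighestWeight.gfd_eq_wfd`).
-/

namespace RingelDuality

open CategoryTheory.Abelian

/-! ### Short exact sequences -/

section ShortExact

variable {S : Type u} [Ring S]
variable {X Y Z W : Type u} [AddCommGroup X] [Module S X] [AddCommGroup Y] [Module S Y]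
  [AddCommGroup Z] [Module S Z] [AddCommGroup W] [Module S W]

/-- The sequence `0 → X → Y → Z → 0` given by `f` and `g` is exact. -/
structure SES (f : X →ₗ[S] Y) (g : Y →ₗ[S] Z) : Prop where
  inj : Function.Injective f
  exact : Function.Exact f g
  surj : Function.Surjective g

namespace SES

theorem mkQ (N : Submodule S X) : SES N.subtype N.mkQ :=
  ⟨N.injective_subtype, LinearMap.exact_subtype_mkQ N, N.mkQ_surjective⟩

theorem ker_subtype {g : Y →ₗ[S] Z} (hg : Function.Surjective g) :
    SES (LinearMap.ker g).subtype g :=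
  ⟨Submodule.injective_subtype _, LinearMap.exact_subtype_ker_map g, hg⟩

theorem range_mkQ {f : X →ₗ[S] Y} (hf : Function.Injective f) :
    SES f (LinearMap.range f).mkQ :=
  ⟨hf, LinearMap.exact_map_mkQ_range f, Submodule.mkQ_surjective _⟩

variable {f : X →ₗ[S] Y} {g : Y →ₗ[S] Z}

theorem comp_apply (h : SES f g) (x : X) : g (f x) = 0 := h.exact.apply_apply_eq_zero x

theorem comp_eq_zero (h : SES f g) : g ∘ₗ f = 0 := LinearMap.ext h.comp_apply

theorem exists_eq (h : SES f g) {y : Y} (hy : g y = 0) : ∃ x, f x = y := (h.exact y).1 hy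

theorem lift (h : SES f g) (a : W →ₗ[S] Y) (ha : ∀ w, g (a w) = 0) :
    ∃ b : W →ₗ[S] X, f ∘ₗ b = a := by
  refine ⟨(LinearEquiv.ofInjective f h.inj).symm.toLinearMap ∘ₗ
    a.codRestrict (LinearMap.range f) fun w => h.exists_eq (ha w), LinearMap.ext fun w => ?_⟩
  have := LinearEquiv.apply_symm_apply (LinearEquiv.ofInjective f h.inj)
    (a.codRestrict (LinearMap.range f) (fun w => h.exists_eq (ha w)) w)
  exact congrArg Subtype.val this

theorem desc (h : SES f g) (a : Y →ₗ[S] W) (ha : ∀ x, a (f x) = 0) :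
    ∃ b : Z →ₗ[S] W, b ∘ₗ g = a := by
  have hk : LinearMap.ker g ≤ LinearMap.ker a := by
    intro y hy
    obtain ⟨x, rfl⟩ := h.exists_eq hy
    exact ha x
  refine ⟨(LinearMap.ker g).liftQ a hk ∘ₗ
    (g.quotKerEquivOfSurjective h.surj).symm.toLinearMap, LinearMap.ext fun y => ?_⟩
  have : (g.quotKerEquivOfSurjective h.surj).symm (g y) = (LinearMap.ker g).mkQ y := by
    rw [LinearEquiv.symm_apply_eq]; rfl
  simp [this]

theorem finite_left [IsNoetherianRing S] [Module.Finite S Y] (h : SES f g) : Module.Finite S X :=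
  Module.Finite.of_injective f h.inj

theorem finite_right [Module.Finite S Y] (h : SES f g) : Module.Finite S Z :=
  Module.Finite.of_surjective g h.surj

theorem finite_mid [Module.Finite S X] [Module.Finite S Z] (h : SES f g) : Module.Finite S Y :=
  Module.Finite.of_exact h.exact h.surj

end SES

theorem SES.inl_snd (S : Type u) [Ring S] (X Y : Type u) [AddCommGroup X] [Module S X]
    [AddCommGroup Y] [Module S Y] : SES (LinearMap.inl S X Y) (LinearMap.snd S X Y) :=
  ⟨LinearMap.inl_injective, Function.Exact.inl_snd, LinearMap.snd_surjective⟩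

theorem SES.of_equiv {X Y : Type u} [AddCommGroup X] [Module S X] [AddCommGroup Y] [Module S Y]
    (e : X ≃ₗ[S] Y) : SES (e : X →ₗ[S] Y) (0 : Y →ₗ[S] PUnit.{u + 1}) :=
  ⟨e.injective, fun y => ⟨fun _ => e.surjective y, fun _ => rfl⟩, fun _ => ⟨0, rfl⟩⟩

end ShortExact

/-! ### Vanishing of Ext groups -/

section ExtVanishing

variable {S : Type u} [Ring S]

/-- The group `Ext^n(X, Y)` vanishes. -/
def ExtVanish (S : Type u) [Ring S] (n : ℕ) (X Y : Type u) [AddCommGroup X] [Module S X]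
    [AddCommGroup Y] [Module S Y] : Prop :=
  Subsingleton (Ext (ModuleCat.of S X) (ModuleCat.of S Y) n)

variable {X Y Z W V : Type u} [AddCommGroup X] [Module S X] [AddCommGroup Y] [Module S Y]
  [AddCommGroup Z] [Module S Z] [AddCommGroup W] [Module S W] [AddCommGroup V] [Module S V]

theorem ExtVanish.eq_zero {n : ℕ} (h : ExtVanish S n X Y)
    (x : Ext (ModuleCat.of S X) (ModuleCat.of S Y) n) : x = 0 :=
  have : Subsingleton (Ext (ModuleCat.of S X) (ModuleCat.of S Y) n) := h
  Subsingleton.elim _ _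

theorem extVanish_of_forall {n : ℕ}
    (h : ∀ x : Ext (ModuleCat.of S X) (ModuleCat.of S Y) n, x = 0) : ExtVanish S n X Y :=
  subsingleton_of_forall_eq 0 h

theorem extVanish_zero_iff : ExtVanish S 0 X Y ↔ ∀ f : X →ₗ[S] Y, f = 0 := by
  constructor
  · intro h f
    have h1 := h.eq_zero (Ext.mk₀ (ModuleCat.ofHom f))
    rw [← Ext.mk₀_zero] at h1
    have h2 := (Ext.mk₀_bijective _ _).1 h1
    exact congrArg ModuleCat.Hom.hom h2
  · intro h
    refine extVanish_of_forall fun x => ?_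
    obtain ⟨f, rfl⟩ := (Ext.mk₀_bijective _ _).2 x
    have : f = 0 := ModuleCat.hom_ext (h f.hom)
    rw [this, Ext.mk₀_zero]

theorem extVanish_of_projective [Module.Projective S X] (n : ℕ) : ExtVanish S (n + 1) X Y := by
  have : Projective (ModuleCat.of S X) := (IsProjective.iff_projective X).1 inferInstance
  exact Ext.subsingleton_of_projective _ _ n

theorem extVanish_of_injective (hY : Module.Injective S Y) (n : ℕ) : ExtVanish S (n + 1) X Y := by
  have : Injective (ModuleCat.of S Y) := Module.injective_object_of_injective_module S Y
  exact Ext.subsingleton_of_injective _ _ n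

theorem ExtVanish.retract_left {n : ℕ} (h : ExtVanish S n X W) (i : Y →ₗ[S] X) (r : X →ₗ[S] Y)
    (hr : r ∘ₗ i = LinearMap.id) : ExtVanish S n Y W := by
  refine extVanish_of_forall fun x => ?_
  have h1 : ModuleCat.ofHom i ≫ ModuleCat.ofHom r = 𝟙 (ModuleCat.of S Y) := by
    rw [← ModuleCat.ofHom_comp, hr]; rfl
  have h2 := h.eq_zero ((Ext.mk₀ (ModuleCat.ofHom r)).comp x (zero_add n))
  have h3 : (Ext.mk₀ (ModuleCat.ofHom i)).comp
      ((Ext.mk₀ (ModuleCat.ofHom r)).comp x (zero_add n)) (zero_add n) = 0 := by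
    rw [h2, Ext.comp_zero]
  rwa [Ext.mk₀_comp_mk₀_assoc, h1, Ext.mk₀_id_comp] at h3

theorem ExtVanish.retract_right {n : ℕ} (h : ExtVanish S n W X) (i : Y →ₗ[S] X) (r : X →ₗ[S] Y)
    (hr : r ∘ₗ i = LinearMap.id) : ExtVanish S n W Y := by
  refine extVanish_of_forall fun x => ?_
  have h1 : ModuleCat.ofHom i ≫ ModuleCat.ofHom r = 𝟙 (ModuleCat.of S Y) := by
    rw [← ModuleCat.ofHom_comp, hr]; rfl
  have h2 := h.eq_zero (x.comp (Ext.mk₀ (ModuleCat.ofHom i)) (add_zero n))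
  have h3 : (x.comp (Ext.mk₀ (ModuleCat.ofHom i)) (add_zero n)).comp
      (Ext.mk₀ (ModuleCat.ofHom r)) (add_zero n) = 0 := by
    rw [h2, Ext.zero_comp]
  rwa [Ext.comp_assoc_of_second_deg_zero, Ext.mk₀_comp_mk₀, h1, Ext.comp_mk₀_id] at h3

theorem ExtVanish.congr_left {n : ℕ} (h : ExtVanish S n X W) (e : X ≃ₗ[S] Y) :
    ExtVanish S n Y W :=
  h.retract_left e.symm.toLinearMap e.toLinearMap (by ext; simp)

theorem ExtVanish.congr_right {n : ℕ} (h : ExtVanish S n W X) (e : X ≃ₗ[S] Y) :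
    ExtVanish S n W Y :=
  h.retract_right e.symm.toLinearMap e.toLinearMap (by ext; simp)

theorem extVanish_subsingleton_left [Subsingleton X] (n : ℕ) : ExtVanish S n X Y := by
  cases n with
  | zero => exact extVanish_zero_iff.2 fun f => Subsingleton.elim _ _
  | succ n => exact extVanish_of_projective n

theorem extVanish_subsingleton_right [Subsingleton Y] (n : ℕ) : ExtVanish S n X Y := by
  cases n with
  | zero => exact extVanish_zero_iff.2 fun f => Subsingleton.elim _ _
  | succ n =>
    exact extVanish_of_injective ⟨fun _ _ _ _ _ _ _ _ _ => ⟨0, fun _ => Subsingleton.elim _ _⟩⟩ n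

variable {f : X →ₗ[S] Y} {g : Y →ₗ[S] Z}

/-- The short exact sequence as an object of homological algebra. -/
abbrev SES.shortComplex (h : SES f g) : ShortComplex (ModuleCat.{u} S) :=
  ShortComplex.mk (ModuleCat.ofHom f) (ModuleCat.ofHom g)
    (by rw [← ModuleCat.ofHom_comp, h.comp_eq_zero]; rfl)

theorem SES.shortExact (h : SES f g) : h.shortComplex.ShortExact where
  exact := (ShortComplex.ShortExact.moduleCat_exact_iff_function_exact _).2 h.exact
  mono_f := (ModuleCat.mono_iff_injective _).2 h.inj
  epi_g := (ModuleCat.epi_iff_surjective _).2 h.surj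

namespace SES

variable (W) {n : ℕ}

theorem cov_mid (h : SES f g) (h1 : ExtVanish S n W X) (h3 : ExtVanish S n W Z) :
    ExtVanish S n W Y := by
  refine extVanish_of_forall fun x => ?_
  obtain ⟨y, rfl⟩ := Ext.covariant_sequence_exact₂ _ h.shortExact x (h3.eq_zero _)
  rw [h1.eq_zero y, Ext.zero_comp]

theorem cov_right (h : SES f g) (h2 : ExtVanish S n W Y) (h1 : ExtVanish S (n + 1) W X) :
    ExtVanish S n W Z := by
  refine extVanish_of_forall fun x => ?_
  obtain ⟨y, rfl⟩ := Ext.covariant_sequence_exact₃ _ h.shortExact x rfl (h1.eq_zero _)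
  rw [h2.eq_zero y, Ext.zero_comp]

theorem cov_left (h : SES f g) (h3 : ExtVanish S n W Z) (h2 : ExtVanish S (n + 1) W Y) :
    ExtVanish S (n + 1) W X := by
  refine extVanish_of_forall fun x => ?_
  obtain ⟨y, rfl⟩ := Ext.covariant_sequence_exact₁ _ h.shortExact x (h2.eq_zero _) rfl
  rw [h3.eq_zero y, Ext.zero_comp]

theorem con_mid (h : SES f g) (h1 : ExtVanish S n X W) (h3 : ExtVanish S n Z W) :
    ExtVanish S n Y W := by
  refine extVanish_of_forall fun x => ?_
  obtain ⟨y, rfl⟩ := Ext.contravariant_sequence_exact₂ h.shortExact _ x (h1.eq_zero _)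
  rw [h3.eq_zero y, Ext.comp_zero]

theorem con_left (h : SES f g) (h2 : ExtVanish S n Y W) (h3 : ExtVanish S (n + 1) Z W) :
    ExtVanish S n X W := by
  refine extVanish_of_forall fun x => ?_
  obtain ⟨y, rfl⟩ := Ext.contravariant_sequence_exact₁ h.shortExact _ x (add_comm 1 n)
    (h3.eq_zero _)
  rw [h2.eq_zero y, Ext.comp_zero]

theorem con_right (h : SES f g) (h1 : ExtVanish S n X W) (h2 : ExtVanish S (n + 1) Y W) :
    ExtVanish S (n + 1) Z W := by
  refine extVanish_of_forall fun x => ?_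
  obtain ⟨y, rfl⟩ := Ext.contravariant_sequence_exact₃ h.shortExact _ x (h2.eq_zero _)
    (add_comm 1 n)
  rw [h1.eq_zero y, Ext.comp_zero]

variable {W}

theorem exists_lift (h : SES f g) (hW : ExtVanish S 1 W X) (a : W →ₗ[S] Z) :
    ∃ b : W →ₗ[S] Y, g ∘ₗ b = a := by
  obtain ⟨y, hy⟩ := Ext.covariant_sequence_exact₃ (ModuleCat.of S W) h.shortExact
    (Ext.mk₀ (ModuleCat.ofHom a)) rfl (hW.eq_zero _)
  obtain ⟨b, rfl⟩ := (Ext.mk₀_bijective _ _).2 y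
  rw [Ext.mk₀_comp_mk₀] at hy
  exact ⟨b.hom, congrArg ModuleCat.Hom.hom ((Ext.mk₀_bijective _ _).1 hy)⟩

theorem exists_extension (h : SES f g) (hW : ExtVanish S 1 Z W) (a : X →ₗ[S] W) :
    ∃ b : Y →ₗ[S] W, b ∘ₗ f = a := by
  obtain ⟨y, hy⟩ := Ext.contravariant_sequence_exact₁ h.shortExact (ModuleCat.of S W)
    (Ext.mk₀ (ModuleCat.ofHom a)) (add_zero 1) (hW.eq_zero _)
  obtain ⟨b, rfl⟩ := (Ext.mk₀_bijective _ _).2 y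
  rw [Ext.mk₀_comp_mk₀] at hy
  exact ⟨b.hom, congrArg ModuleCat.Hom.hom ((Ext.mk₀_bijective _ _).1 hy)⟩

/-- If `Ext¹(Y, W) = 0`, then `Ext¹(Z, W)` is the cokernel of `Hom(Y, W) → Hom(X, W)`. -/
theorem extVanish_of_extension (h : SES f g) (hY : ExtVanish S 1 Y W)
    (ha : ∀ a : X →ₗ[S] W, ∃ b : Y →ₗ[S] W, b ∘ₗ f = a) : ExtVanish S 1 Z W := by
  refine extVanish_of_forall fun x => ?_
  obtain ⟨y, rfl⟩ := Ext.contravariant_sequence_exact₃ h.shortExact _ x (hY.eq_zero _)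
    (add_zero 1)
  obtain ⟨a, rfl⟩ := (Ext.mk₀_bijective _ _).2 y
  obtain ⟨b, hb⟩ := ha a.hom
  have : a = h.shortComplex.f ≫ ModuleCat.ofHom b := ModuleCat.hom_ext hb.symm
  rw [this, ← Ext.mk₀_comp_mk₀,
    ← Ext.comp_assoc (h₁₂ := add_zero 1) (h₂₃ := add_zero 0) (h := by simp),
    h.shortExact.extClass_comp, Ext.zero_comp]

/-- If `Ext¹(W, Y) = 0`, then `Ext¹(W, X)` is the cokernel of `Hom(W, Y) → Hom(W, Z)`. -/
theorem extVanish_of_lift (h : SES f g) (hY : ExtVanish S 1 W Y)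
    (ha : ∀ a : W →ₗ[S] Z, ∃ b : W →ₗ[S] Y, g ∘ₗ b = a) : ExtVanish S 1 W X := by
  refine extVanish_of_forall fun x => ?_
  obtain ⟨y, rfl⟩ := Ext.covariant_sequence_exact₁ _ h.shortExact x (hY.eq_zero _) (zero_add 1)
  obtain ⟨a, rfl⟩ := (Ext.mk₀_bijective _ _).2 y
  obtain ⟨b, hb⟩ := ha a.hom
  have : a = ModuleCat.ofHom b ≫ h.shortComplex.g := ModuleCat.hom_ext hb.symm
  rw [this, ← Ext.mk₀_comp_mk₀,
    Ext.comp_assoc (h₁₂ := add_zero 0) (h₂₃ := zero_add 1) (h := by simp),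
    h.shortExact.comp_extClass, Ext.comp_zero]

end SES

end ExtVanishing

/-! ### Filtrations -/

section Filtrations

variable {S : Type u} [Ring S]

/-- The modules with a finite filtration whose sections satisfy `𝒳`: the closure of `𝒳` and the
zero modules under extensions, built by adding one section on top at a time. -/
inductive Filt (𝒳 : ModuleCat.{u} S → Prop) : ModuleCat.{u} S → Prop
  | zero (M : ModuleCat.{u} S) (h : Subsingleton M) : Filt 𝒳 M
  | cons {X Y Z : ModuleCat.{u} S} (f : X →ₗ[S] Y) (g : Y →ₗ[S] Z) (h : SES f g)
      (hX : Filt 𝒳 X) (hZ : 𝒳 Z) : Filt 𝒳 Y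

variable {𝒳 𝒴 : ModuleCat.{u} S → Prop}
variable {X Y Z W : Type u} [AddCommGroup X] [Module S X] [AddCommGroup Y] [Module S Y]
  [AddCommGroup Z] [Module S Z] [AddCommGroup W] [Module S W]

theorem Filt.mono {M : ModuleCat.{u} S} (h : Filt 𝒳 M) (hXY : ∀ N, 𝒳 N → 𝒴 N) : Filt 𝒴 M := by
  induction h with
  | zero M h => exact .zero M h
  | cons f g h _ hZ ih => exact .cons f g h ih (hXY _ hZ)

theorem Filt.congr {M : ModuleCat.{u} S} (h : Filt 𝒳 M) : ∀ {N : ModuleCat.{u} S}, (M ≃ₗ[S] N) →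
    Filt 𝒳 N := by
  cases h with
  | zero _ h => exact fun e => .zero _ (e.symm.toEquiv.subsingleton)
  | cons f g h hX hZ =>
    refine fun e => .cons (e.toLinearMap ∘ₗ f) (g ∘ₗ e.symm.toLinearMap) ?_ hX hZ
    refine ⟨e.injective.comp h.inj, fun y => ?_, h.surj.comp e.symm.surjective⟩
    have := h.exact (e.symm y)
    simp only [LinearMap.comp_apply, LinearEquiv.coe_coe, this, Set.mem_range]
    exact exists_congr fun x => LinearEquiv.eq_symm_apply e

theorem Filt.of_mem {M : ModuleCat.{u} S} (h : 𝒳 M) : Filt 𝒳 M :=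
  .cons (X := ModuleCat.of S PUnit) 0 LinearMap.id
    ⟨Function.injective_of_subsingleton _,
      fun y => ⟨fun hy => ⟨0, by simpa using Eq.symm hy⟩, by rintro ⟨x, rfl⟩; simp⟩,
      Function.surjective_id⟩ (.zero _ inferInstance) h

/-- Filtrations of the outer terms of a short exact sequence splice to one of the middle term. -/
theorem Filt.of_ses {X Z : ModuleCat.{u} S} {Y : ModuleCat.{u} S} {f : X →ₗ[S] Y} {g : Y →ₗ[S] Z}
    (h : SES f g) (hX : Filt 𝒳 X) (hZ : Filt 𝒳 Z) : Filt 𝒳 Y := by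
  induction hZ generalizing Y with
  | zero Z hZ =>
    refine hX.congr (LinearEquiv.ofBijective f ⟨h.inj,
      fun y => h.exists_eq (Subsingleton.elim _ _)⟩)
  | @cons Z' Z Z'' f' g' h' _ hZ'' ih =>
    have hs : Function.Surjective (g' ∘ₗ g) := h'.surj.comp h.surj
    refine .cons _ _ (X := ModuleCat.of S (LinearMap.ker (g' ∘ₗ g))) (SES.ker_subtype hs) ?_ hZ''
    obtain ⟨a, ha⟩ := h'.lift (g ∘ₗ (LinearMap.ker (g' ∘ₗ g)).subtype) fun w => w.2
    obtain ⟨b, hb⟩ := (SES.ker_subtype hs).lift f fun x => by simp [h.comp_apply]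
    have ha' : ∀ w, f' (a w) = g w.1 := fun w => LinearMap.congr_fun ha w
    have hb' : ∀ w, (b w).1 = f w := fun w => LinearMap.congr_fun hb w
    refine ih (f := b) (g := a) ⟨fun x y hxy => h.inj ?_, fun w => ⟨fun hw => ?_, ?_⟩, fun z => ?_⟩
    · rw [← hb', ← hb', hxy]
    · obtain ⟨x, hx⟩ := h.exists_eq (y := w.1) (by rw [← ha', hw, map_zero])
      exact ⟨x, Subtype.ext (by rw [hb', hx])⟩
    · rintro ⟨x, rfl⟩
      exact h'.inj (by rw [ha', hb', h.comp_apply, map_zero])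
    · obtain ⟨y, hy⟩ := h.surj (f' z)
      refine ⟨⟨y, by simp [hy, h'.comp_apply]⟩, h'.inj ?_⟩
      rw [ha', hy]

theorem Filt.finite {M : ModuleCat.{u} S} (h : Filt 𝒳 M) (hX : ∀ N, 𝒳 N → Module.Finite S N) :
    Module.Finite S M := by
  induction h with
  | zero M h => infer_instance
  | cons f g h _ hZ ih =>
    have := hX _ hZ
    exact h.finite_mid

theorem Filt.extVanish_left {M : ModuleCat.{u} S} {n : ℕ} (h : Filt 𝒳 M)
    (hX : ∀ N, 𝒳 N → ExtVanish S n N W) : ExtVanish S n M W := by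
  induction h with
  | zero M h => exact extVanish_subsingleton_left n
  | cons f g h _ hZ ih => exact h.con_mid W ih (hX _ hZ)

theorem Filt.extVanish_right {M : ModuleCat.{u} S} {n : ℕ} (h : Filt 𝒳 M)
    (hX : ∀ N, 𝒳 N → ExtVanish S n W N) : ExtVanish S n W M := by
  induction h with
  | zero M h => exact extVanish_subsingleton_right n
  | cons f g h _ hZ ih => exact h.cov_mid W ih (hX _ hZ)

variable {Λ : Type v} {𝒵 : Λ → ModuleCat.{u} S → Prop}

/-- The section between two consecutive terms of a chain of submodules. -/
theorem SES.submoduleOf {M : Type u} [AddCommGroup M] [Module S M] {N N' : Submodule S M}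
    (h : N ≤ N') : SES (Submodule.inclusion h) (N.submoduleOf N').mkQ := by
  refine ⟨Submodule.inclusion_injective h, fun x => ?_, Submodule.mkQ_surjective _⟩
  rw [Submodule.mkQ_apply, Submodule.Quotient.mk_eq_zero]
  exact ⟨fun hx => ⟨⟨x.1, hx⟩, rfl⟩, by rintro ⟨y, rfl⟩; exact y.2⟩

theorem Filt.of_hasFiltration_initial {M : ModuleCat.{u} S} {n : ℕ} {s : Fin n → Λ}
    {F : Fin (n + 1) → Submodule S M} (hF : Monotone F) (h0 : F 0 = ⊥)
    (hs : ∀ i : Fin n,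
      𝒵 (s i) (ModuleCat.of S (F i.succ ⧸ (F i.castSucc).submoduleOf (F i.succ))))
    (i : Fin (n + 1)) :
    Filt (fun N => ∃ j : Fin n, j.castSucc < i ∧ 𝒵 (s j) N) (ModuleCat.of S (F i)) := by
  induction i using Fin.induction with
  | zero => exact .zero _ (by rw [h0]; infer_instance)
  | succ i ih =>
    refine .cons (X := ModuleCat.of S (F i.castSucc)) (Y := ModuleCat.of S (F i.succ))
      _ _ (SES.submoduleOf (hF i.castSucc_lt_succ.le)) (ih.mono ?_)
      ⟨i, i.castSucc_lt_succ, hs i⟩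
    rintro N ⟨j, hj, hN⟩
    exact ⟨j, hj.trans i.castSucc_lt_succ, hN⟩

theorem HasFiltration.filt {M : ModuleCat.{u} S} {n : ℕ} {s : Fin n → Λ}
    (h : HasFiltration 𝒵 M s) : Filt (fun N => ∃ j, 𝒵 (s j) N) M := by
  obtain ⟨F, hF, h0, h1, hs⟩ := h
  have := Filt.of_hasFiltration_initial hF h0 hs (Fin.last n)
  rw [h1] at this
  exact (this.mono fun N ⟨j, _, hN⟩ => ⟨j, hN⟩).congr Submodule.topEquiv

/-- A filtration is prolonged by one section on top. -/
theorem HasFiltration.snoc {X Y Z : ModuleCat.{u} S} {f : X →ₗ[S] Y} {g : Y →ₗ[S] Z}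
    (h : SES f g) {n : ℕ} {s : Fin n → Λ} (hX : HasFiltration 𝒵 X s) {a : Λ} (hZ : 𝒵 a Z)
    (hiso : ∀ a (M N : ModuleCat.{u} S), 𝒵 a M → (M ≃ₗ[S] N) → 𝒵 a N) :
    HasFiltration 𝒵 Y (Fin.snoc (α := fun _ => Λ) s a) := by
  obtain ⟨F, hF, h0, h1, hs⟩ := hX
  refine ⟨Fin.snoc (α := fun _ => Submodule S Y) (fun i => (F i).map f) ⊤, ?_, ?_, ?_, ?_⟩
  · refine Fin.monotone_iff_le_succ.2 fun i => ?_
    induction i using Fin.lastCases with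
    | last => simp
    | cast i =>
      rw [Fin.succ_castSucc, Fin.snoc_castSucc, Fin.snoc_castSucc]
      exact Submodule.map_mono (hF i.castSucc_lt_succ.le)
  · have : (0 : Fin (n + 1 + 1)) = (0 : Fin (n + 1)).castSucc := rfl
    rw [this, Fin.snoc_castSucc, h0, Submodule.map_bot]
  · simp
  · intro i
    induction i using Fin.lastCases with
    | last =>
      rw [Fin.succ_last, Fin.snoc_last, Fin.snoc_last, Fin.snoc_castSucc, h1, Submodule.map_top]
      have e1 : ((⊤ : Submodule S Y) ⧸ (LinearMap.range f).submoduleOf ⊤) ≃ₗ[S]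
          (Y ⧸ LinearMap.range f) :=
        Submodule.Quotient.equiv _ _ Submodule.topEquiv (by ext y; simp [Submodule.submoduleOf])
      exact hiso _ _ _ hZ (e1.trans ((Submodule.quotEquivOfEq _ _
        h.exact.linearMap_ker_eq.symm).trans (g.quotKerEquivOfSurjective h.surj))).symm
    | cast i =>
      rw [Fin.succ_castSucc, Fin.snoc_castSucc, Fin.snoc_castSucc, Fin.snoc_castSucc]
      refine hiso _ _ _ (hs i) ?_
      refine Submodule.Quotient.equiv _ _ (Submodule.equivMapOfInjective f h.inj _) ?_
      ext y
      simp only [Submodule.submoduleOf, Submodule.mem_map, Submodule.mem_comap]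
      constructor
      · rintro ⟨x, hx, rfl⟩
        exact ⟨x.1, hx, rfl⟩
      · rintro ⟨x, hx, hxy⟩
        exact ⟨⟨x, hF i.castSucc_lt_succ.le hx⟩, hx, Subtype.ext hxy⟩

theorem hasFiltration_of_subsingleton {M : ModuleCat.{u} S} [Subsingleton M] (s : Fin 0 → Λ) :
    HasFiltration 𝒵 M s :=
  ⟨fun _ => ⊥, fun _ _ _ => le_rfl, rfl, Subsingleton.elim _ _, fun i => i.elim0⟩

/-- Conversely, membership in the extension closure yields a chain of submodules; every label of
the chain labels some section. -/
theorem Filt.exists_hasFiltration {p : Λ → Prop} {M : ModuleCat.{u} S}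
    (h : Filt (fun N => ∃ a, p a ∧ 𝒵 a N) M)
    (hiso : ∀ a (M N : ModuleCat.{u} S), 𝒵 a M → (M ≃ₗ[S] N) → 𝒵 a N) :
    ∃ (n : ℕ) (s : Fin n → Λ), HasFiltration 𝒵 M s ∧ ∀ i, p (s i) := by
  induction h with
  | zero M h => exact ⟨0, Fin.elim0, hasFiltration_of_subsingleton _, fun i => i.elim0⟩
  | cons f g h _ hZ ih =>
    obtain ⟨n, s, hs, hp⟩ := ih
    obtain ⟨a, ha, hZ⟩ := hZ
    refine ⟨n + 1, Fin.snoc (α := fun _ => Λ) s a, hs.snoc h hZ hiso, fun i => ?_⟩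
    induction i using Fin.lastCases with
    | last => simpa using ha
    | cast i => simpa using hp i

end Filtrations

/-! ### Finite length, projective covers and injective hulls -/

section FiniteLength

variable {S : Type u} [Ring S]

/-- Induction on the length of a finitely generated module. -/
theorem length_induction {p : ModuleCat.{u} S → Prop}
    (h : ∀ M : ModuleCat.{u} S, Module.Finite S M →
      (∀ N : ModuleCat.{u} S, Module.Finite S N → Module.length S N < Module.length S M → p N) →
      p M) (M : ModuleCat.{u} S) (hM : Module.Finite S M) : p M := by
  induction hn : Module.length S M using WellFoundedLT.induction generalizing M with
  | ind n ih =>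
    subst hn
    exact h M hM fun N hN hlt => ih _ hlt N hN rfl

variable [IsArtinianRing S]
variable {X Y Z : Type u} [AddCommGroup X] [Module S X] [AddCommGroup Y] [Module S Y]
  [AddCommGroup Z] [Module S Z] {f : X →ₗ[S] Y} {g : Y →ₗ[S] Z}

theorem SES.length_right_lt (h : SES f g) [Module.Finite S Y] [Nontrivial X] :
    Module.length S Z < Module.length S Y := by
  have := h.finite_right
  have := h.finite_left
  rw [Module.length_eq_add_of_exact f g h.inj h.surj h.exact]
  refine ENat.lt_add_left ?_ ?_
  · exact Module.length_ne_top
  · exact Module.length_pos (R := S) (M := X)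

theorem SES.length_left_lt (h : SES f g) [Module.Finite S Y] [Nontrivial Z] :
    Module.length S X < Module.length S Y := by
  have := h.finite_right
  have := h.finite_left
  rw [Module.length_eq_add_of_exact f g h.inj h.surj h.exact, add_comm]
  refine ENat.lt_add_left ?_ ?_
  · exact Module.length_ne_top
  · exact Module.length_pos (R := S) (M := Z)

end FiniteLength

section Covers

variable {S : Type u} [Ring S]

theorem IsProjectiveCover.exists_equiv {P P' M : ModuleCat.{u} S} {p : P →ₗ[S] M}
    {p' : P' →ₗ[S] M} (h : IsProjectiveCover p) (h' : IsProjectiveCover p') :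
    ∃ e : P ≃ₗ[S] P', p' ∘ₗ e.toLinearMap = p := by
  have := h.1
  have := h'.1
  have key : ∀ {P P' : ModuleCat.{u} S} {p : P →ₗ[S] M} {p' : P' →ₗ[S] M},
      Function.Surjective p → IsProjectiveCover p' → ∀ φ : P →ₗ[S] P', p' ∘ₗ φ = p →
      Function.Surjective φ := by
    intro P P' p p' h h' φ hφ
    refine LinearMap.range_eq_top.1 (h'.2.2 _ (eq_top_iff.2 fun y _ => ?_))
    obtain ⟨x, hx⟩ := h (p' y)
    have : p' (φ x) = p' y := by rw [← hx, ← hφ]; rfl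
    exact Submodule.mem_sup.2 ⟨φ x, ⟨x, rfl⟩, y - φ x, by simp [this], by abel⟩
  obtain ⟨φ, hφ⟩ := Module.projective_lifting_property p' p h'.2.1
  have hs := key h.2.1 h' φ hφ
  obtain ⟨ψ, hψ⟩ := Module.projective_lifting_property φ LinearMap.id hs
  have hs' := key h'.2.1 h ψ (by rw [← hφ, LinearMap.comp_assoc, hψ, LinearMap.comp_id])
  refine ⟨LinearEquiv.ofBijective φ ⟨fun x y hxy => ?_, hs⟩, hφ⟩
  obtain ⟨x, rfl⟩ := hs' x
  obtain ⟨y, rfl⟩ := hs' y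
  have h1 : ∀ x, φ (ψ x) = x := fun x => LinearMap.congr_fun hψ x
  rw [h1, h1] at hxy
  exact congrArg ψ hxy

theorem IsInjectiveHull.exists_equiv {I I' M : ModuleCat.{u} S} {j : M →ₗ[S] I}
    {j' : M →ₗ[S] I'} (h : IsInjectiveHull j) (h' : IsInjectiveHull j') :
    ∃ e : I ≃ₗ[S] I', e.toLinearMap ∘ₗ j = j' := by
  have := h.2.1
  have := h'.2.1
  have key : ∀ {I I' : ModuleCat.{u} S} {j : M →ₗ[S] I} {j' : M →ₗ[S] I'},
      IsInjectiveHull j → Function.Injective j' → ∀ φ : I →ₗ[S] I', φ ∘ₗ j = j' →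
      Function.Injective φ := by
    intro I I' j j' h h' φ hφ
    refine LinearMap.ker_eq_bot.1 (h.2.2.2 _ (eq_bot_iff.2 ?_))
    rintro _ ⟨hx, ⟨m, rfl⟩⟩
    have : j' m = 0 := by rw [← hφ]; exact hx
    rw [h' (this.trans (map_zero _).symm), map_zero]
    exact Submodule.zero_mem _
  obtain ⟨φ, hφ⟩ := Module.Injective.extension_property S I' M I j h.2.2.1 j'
  have hs := key h h'.2.2.1 φ hφ
  obtain ⟨ψ, hψ⟩ := Module.Injective.extension_property S I I I' φ hs LinearMap.id
  have hs' := key h' h.2.2.1 ψ (by rw [← hφ, ← LinearMap.comp_assoc, hψ, LinearMap.id_comp])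
  refine ⟨LinearEquiv.ofBijective φ ⟨hs, fun y => ⟨ψ y, hs' ?_⟩⟩, hφ⟩
  exact LinearMap.congr_fun hψ (ψ y)

theorem IsProjectiveCover.finite {P M : ModuleCat.{u} S} {p : P →ₗ[S] M}
    (h : IsProjectiveCover p) [IsSimpleModule S M] : Module.Finite S P := by
  have := IsSimpleModule.nontrivial S M
  obtain ⟨m, hm⟩ := exists_ne (0 : M)
  obtain ⟨x, hx⟩ := h.2.1 m
  have : Submodule.span S {x} = ⊤ := by
    refine h.2.2 _ (eq_top_iff.2 fun y _ => ?_)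
    obtain ⟨s, hs⟩ := IsSimpleModule.toSpanSingleton_surjective S hm (p y)
    refine Submodule.mem_sup.2 ⟨s • x, Submodule.smul_mem _ _ (Submodule.mem_span_singleton_self x),
      y - s • x, ?_, by abel⟩
    have : p y = s • m := hs.symm
    simp [hx, this]
  exact Module.finite_def.2 (this ▸ Submodule.fg_span_singleton x)

/-- A projective cover of a simple module has a unique maximal submodule. -/
theorem IsProjectiveCover.le_ker {P M : ModuleCat.{u} S} {p : P →ₗ[S] M}
    (h : IsProjectiveCover p) [IsSimpleModule S M] {N : Submodule S P} (hN : N ≠ ⊤) :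
    N ≤ LinearMap.ker p := by
  have hc : IsCoatom (LinearMap.ker p) := LinearMap.isCoatom_ker_of_surjective h.2.1
  by_contra hle
  refine hN (h.2.2 N (hc.2 _ (lt_of_le_of_ne le_sup_right fun heq => hle ?_)))
  rw [heq]; exact le_sup_left

/-- Every finitely generated module embeds into a finitely generated injective module. -/
def EnoughFiniteInjectives (S : Type u) [Ring S] : Prop :=
  ∀ (M : Type u) [AddCommGroup M] [Module S M], Module.Finite S M →
    ∃ (I : ModuleCat.{u} S) (i : M →ₗ[S] I),
      Module.Finite S I ∧ Module.Injective S I ∧ Function.Injective i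

theorem injective_of_retract {X Y : Type u} [AddCommGroup X] [Module S X] [AddCommGroup Y]
    [Module S Y] (hX : Module.Injective S X) (i : Y →ₗ[S] X) (r : X →ₗ[S] Y)
    (hr : r ∘ₗ i = LinearMap.id) : Module.Injective S Y := by
  refine ⟨fun A B _ _ _ _ f hf g => ?_⟩
  obtain ⟨h, hh⟩ := hX.out f hf (i ∘ₗ g)
  exact ⟨r ∘ₗ h, fun x => by simpa [hh] using LinearMap.congr_fun hr (g x)⟩

/-- A finitely generated injective module of least length containing `M` is an essential extension
of `M`: otherwise some endomorphism fixes `M` and has a kernel, and by Fitting's lemma it splits off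
a proper injective summand that contains `M`. -/
theorem EnoughFiniteInjectives.exists_injectiveHull [IsArtinianRing S]
    (hS : EnoughFiniteInjectives S) (M : ModuleCat.{u} S) (hM : Module.Finite S M) :
    ∃ (I : ModuleCat.{u} S) (j : M →ₗ[S] I), IsInjectiveHull j := by
  have key : ∀ I : ModuleCat.{u} S, Module.Finite S I → ∀ (i : M →ₗ[S] I), Module.Injective S I →
      Function.Injective i → ∃ (I : ModuleCat.{u} S) (j : M →ₗ[S] I), IsInjectiveHull j := by
    refine length_induction fun I hI ih i hinj hi => ?_
    by_cases hess : ∀ N : Submodule S I, N ⊓ LinearMap.range i = ⊥ → N = ⊥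
    · exact ⟨I, i, hI, hinj, hi, hess⟩
    push Not at hess
    obtain ⟨N, hN, hN0⟩ := hess
    -- an endomorphism of `I` that fixes `M` and kills `N`
    have hinj' : Function.Injective (N.mkQ ∘ₗ i) := by
      rw [← LinearMap.ker_eq_bot, eq_bot_iff]
      intro x hx
      have hx' : i x ∈ N := by simpa using hx
      have : i x ∈ N ⊓ LinearMap.range i := ⟨hx', x, rfl⟩
      rw [hN] at this
      exact hi (by simpa using this)
    obtain ⟨e', he'⟩ := Module.Injective.extension_property S I M (I ⧸ N) _ hinj' i
    let e : Module.End S I := e' ∘ₗ N.mkQ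
    have hei : ∀ x, e (i x) = i x := fun x => LinearMap.congr_fun he' x
    have heN : ∀ x ∈ N, e x = 0 := fun x hx => by
      have : N.mkQ x = 0 := by simpa using hx
      simp only [e, LinearMap.comp_apply, this, map_zero]
    obtain ⟨n, hn0, hn⟩ :
        ∃ n : ℕ, 0 < n ∧ IsCompl (LinearMap.ker (e ^ n)) (LinearMap.range (e ^ n)) :=
      ((Filter.eventually_gt_atTop 0).and (LinearMap.eventually_isCompl_ker_pow_range_pow e)).exists
    have hpow : ∀ (m : ℕ) x, (e ^ m) (i x) = i x := by
      intro m
      induction m with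
      | zero => intro x; simp
      | succ m ihm => intro x; rw [pow_succ, Module.End.mul_apply, hei, ihm]
    let R := LinearMap.range (e ^ n)
    have hR : Module.Injective S R :=
      injective_of_retract hinj R.subtype (R.projectionOnto _ hn.symm) (by
        ext x; simp)
    have hker : Nontrivial (LinearMap.ker (e ^ n)) := by
      rw [Submodule.nontrivial_iff_ne_bot]
      intro hbot
      refine hN0 (eq_bot_iff.2 fun x hx => ?_)
      rw [← hbot, LinearMap.mem_ker, ← Nat.sub_add_cancel hn0, pow_succ, Module.End.mul_apply,
        heN x hx, map_zero]
    refine ih (ModuleCat.of S R) inferInstance ?_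
      (i.codRestrict R fun x => ⟨i x, hpow n x⟩) hR
      (fun x y hxy => hi (congrArg Subtype.val hxy))
    exact Submodule.length_lt fun htop => (Submodule.nontrivial_iff_ne_bot.1 hker) (by
      have := hn.inf_eq_bot
      rwa [show LinearMap.range (e ^ n) = ⊤ from htop, inf_top_eq] at this)
  obtain ⟨I, i, h1, h2, h3⟩ := hS M hM
  exact key I h1 i h2 h3

end Covers

/-! ### Composition factors -/

section Support

variable {S : Type u} [Ring S] {Λ : Type v}

/-- A full set of simple modules together with a projective cover of each of them. -/
structure SimpleCovers (L : Λ → ModuleCat.{u} S) where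
  full : IsFullSetOfSimples L
  /-- The projective cover of the simple module with a given label. -/
  P : Λ → ModuleCat.{u} S
  /-- The covering map. -/
  p : ∀ a, P a →ₗ[S] L a
  cover : ∀ a, IsProjectiveCover (p a)

/-- A finitely generated module `M` all of whose composition factors are of the form `L a` with
`a ∈ A`, expressed by `Hom(P b, M) = 0` for `b ∉ A`. -/
structure SupportedOn {L : Λ → ModuleCat.{u} S} (D : SimpleCovers L) (A : Set Λ)
    (M : Type u) [AddCommGroup M] [Module S M] : Prop where
  finite : Module.Finite S M
  vanish : ∀ b ∉ A, ExtVanish S 0 (D.P b) M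

theorem ExtVanish.hom_eq_zero {X Y : Type u} [AddCommGroup X] [Module S X] [AddCommGroup Y]
    [Module S Y] (h : ExtVanish S 0 X Y) (f : X →ₗ[S] Y) : f = 0 := extVanish_zero_iff.1 h f

variable {X Y Z : Type u} [AddCommGroup X] [Module S X] [AddCommGroup Y] [Module S Y]
  [AddCommGroup Z] [Module S Z] {f : X →ₗ[S] Y} {g : Y →ₗ[S] Z}

theorem ExtVanish.of_injective (h : ExtVanish S 0 Z Y) {f : X →ₗ[S] Y}
    (hf : Function.Injective f) : ExtVanish S 0 Z X :=
  extVanish_zero_iff.2 fun a => LinearMap.ext fun z => hf (by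
    simpa using LinearMap.congr_fun (h.hom_eq_zero (f ∘ₗ a)) z)

theorem ExtVanish.of_surjective (h : ExtVanish S 0 X Z) {f : X →ₗ[S] Y}
    (hf : Function.Surjective f) : ExtVanish S 0 Y Z :=
  extVanish_zero_iff.2 fun a => LinearMap.ext fun y => by
    obtain ⟨x, rfl⟩ := hf y
    simpa using LinearMap.congr_fun (h.hom_eq_zero (a ∘ₗ f)) x

variable {L : Λ → ModuleCat.{u} S}

namespace SimpleCovers

theorem isSimple (D : SimpleCovers L) (a : Λ) : IsSimpleModule S (L a) := D.full.simple a

theorem projective (D : SimpleCovers L) (a : Λ) : Module.Projective S (D.P a) := (D.cover a).1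

theorem finite_P (D : SimpleCovers L) (a : Λ) : Module.Finite S (D.P a) :=
  have := D.isSimple a
  (D.cover a).finite

theorem finite_L (D : SimpleCovers L) (a : Λ) : Module.Finite S (L a) :=
  have := D.finite_P a
  Module.Finite.of_surjective _ (D.cover a).2.1

theorem p_ne_zero (D : SimpleCovers L) (a : Λ) : D.p a ≠ 0 := by
  have := D.isSimple a
  have := IsSimpleModule.nontrivial S (L a)
  intro h
  obtain ⟨x, hx⟩ := exists_ne (0 : L a)
  obtain ⟨y, rfl⟩ := (D.cover a).2.1 x
  exact hx (by rw [h]; rfl)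

theorem not_extVanish_P (D : SimpleCovers L) {a : Λ} {f : D.P a →ₗ[S] X} (hf : f ≠ 0) :
    ¬ ExtVanish S 0 (D.P a) X :=
  fun h => hf (h.hom_eq_zero f)

theorem extVanish_P (D : SimpleCovers L) (a : Λ) (n : ℕ) : ExtVanish S (n + 1) (D.P a) X :=
  have := D.projective a
  extVanish_of_projective n

/-- A nonzero quotient of `P a` maps onto `L a`. -/
theorem exists_desc (D : SimpleCovers L) {a : Λ} {q : D.P a →ₗ[S] X} (hq : Function.Surjective q)
    [Nontrivial X] :
    ∃ r : X →ₗ[S] L a, r ∘ₗ q = D.p a ∧ Function.Surjective r := by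
  have := D.isSimple a
  have hk : LinearMap.ker q ≤ LinearMap.ker (D.p a) := (D.cover a).le_ker fun htop => by
    obtain ⟨x, hx⟩ := exists_ne (0 : X)
    obtain ⟨y, rfl⟩ := hq x
    exact hx (LinearMap.mem_ker.1 (htop ▸ Submodule.mem_top))
  obtain ⟨r, hr⟩ := (SES.ker_subtype hq).desc (D.p a) fun x => hk x.2
  refine ⟨r, hr, fun y => ?_⟩
  obtain ⟨x, rfl⟩ := (D.cover a).2.1 y
  exact ⟨q x, LinearMap.congr_fun hr x⟩

theorem eq_of_hom_L_ne_zero (D : SimpleCovers L) {a b : Λ} {f : L a →ₗ[S] L b} (hf : f ≠ 0) :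
    a = b := by
  have := D.isSimple a
  have := D.isSimple b
  exact D.full.injective a b ⟨LinearEquiv.ofBijective f (LinearMap.bijective_of_ne_zero hf)⟩

theorem eq_of_hom_P_ne_zero (D : SimpleCovers L) {a b : Λ} {f : D.P a →ₗ[S] L b} (hf : f ≠ 0) :
    a = b := by
  have := D.isSimple b
  have := IsSimpleModule.nontrivial S (L b)
  have := D.isSimple a
  obtain ⟨r, hr, hs⟩ := D.exists_desc (LinearMap.surjective_of_ne_zero hf)
  refine (D.eq_of_hom_L_ne_zero (f := r) fun h => ?_).symm
  exact D.p_ne_zero a (by rw [← hr, h, LinearMap.zero_comp])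

theorem extVanish_P_L (D : SimpleCovers L) {a b : Λ} (h : a ≠ b) : ExtVanish S 0 (D.P a) (L b) :=
  extVanish_zero_iff.2 fun _ => by_contra fun hf => h (D.eq_of_hom_P_ne_zero hf)

variable (X) in
theorem exists_simple_quot (D : SimpleCovers L) [Module.Finite S X] [Nontrivial X] :
    ∃ (a : Λ) (q : X →ₗ[S] L a), Function.Surjective q := by
  obtain ⟨m, hm⟩ := IsCoatomic.exists_coatom (Submodule S X)
  have hs : IsSimpleModule S (X ⧸ m) := isSimpleModule_iff_isCoatom.2 hm
  obtain ⟨a, ⟨e⟩⟩ := D.full.exhaustive (ModuleCat.of S (X ⧸ m)) hs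
  exact ⟨a, e.toLinearMap ∘ₗ m.mkQ, e.surjective.comp m.mkQ_surjective⟩

section Artinian

variable [IsArtinianRing S]

variable (X) in
theorem exists_simple_sub (D : SimpleCovers L) [Module.Finite S X] [Nontrivial X] :
    ∃ (a : Λ) (j : L a →ₗ[S] X), Function.Injective j := by
  obtain ⟨m, hm⟩ := IsAtomic.exists_atom (Submodule S X)
  have hs : IsSimpleModule S m := isSimpleModule_iff_isAtom.2 hm
  obtain ⟨a, ⟨e⟩⟩ := D.full.exhaustive (ModuleCat.of S m) hs
  exact ⟨a, m.subtype ∘ₗ e.symm.toLinearMap, m.injective_subtype.comp e.symm.injective⟩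

end Artinian

end SimpleCovers

variable {D : SimpleCovers L} {A B : Set Λ}

namespace SupportedOn

theorem mono (h : SupportedOn D A X) (hAB : A ⊆ B) : SupportedOn D B X :=
  ⟨h.finite, fun b hb => h.vanish b fun hA => hb (hAB hA)⟩

theorem of_surjective (h : SupportedOn D A X) {f : X →ₗ[S] Y} (hf : Function.Surjective f) :
    SupportedOn D A Y := by
  have := h.finite
  refine ⟨Module.Finite.of_surjective f hf, fun b hb => ?_⟩
  exact (SES.ker_subtype hf).cov_right _ (h.vanish b hb) (D.extVanish_P b 0)

theorem of_injective [IsNoetherianRing S] (h : SupportedOn D A Y) {f : X →ₗ[S] Y}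
    (hf : Function.Injective f) : SupportedOn D A X := by
  have := h.finite
  exact ⟨Module.Finite.of_injective f hf, fun b hb => (h.vanish b hb).of_injective hf⟩

theorem congr (h : SupportedOn D A X) (e : X ≃ₗ[S] Y) : SupportedOn D A Y :=
  h.of_surjective (f := e.toLinearMap) e.surjective

theorem of_ses (h : SES f g) (hX : SupportedOn D A X) (hZ : SupportedOn D A Z) :
    SupportedOn D A Y := by
  have := hX.finite
  have := hZ.finite
  exact ⟨h.finite_mid, fun b hb => h.cov_mid _ (hX.vanish b hb) (hZ.vanish b hb)⟩

theorem of_subsingleton [Subsingleton X] : SupportedOn D A X :=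
  ⟨inferInstance, fun _ _ => extVanish_subsingleton_right 0⟩

theorem simple {D : SimpleCovers L} {a : Λ} (ha : a ∈ A) : SupportedOn D A (L a) :=
  ⟨D.finite_L a, fun _ hb => D.extVanish_P_L fun h => hb (h ▸ ha)⟩

theorem of_filt {𝒳 : ModuleCat.{u} S → Prop} {M : ModuleCat.{u} S} (h : Filt 𝒳 M)
    (hX : ∀ N, 𝒳 N → SupportedOn D A N) : SupportedOn D A M := by
  induction h with
  | zero M h => exact of_subsingleton
  | cons f g h _ hZ ih => exact of_ses h ih (hX _ hZ)

theorem mem_of_hom_ne_zero (h : SupportedOn D A X) {a : Λ} {f : D.P a →ₗ[S] X} (hf : f ≠ 0) :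
    a ∈ A := by_contra fun ha => hf ((h.vanish a ha).hom_eq_zero f)

theorem mem_of_surjective (h : SupportedOn D A X) {a : Λ} {f : X →ₗ[S] L a}
    (hf : Function.Surjective f) : a ∈ A := by
  by_contra ha
  exact D.p_ne_zero a (((h.of_surjective hf).vanish a ha).hom_eq_zero _)

theorem mem_of_injective (h : SupportedOn D A X) {a : Λ} {f : L a →ₗ[S] X}
    (hf : Function.Injective f) : a ∈ A := by
  by_contra ha
  exact D.p_ne_zero a (((h.vanish a ha).of_injective hf).hom_eq_zero _)

variable [IsArtinianRing S]

theorem filt {M : ModuleCat.{u} S} (h : SupportedOn D A M) :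
    Filt (fun N => ∃ a, a ∈ A ∧ Nonempty (N ≃ₗ[S] L a)) M := by
  have hfin := h.finite
  revert h
  refine length_induction (p := fun M => SupportedOn D A M →
    Filt (fun N => ∃ a, a ∈ A ∧ Nonempty (N ≃ₗ[S] L a)) M) (fun M hM ih h => ?_) M hfin
  by_cases hs : Subsingleton M
  · exact .zero _ hs
  rw [not_subsingleton_iff_nontrivial] at hs
  obtain ⟨a, q, hq⟩ := D.exists_simple_quot M
  have := D.isSimple a
  have := IsSimpleModule.nontrivial S (L a)
  have hses := SES.ker_subtype hq
  exact .cons (X := ModuleCat.of S (LinearMap.ker q)) _ _ hses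
    (ih _ hses.finite_left hses.length_left_lt (h.of_injective hses.inj))
    ⟨a, h.mem_of_surjective hq, ⟨LinearEquiv.refl S _⟩⟩

end SupportedOn

theorem iso_closed_L (a : Λ) (M N : ModuleCat.{u} S) (h : Nonempty (M ≃ₗ[S] L a))
    (e : M ≃ₗ[S] N) : Nonempty (N ≃ₗ[S] L a) := h.map fun e' => e.symm.trans e'

theorem factorsLE_iff_filt [PartialOrder Λ] {a : Λ} {M : ModuleCat.{u} S} :
    FactorsLE L a M ↔ Filt (fun N => ∃ b, b ≤ a ∧ Nonempty (N ≃ₗ[S] L b)) M := by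
  constructor
  · rintro ⟨n, s, hs, hle⟩
    exact hs.filt.mono fun N ⟨j, hj⟩ => ⟨s j, hle j, hj⟩
  · intro h
    obtain ⟨n, s, hs, hle⟩ := h.exists_hasFiltration iso_closed_L
    exact ⟨n, s, hs, hle⟩

theorem FactorsLE.congr [PartialOrder Λ] {a : Λ} {M N : ModuleCat.{u} S} (h : FactorsLE L a M)
    (e : M ≃ₗ[S] N) : FactorsLE L a N :=
  factorsLE_iff_filt.2 ((factorsLE_iff_filt.1 h).congr e)

theorem factorsLE_iff [IsArtinianRing S] [PartialOrder Λ] (D : SimpleCovers L) {a : Λ}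
    {M : ModuleCat.{u} S} : FactorsLE L a M ↔ SupportedOn D (Set.Iic a) M := by
  rw [factorsLE_iff_filt]
  refine ⟨fun h => .of_filt h ?_, fun h => h.filt⟩
  rintro N ⟨b, hb, ⟨e⟩⟩
  exact (SupportedOn.simple (D := D) (A := Set.Iic a) hb).congr e.symm

end Support

section Multiplicity

variable {S : Type u} [Ring S]
variable {P X Y Z : Type u} [AddCommGroup P] [Module S P] [AddCommGroup X] [Module S X]
  [AddCommGroup Y] [Module S Y] [AddCommGroup Z] [Module S Z] {f : X →ₗ[S] Y} {g : Y →ₗ[S] Z}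

/-- `Hom(P, M)` is a simple module over `End(P)ᵒᵖ`. If `P` is a projective cover of a simple module
`L`, this says that `L` occurs exactly once as a composition factor of `M`. -/
structure Once (S : Type u) [Ring S] (P M : Type u) [AddCommGroup P] [Module S P]
    [AddCommGroup M] [Module S M] : Prop where
  exists_ne : ∃ f : P →ₗ[S] M, f ≠ 0
  exists_comp : ∀ f g : P →ₗ[S] M, f ≠ 0 → ∃ h : P →ₗ[S] P, g = f ∘ₗ h

namespace Once

theorem left (h : SES f g) (hY : Once S P Y) (hZ : ExtVanish S 0 P Z) : Once S P X := by
  constructor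
  · obtain ⟨a, ha⟩ := hY.exists_ne
    obtain ⟨b, rfl⟩ := h.lift a fun w => by
      simpa using LinearMap.congr_fun (hZ.hom_eq_zero (g ∘ₗ a)) w
    exact ⟨b, fun hb => ha (by rw [hb, LinearMap.comp_zero])⟩
  · intro a b ha
    obtain ⟨c, hc⟩ := hY.exists_comp (f ∘ₗ a) (f ∘ₗ b) fun h0 => ha (LinearMap.ext fun x =>
      h.inj (by simpa using LinearMap.congr_fun h0 x))
    exact ⟨c, LinearMap.ext fun x => h.inj (by simpa using LinearMap.congr_fun hc x)⟩

theorem right [Module.Projective S P] (h : SES f g) (hY : Once S P Y) (hX : ExtVanish S 0 P X) :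
    Once S P Z := by
  constructor
  · obtain ⟨a, ha⟩ := hY.exists_ne
    refine ⟨g ∘ₗ a, fun h0 => ha ?_⟩
    obtain ⟨b, rfl⟩ := h.lift a fun w => by simpa using LinearMap.congr_fun h0 w
    rw [hX.hom_eq_zero b, LinearMap.comp_zero]
  · intro a b ha
    obtain ⟨a', rfl⟩ := Module.projective_lifting_property g a h.surj
    obtain ⟨b', rfl⟩ := Module.projective_lifting_property g b h.surj
    obtain ⟨c, hc⟩ := hY.exists_comp a' b' fun h0 => ha (by rw [h0, LinearMap.comp_zero])
    exact ⟨c, by rw [hc, LinearMap.comp_assoc]⟩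

/-- A simple composition factor of multiplicity one cannot occur both in a submodule and in the
quotient by it. -/
theorem extVanish_or [Module.Projective S P] (h : SES f g) (hY : Once S P Y) :
    ExtVanish S 0 P X ∨ ExtVanish S 0 P Z := by
  by_contra hcon
  push Not at hcon
  obtain ⟨h1, h2⟩ := hcon
  simp only [extVanish_zero_iff, not_forall] at h1 h2
  obtain ⟨a, ha⟩ := h1
  obtain ⟨b, hb⟩ := h2
  obtain ⟨b', rfl⟩ := Module.projective_lifting_property g b h.surj
  obtain ⟨c, rfl⟩ := hY.exists_comp (f ∘ₗ a) b' fun h0 => ha (LinearMap.ext fun x =>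
      h.inj (by simpa using LinearMap.congr_fun h0 x))
  exact hb (by rw [← LinearMap.comp_assoc, ← LinearMap.comp_assoc, h.comp_eq_zero,
    LinearMap.zero_comp, LinearMap.zero_comp])

theorem congr (h : Once S P X) (e : X ≃ₗ[S] Y) : Once S P Y :=
  h.left (SES.of_equiv e.symm) (extVanish_subsingleton_right 0)

end Once

variable {Λ : Type v} {L : Λ → ModuleCat.{u} S}

theorem SimpleCovers.once_L (D : SimpleCovers L) (a : Λ) : Once S (D.P a) (L a) := by
  have := D.isSimple a
  have := D.projective a
  exact ⟨⟨D.p a, D.p_ne_zero a⟩, fun f g hf =>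
    (Module.projective_lifting_property f g (LinearMap.surjective_of_ne_zero hf)).imp
      fun _ h => h.symm⟩

theorem SimpleCovers.once_of_compositionFactors (D : SimpleCovers L) {a : Λ} {M : ModuleCat.{u} S}
    {n : ℕ} {s : Fin n → Λ} (h : HasCompositionFactors L M s) (ha : ∃! i, s i = a) :
    Once S (D.P a) M := by
  obtain ⟨F, hF, h0, h1, hs⟩ := h
  obtain ⟨i, hi, huniq⟩ := ha
  have hi' : s i = a := hi
  have hP := D.projective a
  have hlow : ExtVanish S 0 (D.P a) (F i.castSucc) := by
    refine (Filt.of_hasFiltration_initial (𝒵 := fun a N => Nonempty (N ≃ₗ[S] L a))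
      hF h0 hs i.castSucc).extVanish_right ?_
    rintro N ⟨j, hj, ⟨e⟩⟩
    refine (D.extVanish_P_L fun h => ?_).congr_right e.symm
    exact hj.ne (congrArg Fin.castSucc (huniq j h.symm))
  have hsimple := D.once_L (s i)
  rw [hi'] at hsimple
  have e1 := (hs i).some
  rw [hi'] at e1
  have hmid : Once S (D.P a) (F i.succ) := by
    have hses := SES.submoduleOf (hF i.castSucc_lt_succ.le)
    have h3 := hsimple.congr e1.symm
    constructor
    · obtain ⟨f, hf⟩ := h3.exists_ne
      obtain ⟨f', rfl⟩ := Module.projective_lifting_property _ f hses.surj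
      exact ⟨f', fun h => hf (by rw [h, LinearMap.comp_zero])⟩
    · intro f g hf
      obtain ⟨c, hc⟩ := h3.exists_comp (((F i.castSucc).submoduleOf (F i.succ)).mkQ ∘ₗ f)
        (((F i.castSucc).submoduleOf (F i.succ)).mkQ ∘ₗ g) fun h0 => hf (by
          obtain ⟨b, rfl⟩ := hses.lift f fun w => LinearMap.congr_fun h0 w
          rw [hlow.hom_eq_zero b, LinearMap.comp_zero])
      obtain ⟨b, hb⟩ := hses.lift (g - f ∘ₗ c) fun w => by
        rw [LinearMap.sub_apply, map_sub, sub_eq_zero]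
        exact LinearMap.congr_fun hc w
      rw [hlow.hom_eq_zero b, LinearMap.comp_zero] at hb
      exact ⟨c, (sub_eq_zero.1 hb.symm)⟩
  have hup : ∀ j : Fin (n + 1), i.succ ≤ j → Once S (D.P a) (F j) := by
    intro j
    induction j using Fin.induction with
    | zero => exact fun h => absurd h (by simp)
    | succ j ih =>
      intro hj
      rcases hj.eq_or_lt with h | h
      · rw [← h]; exact hmid
      · have hj' : i.succ ≤ j.castSucc := by
          rw [Fin.le_def]; rw [Fin.lt_def] at h; simp at h ⊢; omega
        have hses := SES.submoduleOf (hF j.castSucc_lt_succ.le)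
        have hv : ExtVanish S 0 (D.P a)
            (F j.succ ⧸ (F j.castSucc).submoduleOf (F j.succ)) := by
          refine (D.extVanish_P_L fun h => ?_).congr_right (hs j).some.symm
          have := huniq j h.symm
          subst this
          rw [Fin.le_def] at hj'; simp at hj'
        have hO := ih hj'
        constructor
        · obtain ⟨f, hf⟩ := hO.exists_ne
          refine ⟨Submodule.inclusion (hF j.castSucc_lt_succ.le) ∘ₗ f, fun h => hf ?_⟩
          exact LinearMap.ext fun x => hses.inj (by simpa using LinearMap.congr_fun h x)
        · intro f g hf
          obtain ⟨f', rfl⟩ := hses.lift f fun w => LinearMap.congr_fun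
            (hv.hom_eq_zero (((F j.castSucc).submoduleOf (F j.succ)).mkQ ∘ₗ f)) w
          obtain ⟨g', rfl⟩ := hses.lift g fun w => LinearMap.congr_fun
            (hv.hom_eq_zero (((F j.castSucc).submoduleOf (F j.succ)).mkQ ∘ₗ g)) w
          obtain ⟨c, rfl⟩ := hO.exists_comp f' g' fun h => hf (by rw [h, LinearMap.comp_zero])
          exact ⟨c, rfl⟩
  have := hup (Fin.last n) (Fin.le_last _)
  rw [h1] at this
  exact this.congr Submodule.topEquiv

end Multiplicity

/-! ### Standard and costandard modules -/

section Standard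

theorem exists_largest_supported {S : Type u} [Ring S] [IsArtinianRing S] {Λ : Type v}
    {L : Λ → ModuleCat.{u} S} (D : SimpleCovers L) (A : Set Λ) (M : Type u)
    [AddCommGroup M] [Module S M] [Module.Finite S M] :
    ∃ N : Submodule S M, SupportedOn D A N ∧ ∀ K : Submodule S M, SupportedOn D A K → K ≤ N := by
  obtain ⟨N, hN, hmax⟩ := set_has_maximal_iff_noetherian.2 (inferInstance : IsNoetherian S M)
    {N : Submodule S M | SupportedOn D A N} ⟨⊥, SupportedOn.of_subsingleton⟩
  refine ⟨N, hN, fun K hK => ?_⟩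
  have hsup : SupportedOn D A (N ⊔ K : Submodule S M) := by
    have h1 : SupportedOn D A (N × K) := SupportedOn.of_ses (SES.inl_snd S N K) hN hK
    have hr : LinearMap.range (LinearMap.coprod N.subtype K.subtype) = N ⊔ K := by
      rw [LinearMap.range_coprod, Submodule.range_subtype, Submodule.range_subtype]
    rw [← hr]
    exact h1.of_surjective (LinearMap.surjective_rangeRestrict _)
  by_contra hle
  exact hmax _ hsup (lt_of_le_of_ne le_sup_left fun heq => hle (heq ▸ le_sup_right))

variable {S : Type u} [Ring S] {Λ : Type v} [PartialOrder Λ] {L : Λ → ModuleCat.{u} S}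

theorem IsStandard.congr {a : Λ} {M N : ModuleCat.{u} S} (h : IsStandard L a M) (e : M ≃ₗ[S] N) :
    IsStandard L a N := by
  obtain ⟨P, p, q, hp, hq, hle, hmax⟩ := h
  refine ⟨P, p, e.toLinearMap ∘ₗ q, hp, e.surjective.comp hq, hle.congr e, fun K hK => ?_⟩
  rw [LinearEquiv.ker_comp]
  exact hmax K hK

theorem IsCostandard.congr {a : Λ} {M N : ModuleCat.{u} S} (h : IsCostandard L a M)
    (e : M ≃ₗ[S] N) : IsCostandard L a N := by
  obtain ⟨I, j, i, hj, hi, hle, hmax⟩ := h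
  refine ⟨I, j, i ∘ₗ e.symm.toLinearMap, hj, hi.comp e.symm.injective, hle.congr e, fun K hK => ?_⟩
  rw [LinearMap.range_comp, LinearEquiv.range, Submodule.map_top]
  exact hmax K hK

theorem IsStandard.unique {a : Λ} {M N : ModuleCat.{u} S} (h : IsStandard L a M)
    (h' : IsStandard L a N) : Nonempty (M ≃ₗ[S] N) := by
  obtain ⟨P, p, q, hp, hq, hle, hmax⟩ := h
  obtain ⟨P', p', q', hp', hq', hle', hmax'⟩ := h'
  obtain ⟨e, -⟩ := hp.exists_equiv hp'
  have hs : Function.Surjective (q' ∘ₗ e.toLinearMap) := hq'.comp e.surjective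
  have hs' : Function.Surjective (q ∘ₗ e.symm.toLinearMap) := hq.comp e.symm.surjective
  have h1 := hmax (LinearMap.ker (q' ∘ₗ e.toLinearMap))
    (hle'.congr ((q' ∘ₗ e.toLinearMap).quotKerEquivOfSurjective hs).symm)
  have h2 := hmax' (LinearMap.ker (q ∘ₗ e.symm.toLinearMap))
    (hle.congr ((q ∘ₗ e.symm.toLinearMap).quotKerEquivOfSurjective hs').symm)
  have h3 : LinearMap.ker q = LinearMap.ker (q' ∘ₗ e.toLinearMap) :=
    le_antisymm h1 fun x hx => by simpa using h2 hx
  exact ⟨(q.quotKerEquivOfSurjective hq).symm.trans ((Submodule.quotEquivOfEq _ _ h3).trans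
    ((q' ∘ₗ e.toLinearMap).quotKerEquivOfSurjective hs))⟩

theorem IsCostandard.unique {a : Λ} {M N : ModuleCat.{u} S} (h : IsCostandard L a M)
    (h' : IsCostandard L a N) : Nonempty (M ≃ₗ[S] N) := by
  obtain ⟨I, j, i, hj, hi, hle, hmax⟩ := h
  obtain ⟨I', j', i', hj', hi', hle', hmax'⟩ := h'
  obtain ⟨e, -⟩ := hj.exists_equiv hj'
  have hs : Function.Injective (e.symm.toLinearMap ∘ₗ i') := e.symm.injective.comp hi'
  have hs' : Function.Injective (e.toLinearMap ∘ₗ i) := e.injective.comp hi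
  have h1 := hmax (LinearMap.range (e.symm.toLinearMap ∘ₗ i'))
    (hle'.congr (LinearEquiv.ofInjective _ hs))
  have h2 := hmax' (LinearMap.range (e.toLinearMap ∘ₗ i))
    (hle.congr (LinearEquiv.ofInjective _ hs'))
  have h3 : LinearMap.range i = LinearMap.range (e.symm.toLinearMap ∘ₗ i') := by
    refine le_antisymm ?_ h1
    rintro _ ⟨x, rfl⟩
    obtain ⟨y, hy⟩ := h2 ⟨x, rfl⟩
    exact ⟨y, by simp [hy]⟩
  exact ⟨(LinearEquiv.ofInjective i hi).trans ((LinearEquiv.ofEq _ _ h3).trans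
    (LinearEquiv.ofInjective _ hs).symm)⟩

/-- The top section of a nonempty filtration. -/
theorem HasFiltration.exists_top {Λ : Type v} {𝒵 : Λ → ModuleCat.{u} S → Prop}
    {M : ModuleCat.{u} S} {m : ℕ} {s : Fin (m + 1) → Λ} (h : HasFiltration 𝒵 M s)
    (hiso : ∀ a (M N : ModuleCat.{u} S), 𝒵 a M → (M ≃ₗ[S] N) → 𝒵 a N) :
    ∃ N : Submodule S M, 𝒵 (s (Fin.last m)) (ModuleCat.of S (M ⧸ N)) ∧
      Filt (fun K => ∃ j, j ≠ Fin.last m ∧ 𝒵 (s j) K) (ModuleCat.of S N) := by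
  obtain ⟨F, hF, h0, h1, hs⟩ := h
  refine ⟨F (Fin.last m).castSucc, ?_, ?_⟩
  · have := hs (Fin.last m)
    rw [Fin.succ_last, h1] at this
    exact hiso _ _ _ this (Submodule.Quotient.equiv _ _
      (Submodule.topEquiv : (⊤ : Submodule S M) ≃ₗ[S] M) (by ext y; simp [Submodule.submoduleOf]))
  · refine (Filt.of_hasFiltration_initial hF h0 hs (Fin.last m).castSucc).mono ?_
    rintro N ⟨j, hj, hN⟩
    exact ⟨j, fun h => hj.ne (congrArg _ h), hN⟩

/-- A quasi-hereditary structure in terms of chosen modules: for every label the projective cover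
`P a` with its standard quotient `q a : P a → Δ a`, and the injective hull `I a` with its
costandard submodule `i a : C a → I a`. -/
structure HighestWeight (L : Λ → ModuleCat.{u} S) extends SimpleCovers L where
  /-- The standard module. -/
  Δ : Λ → ModuleCat.{u} S
  /-- The quotient map onto the standard module. -/
  q : ∀ a, P a →ₗ[S] Δ a
  q_surj : ∀ a, Function.Surjective (q a)
  supp_Δ : ∀ a, SupportedOn toSimpleCovers (Set.Iic a) (Δ a)
  q_max : ∀ a (N : Submodule S (P a)), SupportedOn toSimpleCovers (Set.Iic a) (P a ⧸ N) →
    LinearMap.ker (q a) ≤ N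
  once_Δ : ∀ a, Once S (P a) (Δ a)
  filt_ker : ∀ a, Filt (fun N => ∃ b, a < b ∧ Nonempty (N ≃ₗ[S] Δ b))
    (ModuleCat.of S (LinearMap.ker (q a)))
  /-- The injective hull of the simple module. -/
  I : Λ → ModuleCat.{u} S
  /-- The embedding of the simple module into its injective hull. -/
  j : ∀ a, L a →ₗ[S] I a
  hull : ∀ a, IsInjectiveHull (j a)
  /-- The costandard module. -/
  C : Λ → ModuleCat.{u} S
  /-- The embedding of the costandard module into the injective hull. -/
  i : ∀ a, C a →ₗ[S] I a
  i_inj : ∀ a, Function.Injective (i a)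
  supp_C : ∀ a, SupportedOn toSimpleCovers (Set.Iic a) (C a)
  i_max : ∀ a (N : Submodule S (I a)), SupportedOn toSimpleCovers (Set.Iic a) N →
    N ≤ LinearMap.range (i a)

/-- The choice of standard and costandard modules in a quasi-hereditary algebra. In the given
filtration of `P a` the top section has to be the standard quotient `Δ a`. -/
theorem IsQuasiHereditary.nonempty_highestWeight [IsArtinianRing S] (h : IsQuasiHereditary L)
    (hS : EnoughFiniteInjectives S) : Nonempty (HighestWeight L) := by
  choose P p hcov n s hfil huniq hle using h.projective
  let D : SimpleCovers L := ⟨h.full, P, p, hcov⟩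
  choose E hE honce using h.standard
  have hsec : ∀ a, ∃ N : Submodule S (P a), IsStandard L a (ModuleCat.of S (P a ⧸ N)) ∧
      Filt (fun K => ∃ b, a < b ∧ Nonempty (K ≃ₗ[S] E b)) (ModuleCat.of S N) := by
    intro a
    obtain ⟨i, hi, hi'⟩ := huniq a
    have hn : n a ≠ 0 := fun h0 => by
      have := i.2
      omega
    obtain ⟨m, hm⟩ := Nat.exists_eq_succ_of_ne_zero hn
    have hfa := hfil a
    have hla := hle a
    revert i
    generalize s a = t at *
    revert t
    rw [hm]
    intro t hfa hla i hi hi'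
    obtain ⟨N, hN, hfN⟩ := hfa.exists_top fun _ _ _ h e => h.congr e
    have hlast : t (Fin.last m) = a := by
      obtain ⟨P', p', q', hp', hq', hle', hmax'⟩ := hN
      have hsimp := h.full.simple (t (Fin.last m))
      have := IsSimpleModule.nontrivial S (L (t (Fin.last m)))
      have hker : LinearMap.ker q' ≤ LinearMap.ker p' := by
        refine hmax' _ ((factorsLE_iff D).2 ((SupportedOn.simple (D := D)
          (A := Set.Iic (t (Fin.last m))) (Set.mem_Iic.2 le_rfl)).congr
          (p'.quotKerEquivOfSurjective hp'.2.1).symm))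
      obtain ⟨r, hr⟩ := (SES.ker_subtype hq').desc p' fun x => hker x.2
      refine (D.eq_of_hom_P_ne_zero (f := r ∘ₗ N.mkQ) fun h0 => ?_).symm
      obtain ⟨y, hy⟩ := exists_ne (0 : L (t (Fin.last m)))
      obtain ⟨x, rfl⟩ := hp'.2.1 y
      obtain ⟨z, hz⟩ := N.mkQ_surjective (q' x)
      have h2 := LinearMap.congr_fun h0 z
      rw [LinearMap.comp_apply, hz] at h2
      exact hy ((LinearMap.congr_fun hr x).symm.trans h2)
    refine ⟨N, hlast ▸ hN, hfN.mono ?_⟩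
    rintro K ⟨j, hj, hK⟩
    refine ⟨t j, lt_of_le_of_ne (hla j) fun heq => hj ?_, hK.unique (hE _)⟩
    rw [hi' j heq.symm, hi' _ hlast]
  choose N hN hfN using hsec
  have hmax : ∀ a (K : Submodule S (P a)), SupportedOn D (Set.Iic a) (P a ⧸ K) → N a ≤ K := by
    intro a K hK
    obtain ⟨P', p', q', hp', hq', hle', hmax'⟩ := hN a
    obtain ⟨e, -⟩ := hp'.exists_equiv (hcov a)
    have hPfin := D.finite_P a
    -- `e` carries the kernel of the standard quotient to `N a`, by comparing lengths
    let K' := (LinearMap.ker q').map e.toLinearMap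
    have hK' : ∀ K : Submodule S (P a), SupportedOn D (Set.Iic a) (P a ⧸ K) → K' ≤ K := by
      intro K hK
      rw [Submodule.map_le_iff_le_comap]
      refine hmax' _ ((factorsLE_iff D).2 (hK.congr (LinearEquiv.symm ?_)))
      exact Submodule.Quotient.equiv _ _ e (Submodule.map_comap_eq_of_surjective e.surjective K)
    have hKN : K' ≤ N a := hK' _ ((factorsLE_iff D).1 hle')
    have e1 : (P a ⧸ K') ≃ₗ[S] (P a ⧸ N a) :=
      (Submodule.Quotient.equiv (LinearMap.ker q') K' e rfl).symm.trans
        (q'.quotKerEquivOfSurjective hq')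
    have hinj : Function.Injective (e1.symm.toLinearMap ∘ₗ Submodule.factor hKN) :=
      IsNoetherian.injective_of_surjective_endomorphism _
        (e1.symm.surjective.comp (Submodule.factor_surjective hKN))
    have hNK : N a ≤ K' := by
      intro x hx
      have h0 : (e1.symm.toLinearMap ∘ₗ Submodule.factor hKN) (K'.mkQ x) = 0 := by
        have : Submodule.factor hKN (K'.mkQ x) = 0 := by
          rw [Submodule.factor_mk, Submodule.mkQ_apply, Submodule.Quotient.mk_eq_zero]
          exact hx
        rw [LinearMap.comp_apply, this, map_zero]
      simpa using hinj (h0.trans (map_zero _).symm)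
    exact hNK.trans (hK' K hK)
  have hΔE : ∀ a, Nonempty ((P a ⧸ N a) ≃ₗ[S] E a) := fun a => (hN a).unique (hE a)
  have hhull : ∀ a, ∃ (I : ModuleCat.{u} S) (j : L a →ₗ[S] I), IsInjectiveHull j := fun a =>
    hS.exists_injectiveHull (L a) (D.finite_L a)
  choose I j hI using hhull
  have hlarge : ∀ a, ∃ N : Submodule S (I a), SupportedOn D (Set.Iic a) N ∧
      ∀ K : Submodule S (I a), SupportedOn D (Set.Iic a) K → K ≤ N := fun a =>
    have := (hI a).1
    exists_largest_supported D (Set.Iic a) (I a)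
  choose C hC hCmax using hlarge
  exact ⟨{
    toSimpleCovers := D
    Δ := fun a => ModuleCat.of S (P a ⧸ N a)
    q := fun a => (N a).mkQ
    q_surj := fun a => (N a).mkQ_surjective
    supp_Δ := fun a => by
      obtain ⟨_, _, _, _, _, hle', _⟩ := hN a
      exact (factorsLE_iff D).1 hle'
    q_max := fun a K hK => by
      rw [Submodule.ker_mkQ]
      exact hmax a K hK
    once_Δ := fun a => by
      obtain ⟨_, _, hs, ho⟩ := honce a
      exact (D.once_of_compositionFactors hs ho).congr (hΔE a).some.symm
    filt_ker := fun a => by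
      refine ((hfN a).mono ?_).congr (LinearEquiv.ofEq _ _ (Submodule.ker_mkQ _).symm)
      rintro K ⟨b, hb, ⟨e⟩⟩
      exact ⟨b, hb, ⟨e.trans (hΔE b).some.symm⟩⟩
    I := I
    j := j
    hull := hI
    C := fun a => ModuleCat.of S (C a)
    i := fun a => (C a).subtype
    i_inj := fun a => (C a).injective_subtype
    supp_C := hC
    i_max := fun a K hK => by
      rw [Submodule.range_subtype]
      exact hCmax a K hK }⟩

namespace HighestWeight

theorem isStandard_iff [IsArtinianRing S] (D : HighestWeight L) {a : Λ} {M : ModuleCat.{u} S} :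
    IsStandard L a M ↔ Nonempty (M ≃ₗ[S] D.Δ a) := by
  have h : IsStandard L a (D.Δ a) := ⟨D.P a, D.p a, D.q a, D.cover a, D.q_surj a,
    (factorsLE_iff D.toSimpleCovers).2 (D.supp_Δ a),
    fun N hN => D.q_max a N ((factorsLE_iff D.toSimpleCovers).1 hN)⟩
  exact ⟨fun h' => h'.unique h, fun ⟨e⟩ => h.congr e.symm⟩

theorem isCostandard_iff [IsArtinianRing S] (D : HighestWeight L) {a : Λ} {M : ModuleCat.{u} S} :
    IsCostandard L a M ↔ Nonempty (M ≃ₗ[S] D.C a) := by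
  have h : IsCostandard L a (D.C a) := ⟨D.I a, D.j a, D.i a, D.hull a, D.i_inj a,
    (factorsLE_iff D.toSimpleCovers).2 (D.supp_C a),
    fun N hN => D.i_max a N ((factorsLE_iff D.toSimpleCovers).1 hN)⟩
  exact ⟨fun h' => h'.unique h, fun ⟨e⟩ => h.congr e.symm⟩

/-- The modules with a filtration by standard modules `Δ a` with `a ∈ A`. -/
def FiltΔ (D : HighestWeight L) (A : Set Λ) : ModuleCat.{u} S → Prop :=
  Filt fun N => ∃ a, a ∈ A ∧ Nonempty (N ≃ₗ[S] D.Δ a)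

/-- The modules with a filtration by costandard modules `C a` with `a ∈ A`. -/
def FiltC (D : HighestWeight L) (A : Set Λ) : ModuleCat.{u} S → Prop :=
  Filt fun N => ∃ a, a ∈ A ∧ Nonempty (N ≃ₗ[S] D.C a)

theorem hasDeltaFiltration_iff [IsArtinianRing S] (D : HighestWeight L) {M : ModuleCat.{u} S} :
    HasDeltaFiltration L M ↔ D.FiltΔ Set.univ M := by
  constructor
  · rintro ⟨n, s, hs⟩
    exact hs.filt.mono fun N ⟨j, hj⟩ => ⟨s j, trivial, D.isStandard_iff.1 hj⟩
  · intro h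
    obtain ⟨n, s, hs, -⟩ := (h.mono fun N ⟨a, ha, hN⟩ => ⟨a, ha, D.isStandard_iff.2 hN⟩ :
      Filt (fun N => ∃ a, a ∈ Set.univ ∧ IsStandard L a N) M).exists_hasFiltration
        fun _ _ _ h e => h.congr e
    exact ⟨n, s, hs⟩

theorem hasNablaFiltration_iff [IsArtinianRing S] (D : HighestWeight L) {M : ModuleCat.{u} S} :
    HasNablaFiltration L M ↔ D.FiltC Set.univ M := by
  constructor
  · rintro ⟨n, s, hs⟩
    exact hs.filt.mono fun N ⟨j, hj⟩ => ⟨s j, trivial, D.isCostandard_iff.1 hj⟩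
  · intro h
    obtain ⟨n, s, hs, -⟩ := (h.mono fun N ⟨a, ha, hN⟩ => ⟨a, ha, D.isCostandard_iff.2 hN⟩ :
      Filt (fun N => ∃ a, a ∈ Set.univ ∧ IsCostandard L a N) M).exists_hasFiltration
        fun _ _ _ h e => h.congr e
    exact ⟨n, s, hs⟩

end HighestWeight

end Standard

/-! ### Extensions between standard and costandard modules -/

section HomologicalTheory

variable {S : Type u} [Ring S] {Λ : Type v}

theorem SimpleCovers.finite_labels [IsArtinianRing S] {L : Λ → ModuleCat.{u} S}
    (D : SimpleCovers L) : Finite Λ := by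
  have h : SupportedOn D Set.univ S := ⟨inferInstance, fun b hb => absurd trivial hb⟩
  obtain ⟨n, s, hs, -⟩ := (SupportedOn.filt (M := ModuleCat.of S S) h).exists_hasFiltration
    iso_closed_L
  have h' : SupportedOn D (Set.range s) S := by
    refine SupportedOn.of_filt (M := ModuleCat.of S S) hs.filt ?_
    rintro N ⟨j, ⟨e⟩⟩
    exact (SupportedOn.simple (D := D) (A := Set.range s) ⟨j, rfl⟩).congr e.symm
  refine Finite.of_surjective s fun a => ?_
  have := D.isSimple a
  have := IsSimpleModule.nontrivial S (L a)
  obtain ⟨x, hx⟩ := exists_ne (0 : L a)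
  exact h'.mem_of_surjective (IsSimpleModule.toSpanSingleton_surjective S hx)

variable [PartialOrder Λ] {L : Λ → ModuleCat.{u} S}
variable {X Y Z : Type u} [AddCommGroup X] [Module S X] [AddCommGroup Y] [Module S Y]
  [AddCommGroup Z] [Module S Z] {f : X →ₗ[S] Y} {g : Y →ₗ[S] Z}

namespace HighestWeight

theorem finite_Δ (D : HighestWeight L) (a : Λ) : Module.Finite S (D.Δ a) := (D.supp_Δ a).finite

theorem finite_C (D : HighestWeight L) (a : Λ) : Module.Finite S (D.C a) := (D.supp_C a).finite

theorem ses_q (D : HighestWeight L) (a : Λ) : SES (LinearMap.ker (D.q a)).subtype (D.q a) :=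
  SES.ker_subtype (D.q_surj a)

theorem ses_i (D : HighestWeight L) (a : Λ) : SES (D.i a) (LinearMap.range (D.i a)).mkQ :=
  SES.range_mkQ (D.i_inj a)

/-- The kernel of `P a → Δ a` has no quotient with composition factors `L b`, `b ≤ a`: such a
quotient would enlarge the largest quotient `Δ a` of `P a`. -/
theorem extVanish_ker_q [IsArtinianRing S] (D : HighestWeight L) {a : Λ}
    (hY : SupportedOn D.toSimpleCovers (Set.Iic a) Y) :
    ExtVanish S 0 (LinearMap.ker (D.q a)) Y := by
  refine extVanish_zero_iff.2 fun f => LinearMap.ext fun x => ?_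
  let N := (LinearMap.ker f).map (LinearMap.ker (D.q a)).subtype
  have hN : N ≤ LinearMap.ker (D.q a) := Submodule.map_subtype_le _ _
  have hsupp : SupportedOn D.toSimpleCovers (Set.Iic a) (D.P a ⧸ N) := by
    obtain ⟨g, hg⟩ := (SES.mkQ N).desc (D.q a) fun x => hN x.2
    have hg' : ∀ x, g (N.mkQ x) = D.q a x := fun x => LinearMap.congr_fun hg x
    have hgs : Function.Surjective g := fun y => by
      obtain ⟨x, rfl⟩ := D.q_surj a y
      exact ⟨N.mkQ x, hg' x⟩
    refine SupportedOn.of_ses (SES.ker_subtype hgs) ?_ (D.supp_Δ a)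
    let φ : LinearMap.ker (D.q a) →ₗ[S] LinearMap.ker g :=
      (N.mkQ ∘ₗ (LinearMap.ker (D.q a)).subtype).codRestrict _ fun x => by
        rw [LinearMap.mem_ker, LinearMap.comp_apply, hg']
        exact x.2
    have hφ : Function.Surjective φ := by
      rintro ⟨y, hy⟩
      obtain ⟨x, rfl⟩ := N.mkQ_surjective y
      rw [LinearMap.mem_ker, hg'] at hy
      exact ⟨⟨x, hy⟩, rfl⟩
    obtain ⟨r, hr⟩ := (SES.ker_subtype (LinearMap.surjective_rangeRestrict f)).desc φ fun x => by
      refine Subtype.ext ((Submodule.Quotient.mk_eq_zero N).2 ⟨x.1, ?_, rfl⟩)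
      exact congrArg Subtype.val x.2
    refine (hY.of_injective (LinearMap.range f).injective_subtype).of_surjective (f := r) fun y => ?_
    obtain ⟨x, rfl⟩ := hφ y
    exact ⟨_, LinearMap.congr_fun hr x⟩
  obtain ⟨y, hy, hyx⟩ := D.q_max a N hsupp x.2
  rw [← Subtype.ext hyx]
  exact hy

theorem extVanish_coker_i [IsArtinianRing S] (D : HighestWeight L) {a : Λ}
    (hY : SupportedOn D.toSimpleCovers (Set.Iic a) Y) :
    ExtVanish S 0 Y (D.I a ⧸ LinearMap.range (D.i a)) := by
  refine extVanish_zero_iff.2 fun f => LinearMap.ext fun y => ?_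
  let R := LinearMap.range (D.i a)
  let N := (LinearMap.range f).comap R.mkQ
  have hRN : R ≤ N := fun x hx => by
    have : R.mkQ x = 0 := by simpa using hx
    rw [Submodule.mem_comap, this]
    exact Submodule.zero_mem _
  let g : N →ₗ[S] LinearMap.range f :=
    (R.mkQ ∘ₗ N.subtype).codRestrict _ fun x => x.2
  have hses : SES (Submodule.inclusion hRN) g := by
    refine ⟨Submodule.inclusion_injective _, fun x => ⟨fun hx => ?_, ?_⟩, ?_⟩
    · exact ⟨⟨x.1, (Submodule.Quotient.mk_eq_zero R).1 (congrArg Subtype.val hx)⟩, rfl⟩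
    · rintro ⟨x, rfl⟩
      exact Subtype.ext ((Submodule.Quotient.mk_eq_zero R).2 x.2)
    · rintro ⟨y, hy⟩
      obtain ⟨x, rfl⟩ := R.mkQ_surjective y
      exact ⟨⟨x, hy⟩, rfl⟩
  have hsupp : SupportedOn D.toSimpleCovers (Set.Iic a) N :=
    SupportedOn.of_ses hses ((D.supp_C a).congr (LinearEquiv.ofInjective _ (D.i_inj a)))
      (hY.of_surjective (LinearMap.surjective_rangeRestrict f))
  obtain ⟨z, hz⟩ := R.mkQ_surjective (f y)
  have hzN : z ∈ N := ⟨y, hz.symm⟩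
  rw [← hz]
  exact (Submodule.Quotient.mk_eq_zero R).2 (D.i_max a N hsupp hzN)

theorem extVanish_Δ_of_supp [IsArtinianRing S] (D : HighestWeight L) {a : Λ}
    (hY : SupportedOn D.toSimpleCovers (Set.Iic a) Y) : ExtVanish S 1 (D.Δ a) Y :=
  (D.ses_q a).con_right _ (D.extVanish_ker_q hY) (D.extVanish_P a 0)

theorem extVanish_C_of_supp [IsArtinianRing S] (D : HighestWeight L) {a : Λ}
    (hY : SupportedOn D.toSimpleCovers (Set.Iic a) Y) : ExtVanish S 1 Y (D.C a) :=
  (D.ses_i a).cov_left _ (D.extVanish_coker_i hY) (extVanish_of_injective (D.hull a).2.1 0)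

theorem exists_socle [IsArtinianRing S] (D : HighestWeight L) (a : Λ) :
    ∃ l : L a →ₗ[S] D.C a, D.i a ∘ₗ l = D.j a := by
  refine (D.ses_i a).lift (D.j a) fun w => ?_
  rw [Submodule.mkQ_apply, Submodule.Quotient.mk_eq_zero]
  refine D.i_max a (LinearMap.range (D.j a)) ?_ ⟨w, rfl⟩
  exact (SupportedOn.simple (A := Set.Iic a) (Set.mem_Iic.2 le_rfl)).of_surjective
    (LinearMap.surjective_rangeRestrict _)

theorem nontrivial_L (D : HighestWeight L) (a : Λ) : Nontrivial (L a) :=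
  have := D.isSimple a
  IsSimpleModule.nontrivial S (L a)

theorem nontrivial_Δ (D : HighestWeight L) (a : Λ) : Nontrivial (D.Δ a) := by
  obtain ⟨f, hf⟩ := (D.once_Δ a).exists_ne
  by_contra h
  rw [not_nontrivial_iff_subsingleton] at h
  exact hf (Subsingleton.elim _ _)

theorem exists_head (D : HighestWeight L) (a : Λ) :
    ∃ r : D.Δ a →ₗ[S] L a, r ∘ₗ D.q a = D.p a :=
  have := D.nontrivial_Δ a
  (D.exists_desc (D.q_surj a)).imp fun _ h => h.1

/-- The inclusion of the socle of the costandard module. -/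
noncomputable def l [IsArtinianRing S] (D : HighestWeight L) (a : Λ) : L a →ₗ[S] D.C a :=
  (D.exists_socle a).choose

/-- The projection of the standard module onto its head. -/
noncomputable def r (D : HighestWeight L) (a : Λ) : D.Δ a →ₗ[S] L a := (D.exists_head a).choose

theorem i_l [IsArtinianRing S] (D : HighestWeight L) {a : Λ} (x : L a) :
    D.i a (D.l a x) = D.j a x := LinearMap.congr_fun (D.exists_socle a).choose_spec x

theorem r_q (D : HighestWeight L) {a : Λ} (x : D.P a) : D.r a (D.q a x) = D.p a x :=
  LinearMap.congr_fun (D.exists_head a).choose_spec x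

theorem l_inj [IsArtinianRing S] (D : HighestWeight L) (a : Λ) : Function.Injective (D.l a) :=
  fun x y h => (D.hull a).2.2.1 (by rw [← D.i_l, ← D.i_l, h])

theorem r_surj (D : HighestWeight L) (a : Λ) : Function.Surjective (D.r a) := fun y => by
  obtain ⟨x, rfl⟩ := (D.cover a).2.1 y
  exact ⟨D.q a x, D.r_q x⟩

theorem nontrivial_C [IsArtinianRing S] (D : HighestWeight L) (a : Λ) : Nontrivial (D.C a) :=
  have := D.nontrivial_L a
  (D.l_inj a).nontrivial

theorem ses_l [IsArtinianRing S] (D : HighestWeight L) (a : Λ) :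
    SES (D.l a) (LinearMap.range (D.l a)).mkQ := SES.range_mkQ (D.l_inj a)

theorem ses_r (D : HighestWeight L) (a : Λ) : SES (LinearMap.ker (D.r a)).subtype (D.r a) :=
  SES.ker_subtype (D.r_surj a)

theorem range_l_le [IsArtinianRing S] (D : HighestWeight L) {a : Λ} {N : Submodule S (D.C a)}
    (hN : N ≠ ⊥) : LinearMap.range (D.l a) ≤ N := by
  have := D.isSimple a
  have h1 : N.map (D.i a) ≠ ⊥ := fun h => hN (eq_bot_iff.2 fun x hx => by
    have : D.i a x ∈ N.map (D.i a) := ⟨x, hx, rfl⟩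
    rw [h, Submodule.mem_bot] at this
    exact D.i_inj a (this.trans (map_zero _).symm))
  have h2 : N.map (D.i a) ⊓ LinearMap.range (D.j a) ≠ ⊥ := fun h => h1 ((D.hull a).2.2.2 _ h)
  obtain ⟨_, ⟨⟨y, hy, hyx⟩, ⟨x, rfl⟩⟩, hne⟩ := Submodule.exists_mem_ne_zero_of_ne_bot h2
  have hx : D.l a x ∈ N := by
    rwa [← D.i_inj a (hyx.trans (D.i_l x).symm)]
  have hcomap : N.comap (D.l a) = ⊤ :=
    (eq_bot_or_eq_top (N.comap (D.l a))).resolve_left fun h => by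
      have : x ∈ N.comap (D.l a) := hx
      rw [h, Submodule.mem_bot] at this
      exact hne (by rw [this, map_zero])
  rintro _ ⟨z, rfl⟩
  have : z ∈ N.comap (D.l a) := hcomap ▸ Submodule.mem_top
  exact this

/-- A map out of `C a` that does not kill the socle is injective. -/
theorem injective_of_comp_l_ne_zero [IsArtinianRing S] (D : HighestWeight L) {a : Λ}
    {f : D.C a →ₗ[S] X} (hf : f ∘ₗ D.l a ≠ 0) : Function.Injective f := by
  rw [← LinearMap.ker_eq_bot]
  by_contra h
  exact hf (LinearMap.ext fun x => D.range_l_le h ⟨x, rfl⟩)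

/-- A nonzero map to `C a` hits the socle. -/
theorem exists_lift_socle [IsArtinianRing S] (D : HighestWeight L) {a : Λ} {g : X →ₗ[S] D.C a}
    (hg : g ≠ 0) : ∃ f : D.P a →ₗ[S] X, g ∘ₗ f = D.l a ∘ₗ D.p a := by
  have := D.projective a
  have hle := D.range_l_le (N := LinearMap.range g) fun h => hg (LinearMap.range_eq_bot.1 h)
  obtain ⟨f, hf⟩ := Module.projective_lifting_property g.rangeRestrict
    ((D.l a ∘ₗ D.p a).codRestrict (LinearMap.range g) fun x => hle ⟨_, rfl⟩)
    (LinearMap.surjective_rangeRestrict g)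
  exact ⟨f, LinearMap.ext fun x => congrArg Subtype.val (LinearMap.congr_fun hf x)⟩

theorem l_comp_p_ne_zero [IsArtinianRing S] (D : HighestWeight L) (a : Λ) :
    D.l a ∘ₗ D.p a ≠ 0 := fun h => D.p_ne_zero a (LinearMap.ext fun x => D.l_inj a (by
      simpa using LinearMap.congr_fun h x))

/-- A map to `Δ a` that is nonzero on the head is surjective. -/
theorem surjective_of_r_comp_ne_zero (D : HighestWeight L) {a : Λ}
    {f : X →ₗ[S] D.Δ a} (hf : D.r a ∘ₗ f ≠ 0) : Function.Surjective f := by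
  have := D.isSimple a
  by_contra h
  have htop : (LinearMap.range f).comap (D.q a) ≠ ⊤ := fun htop => h fun y => by
    obtain ⟨x, rfl⟩ := D.q_surj a y
    have : x ∈ (LinearMap.range f).comap (D.q a) := htop ▸ Submodule.mem_top
    exact this
  have hle := (D.cover a).le_ker htop
  refine hf (LinearMap.ext fun x => ?_)
  obtain ⟨y, hy⟩ := D.q_surj a (f x)
  have hy' : y ∈ (LinearMap.range f).comap (D.q a) := ⟨x, hy.symm⟩
  rw [LinearMap.comp_apply, ← hy, D.r_q]
  exact hle hy'

theorem extVanish_Δ_C_zero [IsArtinianRing S] (D : HighestWeight L) {a b : Λ} (h : b ≠ a) :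
    ExtVanish S 0 (D.Δ b) (D.C a) := by
  refine extVanish_zero_iff.2 fun f => by_contra fun hf => h ?_
  have h1 : b ∈ Set.Iic a := (D.supp_C a).mem_of_hom_ne_zero (f := f ∘ₗ D.q b) fun h0 => hf
    (LinearMap.ext fun x => by
      obtain ⟨y, rfl⟩ := D.q_surj b x
      simpa using LinearMap.congr_fun h0 y)
  obtain ⟨g, hg⟩ := D.exists_lift_socle hf
  have h2 : a ∈ Set.Iic b := (D.supp_Δ b).mem_of_hom_ne_zero (f := g) fun h0 =>
    D.l_comp_p_ne_zero a (by rw [← hg, h0, LinearMap.comp_zero])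
  exact le_antisymm h1 h2

theorem extVanish_ker_q_C [IsArtinianRing S] (D : HighestWeight L) {a b : Λ} (h : ¬ b < a) :
    ExtVanish S 0 (LinearMap.ker (D.q b)) (D.C a) := by
  refine (D.filt_ker b).extVanish_left ?_
  rintro N ⟨c, hc, ⟨e⟩⟩
  exact (D.extVanish_Δ_C_zero (b := c) (a := a) fun hca => h (hca ▸ hc)).congr_left e.symm

/-- `Ext^n(Δ b, C a) = 0` for `n > 0`. For `n = 1` and `b ≤ a` this is the maximality of `C a`; in
the remaining cases it follows from the filtration of the kernel of `P b → Δ b`. -/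
theorem extVanish_Δ_C [IsArtinianRing S] (D : HighestWeight L) (a b : Λ) (n : ℕ) :
    ExtVanish S (n + 1) (D.Δ b) (D.C a) := by
  induction n generalizing b with
  | zero =>
    by_cases h : b < a
    · exact D.extVanish_C_of_supp ((D.supp_Δ b).mono (Set.Iic_subset_Iic.2 h.le))
    · exact (D.ses_q b).con_right _ (D.extVanish_ker_q_C h) (D.extVanish_P b 0)
  | succ n ih =>
    refine (D.ses_q b).con_right _ ((D.filt_ker b).extVanish_left ?_) (D.extVanish_P b _)
    rintro N ⟨c, hc, ⟨e⟩⟩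
    exact (ih c).congr_left e.symm

theorem FiltΔ.extVanish_C [IsArtinianRing S] {D : HighestWeight L} {A : Set Λ}
    {M : ModuleCat.{u} S} (h : D.FiltΔ A M) (a : Λ) (n : ℕ) : ExtVanish S (n + 1) M (D.C a) :=
  h.extVanish_left fun _ ⟨b, _, ⟨e⟩⟩ => (D.extVanish_Δ_C a b n).congr_left e.symm

theorem FiltC.extVanish_Δ [IsArtinianRing S] {D : HighestWeight L} {A : Set Λ}
    {M : ModuleCat.{u} S} (h : D.FiltC A M) (a : Λ) (n : ℕ) : ExtVanish S (n + 1) (D.Δ a) M :=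
  h.extVanish_right fun _ ⟨b, _, ⟨e⟩⟩ => (D.extVanish_Δ_C b a n).congr_right e.symm

theorem FiltΔ.extVanish_filtC [IsArtinianRing S] {D : HighestWeight L} {A B : Set Λ}
    {M N : ModuleCat.{u} S} (h : D.FiltΔ A M) (h' : D.FiltC B N) (n : ℕ) :
    ExtVanish S (n + 1) M N :=
  h'.extVanish_right fun _ ⟨b, _, ⟨e⟩⟩ => (h.extVanish_C b n).congr_right e.symm

theorem FiltC.finite {D : HighestWeight L} {A : Set Λ} {M : ModuleCat.{u} S} (h : D.FiltC A M) :
    Module.Finite S M :=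
  Filt.finite h fun _ ⟨a, _, ⟨e⟩⟩ => have := D.finite_C a; Module.Finite.equiv e.symm

theorem FiltΔ.finite {D : HighestWeight L} {A : Set Λ} {M : ModuleCat.{u} S} (h : D.FiltΔ A M) :
    Module.Finite S M :=
  Filt.finite h fun _ ⟨a, _, ⟨e⟩⟩ => have := D.finite_Δ a; Module.Finite.equiv e.symm

theorem supp_ker_r [IsArtinianRing S] (D : HighestWeight L) (a : Λ) :
    SupportedOn D.toSimpleCovers (Set.Iio a) (LinearMap.ker (D.r a)) := by
  have := D.projective a
  have h := (D.supp_Δ a).of_injective (LinearMap.ker (D.r a)).injective_subtype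
  refine ⟨h.finite, fun b hb => ?_⟩
  by_cases hba : b = a
  · subst hba
    exact ((D.once_Δ b).extVanish_or (D.ses_r b)).resolve_right
      (D.not_extVanish_P (D.p_ne_zero b))
  · exact h.vanish b fun hle => hb (lt_of_le_of_ne hle hba)

/-- `L a` occurs exactly once in `C a`: a map `P a → C a` factors through `Δ a`, and a nonzero map
`Δ a → C a` has its image in the socle since `L a` occurs only once in `Δ a`. -/
theorem supp_coker_l [IsArtinianRing S] (D : HighestWeight L) (a : Λ) :
    SupportedOn D.toSimpleCovers (Set.Iio a) (D.C a ⧸ LinearMap.range (D.l a)) := by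
  have := D.projective a
  have h := (D.supp_C a).of_surjective (LinearMap.range (D.l a)).mkQ_surjective
  refine ⟨h.finite, fun b hb => ?_⟩
  by_cases hba : b = a
  · subst hba
    refine extVanish_zero_iff.2 fun f => ?_
    obtain ⟨f', rfl⟩ := Module.projective_lifting_property _ f (D.ses_l b).surj
    have hk := (D.extVanish_ker_q_C (lt_irrefl b)).hom_eq_zero
      (f' ∘ₗ (LinearMap.ker (D.q b)).subtype)
    obtain ⟨g, rfl⟩ := (D.ses_q b).desc f' fun x => LinearMap.congr_fun hk x
    by_cases hg : g = 0
    · rw [hg, LinearMap.zero_comp, LinearMap.comp_zero]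
    obtain ⟨h', hh'⟩ := D.exists_lift_socle hg
    obtain ⟨c, hc⟩ := (D.once_Δ b).exists_comp h' (D.q b) fun h0 =>
      D.l_comp_p_ne_zero b (by rw [← hh', h0, LinearMap.comp_zero])
    rw [hc, ← LinearMap.comp_assoc c, hh', LinearMap.comp_assoc, ← LinearMap.comp_assoc,
      (D.ses_l b).comp_eq_zero, LinearMap.zero_comp]
  · exact h.vanish b fun hle => hb (lt_of_le_of_ne hle hba)

/-! ### Homological characterization of modules with a filtration -/

section Criteria

variable [IsArtinianRing S]

/-- A finitely generated module `M` has a costandard filtration if `Ext¹(Δ a, M) = 0` for all `a`: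
for a minimal `a` with `Hom(Δ a, M) ≠ 0`, the embedding of `L a` into `M` extends to `C a`. -/
theorem filtC_of_extVanish (D : HighestWeight L) {M : ModuleCat.{u} S} (hM : Module.Finite S M)
    (h : ∀ a, ExtVanish S 1 (D.Δ a) M) : D.FiltC Set.univ M := by
  have := D.finite_labels
  revert h
  refine length_induction (p := fun M => (∀ a, ExtVanish S 1 (D.Δ a) M) → D.FiltC Set.univ M)
    (fun M hM ih h => ?_) M hM
  by_cases hs : Subsingleton M
  · exact .zero _ hs
  rw [not_subsingleton_iff_nontrivial] at hs
  have hex : ∃ a, ∃ f : D.Δ a →ₗ[S] M, f ≠ 0 := by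
    obtain ⟨a, f, hf⟩ := D.exists_simple_sub M
    have := D.nontrivial_Δ a
    have := D.nontrivial_L a
    refine ⟨a, f ∘ₗ D.r a, fun h0 => ?_⟩
    obtain ⟨x, hx⟩ := exists_ne (0 : L a)
    obtain ⟨y, rfl⟩ := D.r_surj a x
    exact hx (hf (by simpa using LinearMap.congr_fun h0 y))
  obtain ⟨a, ⟨f, hf⟩, hmin⟩ := (wellFounded_lt (α := Λ)).has_min
    {a | ∃ f : D.Δ a →ₗ[S] M, f ≠ 0} hex
  have hL0 : ∀ c < a, ExtVanish S 0 (L c) M := fun c hc => by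
    refine ExtVanish.of_surjective (f := D.r c) ?_ (D.r_surj c)
    exact extVanish_zero_iff.2 fun g => by_contra fun hg => hmin c ⟨g, hg⟩ hc
  have hY0 : ∀ Y : ModuleCat.{u} S, SupportedOn D.toSimpleCovers (Set.Iio a) Y →
      ExtVanish S 0 Y M := fun Y hY => hY.filt.extVanish_left fun N ⟨c, hc, ⟨e⟩⟩ =>
    (hL0 c hc).congr_left e.symm
  obtain ⟨f', rfl⟩ := (D.ses_r a).desc f fun x => LinearMap.congr_fun
    ((hY0 (ModuleCat.of S (LinearMap.ker (D.r a))) (D.supp_ker_r a)).hom_eq_zero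
      (f ∘ₗ (LinearMap.ker (D.r a)).subtype)) x
  have hf' : f' ≠ 0 := fun h0 => hf (by rw [h0, LinearMap.zero_comp])
  have hL1 : ∀ c < a, ExtVanish S 1 (L c) M := fun c hc =>
    (D.ses_r c).con_right _ (hY0 (ModuleCat.of S (LinearMap.ker (D.r c)))
      ((D.supp_ker_r c).mono (Set.Iio_subset_Iio hc.le))) (h c)
  have hcok : ExtVanish S 1 (D.C a ⧸ LinearMap.range (D.l a)) M :=
    (SupportedOn.filt (M := ModuleCat.of S (D.C a ⧸ LinearMap.range (D.l a)))
      (D.supp_coker_l a)).extVanish_left fun N ⟨c, hc, ⟨e⟩⟩ => (hL1 c hc).congr_left e.symm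
  obtain ⟨g, hg⟩ := (D.ses_l a).exists_extension hcok f'
  have hginj := D.injective_of_comp_l_ne_zero (hg ▸ hf')
  have hses := SES.range_mkQ hginj
  have := D.nontrivial_C a
  refine Filt.of_ses (Z := ModuleCat.of S (M ⧸ LinearMap.range g)) hses
    (.of_mem ⟨a, trivial, ⟨LinearEquiv.refl S _⟩⟩)
    (ih _ hses.finite_right hses.length_right_lt fun b => ?_)
  exact hses.cov_right _ (h b) (D.extVanish_Δ_C a b 1)

/-- The dual of `filtC_of_extVanish`. -/
theorem filtΔ_of_extVanish (D : HighestWeight L) {M : ModuleCat.{u} S} (hM : Module.Finite S M)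
    (h : ∀ a, ExtVanish S 1 M (D.C a)) : D.FiltΔ Set.univ M := by
  have := D.finite_labels
  revert h
  refine length_induction (p := fun M => (∀ a, ExtVanish S 1 M (D.C a)) → D.FiltΔ Set.univ M)
    (fun M hM ih h => ?_) M hM
  by_cases hs : Subsingleton M
  · exact .zero _ hs
  rw [not_subsingleton_iff_nontrivial] at hs
  have hex : ∃ a, ∃ f : M →ₗ[S] D.C a, f ≠ 0 := by
    obtain ⟨a, f, hf⟩ := D.exists_simple_quot M
    have := D.nontrivial_L a
    refine ⟨a, D.l a ∘ₗ f, fun h0 => ?_⟩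
    obtain ⟨x, hx⟩ := exists_ne (0 : L a)
    obtain ⟨y, rfl⟩ := hf x
    exact hx (D.l_inj a (by simpa using LinearMap.congr_fun h0 y))
  obtain ⟨a, ⟨f, hf⟩, hmin⟩ := (wellFounded_lt (α := Λ)).has_min
    {a | ∃ f : M →ₗ[S] D.C a, f ≠ 0} hex
  have hL0 : ∀ c < a, ExtVanish S 0 M (L c) := fun c hc => by
    refine ExtVanish.of_injective (f := D.l c) ?_ (D.l_inj c)
    exact extVanish_zero_iff.2 fun g => by_contra fun hg => hmin c ⟨g, hg⟩ hc
  have hY0 : ∀ Y : ModuleCat.{u} S, SupportedOn D.toSimpleCovers (Set.Iio a) Y →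
      ExtVanish S 0 M Y := fun Y hY => hY.filt.extVanish_right fun N ⟨c, hc, ⟨e⟩⟩ =>
    (hL0 c hc).congr_right e.symm
  obtain ⟨f', rfl⟩ := (D.ses_l a).lift f fun x => LinearMap.congr_fun
    ((hY0 (ModuleCat.of S (D.C a ⧸ LinearMap.range (D.l a))) (D.supp_coker_l a)).hom_eq_zero
      ((LinearMap.range (D.l a)).mkQ ∘ₗ f)) x
  have hf' : f' ≠ 0 := fun h0 => hf (by rw [h0, LinearMap.comp_zero])
  have hL1 : ∀ c < a, ExtVanish S 1 M (L c) := fun c hc =>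
    (D.ses_l c).cov_left _ (hY0 (ModuleCat.of S (D.C c ⧸ LinearMap.range (D.l c)))
      ((D.supp_coker_l c).mono (Set.Iio_subset_Iio hc.le))) (h c)
  have hker : ExtVanish S 1 M (LinearMap.ker (D.r a)) :=
    (SupportedOn.filt (M := ModuleCat.of S (LinearMap.ker (D.r a)))
      (D.supp_ker_r a)).extVanish_right fun N ⟨c, hc, ⟨e⟩⟩ => (hL1 c hc).congr_right e.symm
  obtain ⟨g, hg⟩ := (D.ses_r a).exists_lift hker f'
  have hgsurj := D.surjective_of_r_comp_ne_zero (hg ▸ hf')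
  have hses := SES.ker_subtype hgsurj
  have := D.nontrivial_Δ a
  refine Filt.cons (X := ModuleCat.of S (LinearMap.ker g)) _ _ hses
    (ih _ hses.finite_left hses.length_left_lt fun b => ?_)
    ⟨a, trivial, ⟨LinearEquiv.refl S _⟩⟩
  exact hses.con_left _ (h b) (D.extVanish_Δ_C b a 1)

theorem filtC_of_injective (D : HighestWeight L) {M : ModuleCat.{u} S} (hM : Module.Finite S M)
    (h : Module.Injective S M) : D.FiltC Set.univ M :=
  D.filtC_of_extVanish hM fun _ => extVanish_of_injective h 0

theorem filtΔ_of_projective (D : HighestWeight L) {M : ModuleCat.{u} S} (hM : Module.Finite S M)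
    (h : Module.Projective S M) : D.FiltΔ Set.univ M :=
  D.filtΔ_of_extVanish hM fun _ => extVanish_of_projective 0

/-- A quasi-hereditary algebra has finite global dimension. The projective dimension is bounded on
the standard modules by descending induction on the label, since the kernel of `P a → Δ a` has
sections `Δ b` with `b > a`, and then on the simple modules by ascending induction, since the kernel
of `Δ a → L a` has composition factors `L b` with `b < a`. -/
theorem exists_globalDimension (D : HighestWeight L) :
    ∃ n : ℕ, ∀ X Y : ModuleCat.{u} S, Module.Finite S X → ∀ j, n < j → ExtVanish S j X Y := by
  have := D.finite_labels
  have := Fintype.ofFinite Λ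
  -- a common bound for the finitely many modules labelled by a subset of `Λ`
  have huni : ∀ (F : Λ → ModuleCat.{u} S) (A : Set Λ),
      (∀ a ∈ A, ∃ n : ℕ, ∀ (Y : ModuleCat.{u} S) (j : ℕ), n < j → ExtVanish S j (F a) Y) →
      ∃ n : ℕ, ∀ M : ModuleCat.{u} S,
        Filt (fun N : ModuleCat.{u} S => ∃ a, a ∈ A ∧ Nonempty (N ≃ₗ[S] F a)) M →
        ∀ (Y : ModuleCat.{u} S) (j : ℕ), n < j → ExtVanish S j M Y := by
    classical
    intro F A hA
    choose! n hn using hA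
    refine ⟨Finset.univ.sup n, fun M hM Y j hj => hM.extVanish_left ?_⟩
    rintro N ⟨a, ha, ⟨e⟩⟩
    exact (hn a ha Y j ((Finset.le_sup (Finset.mem_univ a)).trans_lt hj)).congr_left e.symm
  have hΔ : ∀ a, ∃ n : ℕ, ∀ (Y : ModuleCat.{u} S) (j : ℕ), n < j → ExtVanish S j (D.Δ a) Y := by
    intro a
    induction a using WellFoundedGT.induction with
    | ind a ih =>
      obtain ⟨n, hn⟩ := huni D.Δ (Set.Ioi a) ih
      refine ⟨n + 1, fun Y j hj => ?_⟩
      obtain ⟨j, rfl⟩ := Nat.exists_eq_succ_of_ne_zero (by omega : j ≠ 0)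
      exact (D.ses_q a).con_right _ (hn _ (D.filt_ker a) Y j (by omega)) (D.extVanish_P a _)
  have hL : ∀ a, ∃ n : ℕ, ∀ (Y : ModuleCat.{u} S) (j : ℕ), n < j → ExtVanish S j (L a) Y := by
    intro a
    induction a using WellFoundedLT.induction with
    | ind a ih =>
      obtain ⟨n, hn⟩ := huni L (Set.Iio a) ih
      obtain ⟨m, hm⟩ := hΔ a
      refine ⟨n + m + 1, fun Y j hj => ?_⟩
      obtain ⟨j, rfl⟩ := Nat.exists_eq_succ_of_ne_zero (by omega : j ≠ 0)
      exact (D.ses_r a).con_right _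
        (hn _ (SupportedOn.filt (M := ModuleCat.of S (LinearMap.ker (D.r a))) (D.supp_ker_r a))
          Y j (by omega)) (hm Y _ (by omega))
  obtain ⟨n, hn⟩ := huni L Set.univ fun a _ => hL a
  refine ⟨n, fun X Y hX j hj => hn X ?_ Y j hj⟩
  exact SupportedOn.filt (D := D.toSimpleCovers) ⟨hX, fun b hb => absurd (Set.mem_univ b) hb⟩

end Criteria

end HighestWeight

end HomologicalTheory

/-! ### Filtration dimensions in terms of Ext -/

section Resolutions

variable {S : Type u} [Ring S]

theorem exists_free_cover (X : Type u) [AddCommGroup X] [Module S X] (hX : Module.Finite S X) :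
    ∃ (P : ModuleCat.{u} S) (p : P →ₗ[S] X), Module.Finite S P ∧ Module.Projective S P ∧
      Function.Surjective p := by
  obtain ⟨n, p, hp⟩ := Module.Finite.exists_fin' S X
  exact ⟨ModuleCat.of S (Fin n → S), p, inferInstance, inferInstance, hp⟩

/-- The sequence `X, M 0, M 1, …`. -/
def seqCons (X : ModuleCat.{u} S) (M : ℕ → ModuleCat.{u} S) : ℕ → ModuleCat.{u} S
  | 0 => X
  | n + 1 => M n

/-- The sequence `X → M 0 → M 1 → ⋯` obtained by prepending a map. -/
def seqConsMap {X : ModuleCat.{u} S} {M : ℕ → ModuleCat.{u} S} (g : X →ₗ[S] M 0)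
    (f : ∀ i, M i →ₗ[S] M (i + 1)) : ∀ i, seqCons X M i →ₗ[S] seqCons X M (i + 1)
  | 0 => g
  | i + 1 => f i

/-- The sequence `⋯ → M 1 → M 0 → X` obtained by appending a map. -/
def seqConsMapOp {X : ModuleCat.{u} S} {M : ℕ → ModuleCat.{u} S} (g : M 0 →ₗ[S] X)
    (f : ∀ i, M (i + 1) →ₗ[S] M i) : ∀ i, seqCons X M (i + 1) →ₗ[S] seqCons X M i
  | 0 => g
  | i + 1 => f i

variable [IsArtinianRing S] {Λ : Type v} [PartialOrder Λ] {L : Λ → ModuleCat.{u} S}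

namespace HighestWeight

theorem extVanish_of_hasNablaResolution (D : HighestWeight L) {d : ℕ} {X : ModuleCat.{u} S}
    (h : HasNablaResolution L X d) (a : Λ) {j : ℕ} (hj : d < j) : ExtVanish S j (D.Δ a) X := by
  obtain ⟨j, rfl⟩ := Nat.exists_eq_succ_of_ne_zero (by omega : j ≠ 0)
  induction d generalizing X j with
  | zero =>
    obtain ⟨M, e, f, he, hef, -, hM, hM0⟩ := h
    have := hM0 1 one_pos
    have hsurj : Function.Surjective e := fun y => (hef y).1 (Subsingleton.elim _ _)
    exact (FiltC.extVanish_Δ (D.hasNablaFiltration_iff.1 (hM 0 le_rfl)) a j).congr_right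
      (LinearEquiv.ofBijective e ⟨he, hsurj⟩).symm
  | succ d ih =>
    obtain ⟨M, e, f, he, hef, hff, hM, hM0⟩ := h
    have hses : SES e (f 0).rangeRestrict := by
      refine ⟨he, fun y => ?_, LinearMap.surjective_rangeRestrict _⟩
      rw [← hef y, Subtype.ext_iff]
      rfl
    obtain ⟨j, rfl⟩ := Nat.exists_eq_succ_of_ne_zero (by omega : j ≠ 0)
    refine hses.cov_left _ (ih (X := ModuleCat.of S (LinearMap.range (f 0))) ?_ j (by omega))
      (FiltC.extVanish_Δ (D.hasNablaFiltration_iff.1 (hM 0 (Nat.zero_le _))) a _)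
    refine ⟨fun i => M (i + 1), (LinearMap.range (f 0)).subtype, fun i => f (i + 1),
      Submodule.injective_subtype _, fun y => ?_, fun i => hff (i + 1),
      fun i hi => hM _ (by omega), fun i hi => hM0 _ (by omega)⟩
    rw [hff 0 y]
    simp

/-- Embed `X` into an injective module, which has a costandard filtration, and go on with the
cokernel. -/
theorem hasNablaResolution_of_extVanish (D : HighestWeight L) (hS : EnoughFiniteInjectives S)
    {d : ℕ} {X : ModuleCat.{u} S} (hX : Module.Finite S X)
    (h : ∀ a j, d < j → ExtVanish S j (D.Δ a) X) : HasNablaResolution L X d := by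
  induction d generalizing X with
  | zero =>
    let M : ℕ → ModuleCat.{u} S := seqCons X fun _ => ModuleCat.of S PUnit.{u + 1}
    have hM : ∀ i > 0, Subsingleton (M i) := fun i hi => by
      obtain ⟨i, rfl⟩ := Nat.exists_eq_succ_of_ne_zero hi.ne'
      exact inferInstanceAs (Subsingleton PUnit)
    refine ⟨M, (LinearMap.id : X →ₗ[S] X), fun i => 0, Function.injective_id,
      fun y => ⟨fun _ => ⟨y, rfl⟩, fun _ => rfl⟩, fun i y => ⟨fun _ => ⟨0, ?_⟩, fun _ => rfl⟩,
      fun i hi => ?_, hM⟩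
    · have := hM (i + 1) (Nat.succ_pos i)
      exact Subsingleton.elim _ _
    · obtain rfl := Nat.le_zero.1 hi
      exact D.hasNablaFiltration_iff.2 (D.filtC_of_extVanish hX fun a => h a 1 one_pos)
  | succ d ih =>
    obtain ⟨J, i, hJ, hJ', hi⟩ := hS X hX
    have hses := SES.range_mkQ hi
    obtain ⟨M', e', f', he', hef', hff', hM', hM0'⟩ :=
      ih (X := ModuleCat.of S (J ⧸ LinearMap.range i)) hses.finite_right fun a j hj => by
        obtain ⟨j, rfl⟩ := Nat.exists_eq_succ_of_ne_zero (by omega : j ≠ 0)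
        exact hses.cov_right _ (extVanish_of_injective hJ' j) (h a _ (by omega))
    refine ⟨seqCons J M', i, seqConsMap (e' ∘ₗ (LinearMap.range i).mkQ) f', hi, fun y => ?_,
      fun n => ?_, fun n hn => ?_, fun n hn => ?_⟩
    · refine Iff.trans ?_ (hses.exact y)
      exact ⟨fun h => he' (h.trans (map_zero e').symm),
        fun h => (congrArg e' h).trans (map_zero e')⟩
    · cases n with
      | zero =>
        refine fun y => (hef' y).trans ⟨?_, ?_⟩
        · rintro ⟨x, rfl⟩
          obtain ⟨z, rfl⟩ := hses.surj x
          exact ⟨z, rfl⟩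
        · rintro ⟨z, rfl⟩
          exact ⟨_, rfl⟩
      | succ n => exact hff' n
    · cases n with
      | zero => exact D.hasNablaFiltration_iff.2 (D.filtC_of_injective hJ hJ')
      | succ n => exact hM' n (by omega)
    · obtain ⟨n, rfl⟩ := Nat.exists_eq_succ_of_ne_zero (by omega : n ≠ 0)
      exact hM0' n (by omega)

theorem extVanish_of_hasDeltaResolution (D : HighestWeight L) {d : ℕ} {X : ModuleCat.{u} S}
    (h : HasDeltaResolution L X d) (a : Λ) {j : ℕ} (hj : d < j) : ExtVanish S j X (D.C a) := by
  obtain ⟨j, rfl⟩ := Nat.exists_eq_succ_of_ne_zero (by omega : j ≠ 0)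
  induction d generalizing X j with
  | zero =>
    obtain ⟨M, e, f, he, hef, -, hM, hM0⟩ := h
    have := hM0 1 one_pos
    have hinj : Function.Injective e := (injective_iff_map_eq_zero e).2 fun y hy => by
      obtain ⟨x, rfl⟩ := (hef y).1 hy
      rw [Subsingleton.elim x 0, map_zero]
    exact (FiltΔ.extVanish_C (D.hasDeltaFiltration_iff.1 (hM 0 le_rfl)) a j).congr_left
      (LinearEquiv.ofBijective e ⟨hinj, he⟩)
  | succ d ih =>
    obtain ⟨M, e, f, he, hef, hff, hM, hM0⟩ := h
    obtain ⟨j, rfl⟩ := Nat.exists_eq_succ_of_ne_zero (by omega : j ≠ 0)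
    refine (SES.ker_subtype he).con_right _
      (ih (X := ModuleCat.of S (LinearMap.ker e)) ?_ j (by omega))
      (FiltΔ.extVanish_C (D.hasDeltaFiltration_iff.1 (hM 0 (Nat.zero_le _))) a _)
    refine ⟨fun i => M (i + 1), (f 0).codRestrict (LinearMap.ker e) fun x => (hef _).2 ⟨x, rfl⟩,
      fun i => f (i + 1), ?_, fun y => ?_, fun i => hff (i + 1),
      fun i hi => hM _ (by omega), fun i hi => hM0 _ (by omega)⟩
    · rintro ⟨y, hy⟩
      obtain ⟨x, hx⟩ := (hef y).1 hy
      exact ⟨x, Subtype.ext hx⟩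
    · rw [← hff 0 y, Subtype.ext_iff]
      rfl

/-- Cover `X` by a projective module, which has a standard filtration, and go on with the
kernel. -/
theorem hasDeltaResolution_of_extVanish (D : HighestWeight L)
    {d : ℕ} {X : ModuleCat.{u} S} (hX : Module.Finite S X)
    (h : ∀ a j, d < j → ExtVanish S j X (D.C a)) : HasDeltaResolution L X d := by
  induction d generalizing X with
  | zero =>
    let M : ℕ → ModuleCat.{u} S := seqCons X fun _ => ModuleCat.of S PUnit.{u + 1}
    have hM : ∀ i > 0, Subsingleton (M i) := fun i hi => by
      obtain ⟨i, rfl⟩ := Nat.exists_eq_succ_of_ne_zero hi.ne'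
      exact inferInstanceAs (Subsingleton PUnit)
    refine ⟨M, (LinearMap.id : X →ₗ[S] X), fun i => 0, Function.surjective_id,
      fun y => ⟨fun hy => ⟨0, Eq.symm hy⟩, ?_⟩, fun i y => ⟨fun _ => ⟨0, ?_⟩, fun _ => rfl⟩,
      fun i hi => ?_, hM⟩
    · rintro ⟨x, rfl⟩
      rfl
    · have := hM (i + 1) (Nat.succ_pos i)
      exact Subsingleton.elim _ _
    · obtain rfl := Nat.le_zero.1 hi
      exact D.hasDeltaFiltration_iff.2 (D.filtΔ_of_extVanish hX fun a => h a 1 one_pos)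
  | succ d ih =>
    obtain ⟨P, p, hP, hP', hp⟩ := exists_free_cover X hX
    have hses := SES.ker_subtype hp
    obtain ⟨M', e', f', he', hef', hff', hM', hM0'⟩ :=
      ih (X := ModuleCat.of S (LinearMap.ker p)) hses.finite_left fun a j hj => by
        obtain ⟨j, rfl⟩ := Nat.exists_eq_succ_of_ne_zero (by omega : j ≠ 0)
        exact hses.con_left _ (extVanish_of_projective j) (h a _ (by omega))
    refine ⟨seqCons P M', p, seqConsMapOp ((LinearMap.ker p).subtype ∘ₗ e') f', hp,
      fun y => ?_, fun n => ?_, fun n hn => ?_, fun n hn => ?_⟩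
    · refine (hses.exact y).trans ⟨?_, ?_⟩
      · rintro ⟨x, rfl⟩
        obtain ⟨z, rfl⟩ := he' x
        exact ⟨z, rfl⟩
      · rintro ⟨z, rfl⟩
        exact ⟨_, rfl⟩
    · cases n with
      | zero =>
        refine fun y => Iff.trans ?_ (hef' y)
        exact ⟨fun h => Subtype.ext h, fun h => congrArg Subtype.val h⟩
      | succ n => exact hff' n
    · cases n with
      | zero => exact D.hasDeltaFiltration_iff.2 (D.filtΔ_of_projective hP hP')
      | succ n => exact hM' n (by omega)
    · obtain ⟨n, rfl⟩ := Nat.exists_eq_succ_of_ne_zero (by omega : n ≠ 0)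
      exact hM0' n (by omega)

end HighestWeight

theorem iInf_natCast_le_iff {p : ℕ → Prop} (hp : ∀ m n, m ≤ n → p m → p n) (d : ℕ) :
    (⨅ (n : ℕ) (_ : p n), (n : ℕ∞)) ≤ d ↔ p d := by
  refine ⟨fun h => ?_, fun h => iInf₂_le d h⟩
  by_contra hd
  have : ((d + 1 : ℕ) : ℕ∞) ≤ ⨅ (n : ℕ) (_ : p n), (n : ℕ∞) := by
    refine le_iInf₂ fun n hn => ?_
    rw [Nat.cast_le]
    by_contra hlt
    exact hd (hp n d (by omega) hn)
  have := this.trans h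
  rw [Nat.cast_le] at this
  omega

namespace HighestWeight

theorem gfd_le_iff (D : HighestWeight L) (hS : EnoughFiniteInjectives S) (d : ℕ) :
    gfd L ≤ d ↔ ∀ X : ModuleCat.{u} S, Module.Finite S X → ∀ a j, d < j →
      ExtVanish S j (D.Δ a) X := by
  have h : ∀ X : ModuleCat.{u} S, Module.Finite S X → ∀ d : ℕ, HasNablaResolution L X d ↔
      ∀ a j, d < j → ExtVanish S j (D.Δ a) X := fun X hX d =>
    ⟨fun h a j hj => D.extVanish_of_hasNablaResolution h a hj,
      D.hasNablaResolution_of_extVanish hS hX⟩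
  rw [gfd, iSup₂_le_iff]
  refine forall₂_congr fun X hX => ?_
  rw [← h X hX d]
  exact iInf_natCast_le_iff (fun m n hmn => by
    rw [h X hX, h X hX]; exact fun h' a j hj => h' a j (hmn.trans_lt hj)) d

theorem wfd_le_iff (D : HighestWeight L) (d : ℕ) :
    wfd L ≤ d ↔ ∀ X : ModuleCat.{u} S, Module.Finite S X → ∀ a j, d < j →
      ExtVanish S j X (D.C a) := by
  have h : ∀ X : ModuleCat.{u} S, Module.Finite S X → ∀ d : ℕ, HasDeltaResolution L X d ↔
      ∀ a j, d < j → ExtVanish S j X (D.C a) := fun X hX d =>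
    ⟨fun h a j hj => D.extVanish_of_hasDeltaResolution h a hj,
      D.hasDeltaResolution_of_extVanish hX⟩
  rw [wfd, iSup₂_le_iff]
  refine forall₂_congr fun X hX => ?_
  rw [← h X hX d]
  exact iInf_natCast_le_iff (fun m n hmn => by
    rw [h X hX, h X hX]; exact fun h' a j hj => h' a j (hmn.trans_lt hj)) d

end HighestWeight

end Resolutions

/-! ### Direct summands of powers of a module -/

section AddClosure

variable {S : Type u} [Ring S]
variable {X Y Z T M N : Type u} [AddCommGroup X] [Module S X] [AddCommGroup Y] [Module S Y]
  [AddCommGroup Z] [Module S Z] [AddCommGroup T] [Module S T] [AddCommGroup M] [Module S M]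
  [AddCommGroup N] [Module S N]

theorem SES.pi_succ (S : Type u) [Ring S] (T : Type u) [AddCommGroup T] [Module S T] (n : ℕ) :
    SES (LinearMap.single S (fun _ : Fin (n + 1) => T) 0)
      (LinearMap.funLeft S T (Fin.succ : Fin n → Fin (n + 1))) := by
  refine ⟨fun x y h => by simpa using congrFun h 0, fun y => ⟨fun hy => ⟨y 0, ?_⟩, ?_⟩,
    fun y => ⟨Fin.cons 0 y, ?_⟩⟩
  · funext i
    induction i using Fin.cases with
    | zero => simp
    | succ i => simpa using (congrFun hy i).symm
  · rintro ⟨x, rfl⟩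
    funext i
    simp [LinearMap.funLeft]
  · funext i
    simp [LinearMap.funLeft]

theorem ExtVanish.pi_right {n : ℕ} (h : ExtVanish S n X T) (m : ℕ) :
    ExtVanish S n X (Fin m → T) := by
  induction m with
  | zero => exact extVanish_subsingleton_right n
  | succ m ih => exact (SES.pi_succ S T m).cov_mid X h ih

theorem ExtVanish.pi_left {n : ℕ} (h : ExtVanish S n T X) (m : ℕ) :
    ExtVanish S n (Fin m → T) X := by
  induction m with
  | zero => exact extVanish_subsingleton_left n
  | succ m ih => exact (SES.pi_succ S T m).con_mid X h ih

/-- `M` is a direct summand of a finite direct power of `T`. -/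
def InAdd (S : Type u) [Ring S] (T M : Type u) [AddCommGroup T] [Module S T] [AddCommGroup M]
    [Module S M] : Prop :=
  ∃ (n : ℕ) (i : M →ₗ[S] (Fin n → T)) (r : (Fin n → T) →ₗ[S] M), r ∘ₗ i = LinearMap.id

namespace InAdd

theorem self (S : Type u) [Ring S] (T : Type u) [AddCommGroup T] [Module S T] : InAdd S T T :=
  ⟨1, LinearMap.single S (fun _ : Fin 1 => T) 0, LinearMap.proj 0, by ext; simp⟩

theorem of_subsingleton [Subsingleton M] : InAdd S T M :=
  ⟨0, 0, 0, LinearMap.ext fun _ => Subsingleton.elim _ _⟩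

theorem retract (h : InAdd S T M) (i : N →ₗ[S] M) (r : M →ₗ[S] N) (hr : r ∘ₗ i = LinearMap.id) :
    InAdd S T N := by
  obtain ⟨n, i', r', hr'⟩ := h
  refine ⟨n, i' ∘ₗ i, r ∘ₗ r', ?_⟩
  rw [LinearMap.comp_assoc, ← LinearMap.comp_assoc i i' r', hr', LinearMap.id_comp, hr]

theorem prod (h : InAdd S T M) (h' : InAdd S T N) : InAdd S T (M × N) := by
  obtain ⟨n, i, r, hr⟩ := h
  obtain ⟨n', i', r', hr'⟩ := h'
  let e : ((Fin n → T) × (Fin n' → T)) ≃ₗ[S] (Fin (n + n') → T) :=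
    (LinearEquiv.sumArrowLequivProdArrow (Fin n) (Fin n') S T).symm.trans
      (LinearEquiv.funCongrLeft S T finSumFinEquiv.symm)
  refine ⟨n + n', e.toLinearMap ∘ₗ i.prodMap i', r.prodMap r' ∘ₗ e.symm.toLinearMap, ?_⟩
  have h1 : ∀ x, r (i x) = x := fun x => LinearMap.congr_fun hr x
  have h2 : ∀ x, r' (i' x) = x := fun x => LinearMap.congr_fun hr' x
  refine LinearMap.ext fun x => ?_
  simp [h1, h2]

theorem finite (h : InAdd S T M) [Module.Finite S T] : Module.Finite S M := by
  obtain ⟨n, i, r, hr⟩ := h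
  exact Module.Finite.of_surjective r fun x => ⟨i x, LinearMap.congr_fun hr x⟩

theorem extVanish_left (h : InAdd S T M) {n : ℕ} (hT : ExtVanish S n T X) : ExtVanish S n M X := by
  obtain ⟨m, i, r, hr⟩ := h
  exact (hT.pi_left m).retract_left i r hr

theorem extVanish_right (h : InAdd S T M) {n : ℕ} (hT : ExtVanish S n X T) :
    ExtVanish S n X M := by
  obtain ⟨m, i, r, hr⟩ := h
  exact (hT.pi_right m).retract_right i r hr

end InAdd

end AddClosure

/-! ### Tilting modules -/

section Tilting

variable {S : Type u} [Ring S] {Λ : Type v} [PartialOrder Λ] {L : Λ → ModuleCat.{u} S}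

namespace HighestWeight

variable [IsArtinianRing S]

theorem FiltC.of_supp {D : HighestWeight L} {A B : Set Λ} {M : ModuleCat.{u} S} (h : D.FiltC B M)
    (hM : SupportedOn D.toSimpleCovers A M) : D.FiltC A M := by
  induction h with
  | zero M h => exact .zero M h
  | cons f g h _ hZ ih =>
    obtain ⟨b, -, ⟨e⟩⟩ := hZ
    exact .cons f g h (ih (hM.of_injective h.inj)) ⟨b, ((hM.of_surjective h.surj).congr
      e).mem_of_injective (D.l_inj b), ⟨e⟩⟩

/-- Every map from `X` to a costandard module extends along `u : X → Y`. For an embedding `u` into a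
module with a standard filtration this means that the cokernel has a standard filtration. -/
def ExtendsC (D : HighestWeight L) {X Y : Type u} [AddCommGroup X] [Module S X] [AddCommGroup Y]
    [Module S Y] (u : X →ₗ[S] Y) : Prop :=
  ∀ b (φ : X →ₗ[S] D.C b), ∃ ψ : Y →ₗ[S] D.C b, ψ ∘ₗ u = φ

/-- Every map from a standard module to `Y` lifts along `u : X → Y`. For a surjection `u` from a
module with a costandard filtration this means that the kernel has a costandard filtration. -/
def LiftsΔ (D : HighestWeight L) {X Y : Type u} [AddCommGroup X] [Module S X] [AddCommGroup Y]
    [Module S Y] (u : X →ₗ[S] Y) : Prop :=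
  ∀ b (φ : D.Δ b →ₗ[S] Y), ∃ ψ : D.Δ b →ₗ[S] X, u ∘ₗ ψ = φ

theorem ExtendsC.filtΔ {D : HighestWeight L} {X Y Z : ModuleCat.{u} S} {f : X →ₗ[S] Y}
    {g : Y →ₗ[S] Z} (hf : D.ExtendsC f) (h : SES f g) (hY : D.FiltΔ Set.univ Y) :
    D.FiltΔ Set.univ Z :=
  have := hY.finite
  D.filtΔ_of_extVanish h.finite_right fun b => h.extVanish_of_extension (hY.extVanish_C b 0) (hf b)

theorem LiftsΔ.filtC {D : HighestWeight L} {X Y Z : ModuleCat.{u} S} {f : X →ₗ[S] Y}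
    {g : Y →ₗ[S] Z} (hg : D.LiftsΔ g) (h : SES f g) (hY : D.FiltC Set.univ Y) :
    D.FiltC Set.univ X :=
  have := hY.finite
  D.filtC_of_extVanish h.finite_left fun b => h.extVanish_of_lift (hY.extVanish_Δ b 0) (hg b)

/-- The standard module with the highest label of a module with a standard filtration can be moved
to the bottom of the filtration. -/
theorem FiltΔ.exists_bottom {D : HighestWeight L} {M : ModuleCat.{u} S} {a : Λ}
    (h : D.FiltΔ Set.univ M) (hM : SupportedOn D.toSimpleCovers (Set.Iic a) M)
    (ho : Once S (D.P a) M) : ∃ f : D.Δ a →ₗ[S] M, Function.Injective f ∧ D.ExtendsC f := by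
  have := D.projective a
  induction h with
  | zero M h =>
    obtain ⟨f, hf⟩ := ho.exists_ne
    exact absurd (Subsingleton.elim _ _) hf
  | @cons X M Z f g h hX hZ ih =>
    obtain ⟨b, -, ⟨e⟩⟩ := hZ
    have hZ' : D.FiltΔ Set.univ Z := .of_mem ⟨b, trivial, ⟨e⟩⟩
    rcases ho.extVanish_or h with h0 | h0
    · have hb : SupportedOn D.toSimpleCovers (Set.Iic a) (D.Δ b) :=
        (hM.of_surjective h.surj).congr e
      obtain ⟨φ, hφ⟩ := ((ho.right h h0).congr e).exists_ne
      have hba : b = a := le_antisymm (hb.mem_of_surjective (D.r_surj b))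
        ((D.supp_Δ b).mem_of_hom_ne_zero hφ)
      subst hba
      obtain ⟨s, hs⟩ := h.exists_lift (D.extVanish_Δ_of_supp (hM.of_injective h.inj))
        e.symm.toLinearMap
      have hs' : ∀ x, e (g (s x)) = x := fun x => by
        rw [show g (s x) = e.symm x from LinearMap.congr_fun hs x, LinearEquiv.apply_symm_apply]
      exact ⟨s, fun x y hxy => by rw [← hs' x, ← hs' y, hxy], fun c φ =>
        ⟨φ ∘ₗ e.toLinearMap ∘ₗ g, LinearMap.ext fun x => congrArg φ (hs' x)⟩⟩
    · obtain ⟨u, hu, hext⟩ := ih (hM.of_injective h.inj) (ho.left h h0)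
      refine ⟨f ∘ₗ u, h.inj.comp hu, fun c φ => ?_⟩
      obtain ⟨φ', rfl⟩ := hext c φ
      obtain ⟨ψ, rfl⟩ := h.exists_extension (hZ'.extVanish_C c 0) φ'
      exact ⟨ψ, by rw [LinearMap.comp_assoc]⟩

/-- The costandard module with the highest label of a module with a costandard filtration can be
moved to the top of the filtration. -/
theorem FiltC.exists_top {D : HighestWeight L} {M : ModuleCat.{u} S} {a : Λ}
    (h : D.FiltC Set.univ M) (hM : SupportedOn D.toSimpleCovers (Set.Iic a) M)
    (ho : Once S (D.P a) M) : ∃ g : M →ₗ[S] D.C a, Function.Surjective g ∧ D.LiftsΔ g := by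
  have := D.projective a
  induction h with
  | zero M h =>
    obtain ⟨f, hf⟩ := ho.exists_ne
    exact absurd (Subsingleton.elim _ _) hf
  | @cons X M Z f g h hX hZ ih =>
    obtain ⟨b, -, ⟨e⟩⟩ := hZ
    have hb : SupportedOn D.toSimpleCovers (Set.Iic a) (D.C b) :=
      (hM.of_surjective h.surj).congr e
    rcases ho.extVanish_or h with h0 | h0
    · obtain ⟨φ, hφ⟩ := ((ho.right h h0).congr e).exists_ne
      have hba : b = a := le_antisymm (hb.mem_of_injective (D.l_inj b))
        ((D.supp_C b).mem_of_hom_ne_zero hφ)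
      subst hba
      refine ⟨e.toLinearMap ∘ₗ g, e.surjective.comp h.surj, fun c φ => ?_⟩
      obtain ⟨ψ, hψ⟩ := h.exists_lift (FiltC.extVanish_Δ hX c 0) (e.symm.toLinearMap ∘ₗ φ)
      refine ⟨ψ, ?_⟩
      rw [LinearMap.comp_assoc, hψ]
      ext x
      simp
    · obtain ⟨u, hu, hext⟩ := ih (hM.of_injective h.inj) (ho.left h h0)
      obtain ⟨u', rfl⟩ := h.exists_extension ((D.extVanish_C_of_supp hb).congr_left e.symm) u
      refine ⟨u', fun y => ?_, fun c φ => ?_⟩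
      · obtain ⟨x, rfl⟩ := hu y
        exact ⟨f x, rfl⟩
      · obtain ⟨ψ, rfl⟩ := hext c φ
        exact ⟨f ∘ₗ ψ, by rw [LinearMap.comp_assoc]⟩

end HighestWeight

/-- A full tilting module `T` together with its indecomposable summands `Tl a = T(a)`. That `Tl a`
is itself a tilting module follows, as it is a summand of `T`; the composition factors are described
by maps from the projective modules `P b`. -/
structure FullTilting (D : HighestWeight L) (T : ModuleCat.{u} S) (Tl : Λ → ModuleCat.{u} S) :
    Prop where
  filtC : D.FiltC Set.univ T
  filtΔ : D.FiltΔ Set.univ T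
  indec : ∀ a, IsIndecomposable (Tl a)
  summand : ∀ a, IsDirectSummand (Tl a) T
  supp : ∀ a, SupportedOn D.toSimpleCovers (Set.Iic a) (Tl a)
  once : ∀ a, Once S (D.P a) (Tl a)

theorem FullTilting.of_isTilting [IsArtinianRing S] (D : HighestWeight L) {T : ModuleCat.{u} S}
    {Tl : Λ → ModuleCat.{u} S} (hTl : ∀ a, IsIndecomposableTilting L a (Tl a))
    (hT : IsTilting L T) (hfull : ∀ a, IsDirectSummand (Tl a) T) : FullTilting D T Tl where
  filtC := D.hasNablaFiltration_iff.1 hT.1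
  filtΔ := D.hasDeltaFiltration_iff.1 hT.2
  indec a := (hTl a).2.1
  summand := hfull
  supp a := by
    obtain ⟨n, s, hs, -, hle⟩ := (hTl a).2.2
    refine SupportedOn.of_filt hs.filt ?_
    rintro N ⟨j, ⟨e⟩⟩
    refine (SupportedOn.simple (D := D.toSimpleCovers) (A := Set.Iic a) ?_).congr e.symm
    by_cases h : s j = a
    · exact h.le
    · exact (hle j h).le
  once a := by
    obtain ⟨n, s, hs, ho, -⟩ := (hTl a).2.2
    exact D.once_of_compositionFactors hs ho

namespace FullTilting

variable {D : HighestWeight L} {T : ModuleCat.{u} S} {Tl : Λ → ModuleCat.{u} S}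

theorem finite (h : FullTilting D T Tl) : Module.Finite S T := HighestWeight.FiltC.finite h.filtC

theorem inAdd (h : FullTilting D T Tl) (a : Λ) : InAdd S T (Tl a) :=
  let ⟨i, r, hr⟩ := h.summand a
  (InAdd.self S T).retract i r hr

variable [IsArtinianRing S]

theorem filtC_of_inAdd (h : FullTilting D T Tl) {M : ModuleCat.{u} S} (hM : InAdd S T M) :
    D.FiltC Set.univ M :=
  have := h.finite
  D.filtC_of_extVanish hM.finite fun a =>
    hM.extVanish_right (HighestWeight.FiltC.extVanish_Δ h.filtC a 0)

theorem filtΔ_of_inAdd (h : FullTilting D T Tl) {M : ModuleCat.{u} S} (hM : InAdd S T M) :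
    D.FiltΔ Set.univ M :=
  have := h.finite
  D.filtΔ_of_extVanish hM.finite fun a =>
    hM.extVanish_left (HighestWeight.FiltΔ.extVanish_C h.filtΔ a 0)

/-- The costandard module `C a` is a quotient of `T(a)`. -/
theorem exists_surjective_C (h : FullTilting D T Tl) (a : Λ) :
    ∃ g : Tl a →ₗ[S] D.C a, Function.Surjective g ∧
      D.FiltC (Set.Iio a) (ModuleCat.of S (LinearMap.ker g)) := by
  have := D.projective a
  have hC := h.filtC_of_inAdd (h.inAdd a)
  obtain ⟨g, hg, hl⟩ := hC.exists_top (h.supp a) (h.once a)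
  have hses := SES.ker_subtype hg
  refine ⟨g, hg, (hl.filtC (X := ModuleCat.of S (LinearMap.ker g)) hses hC).of_supp ?_⟩
  have hs := (h.supp a).of_injective (LinearMap.ker g).injective_subtype
  refine ⟨hs.finite, fun b hb => ?_⟩
  by_cases hba : b = a
  · subst hba
    exact ((h.once b).extVanish_or hses).resolve_right
      (D.not_extVanish_P (D.l_comp_p_ne_zero b))
  · exact hs.vanish b fun hle => hb (lt_of_le_of_ne hle hba)

/-- The standard module `Δ a` is a submodule of `T(a)`; no map `T(a) → C a` other than zero
kills it. -/
theorem exists_injective_Δ (h : FullTilting D T Tl) (a : Λ) :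
    ∃ f : D.Δ a →ₗ[S] Tl a, Function.Injective f ∧ D.ExtendsC f ∧
      ∀ φ : Tl a →ₗ[S] D.C a, φ ∘ₗ f = 0 → φ = 0 := by
  have := D.projective a
  obtain ⟨f, hf, hl⟩ := (h.filtΔ_of_inAdd (h.inAdd a)).exists_bottom (h.supp a) (h.once a)
  refine ⟨f, hf, hl, fun φ hφ => by_contra fun hne => ?_⟩
  have hses := SES.range_mkQ hf
  obtain ⟨ψ, rfl⟩ := hses.desc φ fun x => LinearMap.congr_fun hφ x
  have h0 := ((h.once a).extVanish_or hses).resolve_left fun h0 => by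
    obtain ⟨x, hx⟩ := (D.once_Δ a).exists_ne
    exact hx (h0.hom_eq_zero x)
  obtain ⟨u, hu⟩ := D.exists_lift_socle (g := ψ) fun h0 => hne (by rw [h0, LinearMap.zero_comp])
  exact D.l_comp_p_ne_zero a (by rw [← hu, h0.hom_eq_zero u, LinearMap.comp_zero])

/-- Every module with a standard filtration embeds into a module in `add T` with cokernel having
a standard filtration. -/
theorem exists_embedding (h : FullTilting D T Tl) {A : Set Λ} {M : ModuleCat.{u} S}
    (hM : D.FiltΔ A M) : ∃ (N : ModuleCat.{u} S) (f : M →ₗ[S] N), InAdd S T N ∧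
      Function.Injective f ∧ D.ExtendsC f := by
  induction hM with
  | zero M hM =>
    exact ⟨ModuleCat.of S PUnit, 0, .of_subsingleton, Function.injective_of_subsingleton _,
      fun b φ => ⟨0, Subsingleton.elim _ _⟩⟩
  | @cons X M Z f g hses hX hZ ih =>
    obtain ⟨a, ha, ⟨e⟩⟩ := hZ
    have hZ' : D.FiltΔ Set.univ Z := .of_mem ⟨a, trivial, ⟨e⟩⟩
    obtain ⟨N, u, hN, hu, hext⟩ := ih
    obtain ⟨w, hw, hwext, -⟩ := h.exists_injective_Δ a
    obtain ⟨u', rfl⟩ := hses.exists_extension (hZ'.extVanish_filtC (h.filtC_of_inAdd hN) 0) u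
    refine ⟨ModuleCat.of S (N × Tl a), u'.prod (w ∘ₗ e.toLinearMap ∘ₗ g), hN.prod (h.inAdd a),
      (injective_iff_map_eq_zero _).2 fun y hy => ?_, fun b φ => ?_⟩
    · obtain ⟨h1, h2⟩ := Prod.ext_iff.1 hy
      obtain ⟨x, rfl⟩ := hses.exists_eq (y := y) (e.injective (hw (by simpa using h2)))
      rw [hu (a₁ := x) (a₂ := 0) (by simpa using h1), map_zero]
    · obtain ⟨ψ, hψ⟩ := hext b (φ ∘ₗ f)
      obtain ⟨χ, hχ⟩ := hses.desc (φ - ψ ∘ₗ u') fun x => by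
        simpa [sub_eq_zero] using (LinearMap.congr_fun hψ x).symm
      obtain ⟨ω, hω⟩ := hwext b (χ ∘ₗ e.symm.toLinearMap)
      refine ⟨ψ.coprod ω, LinearMap.ext fun y => ?_⟩
      have h1 : ω (w (e (g y))) = χ (g y) := by
        simpa using LinearMap.congr_fun hω (e (g y))
      have h2 : χ (g y) = φ y - ψ (u' y) := LinearMap.congr_fun hχ y
      simp [h1, h2]

/-- Every module with a costandard filtration is a quotient of a module in `add T` by a submodule
with a costandard filtration. -/
theorem exists_cover (h : FullTilting D T Tl) {A : Set Λ} {M : ModuleCat.{u} S}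
    (hM : D.FiltC A M) : ∃ (N : ModuleCat.{u} S) (f : N →ₗ[S] M), InAdd S T N ∧
      Function.Surjective f ∧ D.FiltC Set.univ (ModuleCat.of S (LinearMap.ker f)) := by
  suffices H : ∃ (N : ModuleCat.{u} S) (f : N →ₗ[S] M), InAdd S T N ∧
      Function.Surjective f ∧ D.LiftsΔ f by
    obtain ⟨N, f, hN, hf, hl⟩ := H
    exact ⟨N, f, hN, hf, hl.filtC (SES.ker_subtype hf) (h.filtC_of_inAdd hN)⟩
  induction hM with
  | zero M hM =>
    exact ⟨ModuleCat.of S PUnit, 0, .of_subsingleton, fun y => ⟨0, Subsingleton.elim _ _⟩,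
      fun b φ => ⟨0, LinearMap.ext fun _ => Subsingleton.elim _ _⟩⟩
  | @cons X M Z f g hses hX hZ ih =>
    obtain ⟨a, ha, ⟨e⟩⟩ := hZ
    obtain ⟨N, u, hN, hu, hl⟩ := ih
    obtain ⟨w, hw, hwC⟩ := h.exists_surjective_C a
    obtain ⟨w', hw'⟩ := hses.exists_lift (HighestWeight.FiltΔ.extVanish_filtC
      (h.filtΔ_of_inAdd (h.inAdd a)) hX 0) (e.symm.toLinearMap ∘ₗ w)
    have hw1 : ∀ x, g (w' x) = e.symm (w x) := fun x => LinearMap.congr_fun hw' x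
    refine ⟨ModuleCat.of S (N × Tl a), (f ∘ₗ u).coprod w', hN.prod (h.inAdd a),
      fun y => ?_, fun b φ => ?_⟩
    · obtain ⟨x, hx⟩ := hw (e (g y))
      obtain ⟨z, hz⟩ := hses.exists_eq (y := y - w' x) (by simp [hw1, hx])
      obtain ⟨n, rfl⟩ := hu z
      exact ⟨(n, x), by simp [hz]⟩
    · obtain ⟨ω, hω⟩ := (SES.ker_subtype hw).exists_lift (hwC.extVanish_Δ b 0)
        (e.toLinearMap ∘ₗ g ∘ₗ φ)
      have hω' : ∀ x, w (ω x) = e (g (φ x)) := fun x => LinearMap.congr_fun hω x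
      obtain ⟨χ, hχ⟩ := hses.lift (φ - w' ∘ₗ ω) fun x => by simp [hw1, hω']
      obtain ⟨ψ, rfl⟩ := hl b χ
      refine ⟨ψ.prod ω, LinearMap.ext fun x => ?_⟩
      have := LinearMap.congr_fun hχ x
      simp only [LinearMap.comp_apply, LinearMap.sub_apply] at this
      simp [this]

/-- The modules in `add T` are those with both kinds of filtration: an `add T`-cover of such a
module splits. -/
theorem inAdd_of_filt (h : FullTilting D T Tl) {M : ModuleCat.{u} S} (hΔ : D.FiltΔ Set.univ M)
    (hC : D.FiltC Set.univ M) : InAdd S T M := by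
  obtain ⟨N, f, hN, hf, hfC⟩ := h.exists_cover hC
  obtain ⟨s, hs⟩ := (SES.ker_subtype hf).exists_lift (hΔ.extVanish_filtC hfC 0) LinearMap.id
  exact hN.retract s f hs

end FullTilting

end Tilting

/-! ### Test modules for the filtration dimensions -/

section Dimension

variable {S : Type u} [Ring S] [IsArtinianRing S] {Λ : Type v} [PartialOrder Λ]
  {L : Λ → ModuleCat.{u} S}

/-- An injective module `I` such that finitely generated modules embed into powers of `I`. -/
structure IsFiniteCogenerator (S : Type u) [Ring S] (I : ModuleCat.{u} S) : Prop where
  finite : Module.Finite S I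
  injective : Module.Injective S I
  exists_embedding : ∀ X : ModuleCat.{u} S, Module.Finite S X →
    ∃ (n : ℕ) (i : X →ₗ[S] (Fin n → I)), Function.Injective i

namespace HighestWeight

/-- Every finitely generated module is a quotient of a power of `S`, and all Ext groups vanish in
large degrees; so nonvanishing of `Ext^j(Δ a, -)` in the highest degree is seen on `S`. -/
theorem gfd_le_iff_self (D : HighestWeight L) (hS : EnoughFiniteInjectives S) (d : ℕ) :
    gfd L ≤ d ↔ ∀ a j, d < j → ExtVanish S j (D.Δ a) S := by
  rw [D.gfd_le_iff hS]
  refine ⟨fun h a j hj => h (ModuleCat.of S S) inferInstance a j hj, fun h X hX a j hj => ?_⟩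
  obtain ⟨n, hn⟩ := D.exists_globalDimension
  -- descending induction on `j`, starting above the global dimension
  have key : ∀ (m : ℕ) (X : ModuleCat.{u} S), Module.Finite S X → ∀ j, d < j → n < j + m →
      ExtVanish S j (D.Δ a) X := by
    intro m
    induction m with
    | zero => exact fun X _ j _ hj => hn _ X (D.finite_Δ a) j hj
    | succ m ih =>
      intro X hX j hj hjm
      obtain ⟨r, p, hp⟩ := Module.Finite.exists_fin' S X
      have hses := SES.ker_subtype hp
      exact hses.cov_right _ ((h a j hj).pi_right r)
        (ih (ModuleCat.of S (LinearMap.ker p)) hses.finite_left _ (by omega) (by omega))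
  exact key (n + 1) X hX j hj (by omega)

/-- Every finitely generated module embeds into a power of `I`; so nonvanishing of `Ext^j(-, C a)`
in the highest degree is seen on `I`. -/
theorem wfd_le_iff_cogenerator (D : HighestWeight L) {I : ModuleCat.{u} S}
    (hI : IsFiniteCogenerator S I) (d : ℕ) :
    wfd L ≤ d ↔ ∀ a j, d < j → ExtVanish S j I (D.C a) := by
  rw [D.wfd_le_iff]
  refine ⟨fun h a j hj => h I hI.finite a j hj, fun h X hX a j hj => ?_⟩
  obtain ⟨n, hn⟩ := D.exists_globalDimension
  -- descending induction on `j`, starting above the global dimension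
  have key : ∀ (m : ℕ) (X : ModuleCat.{u} S), Module.Finite S X → ∀ j, d < j → n < j + m →
      ExtVanish S j X (D.C a) := by
    intro m
    induction m with
    | zero => exact fun X hX j _ hj => hn X _ hX j hj
    | succ m ih =>
      intro X hX j hj hjm
      obtain ⟨r, p, hp⟩ := hI.exists_embedding X hX
      have := hI.finite
      have hses := SES.range_mkQ hp
      exact hses.con_left _ ((h a j hj).pi_left r)
        (ih (ModuleCat.of S ((Fin r → I) ⧸ LinearMap.range p)) hses.finite_right _
          (by omega) (by omega))
  exact key (n + 1) X hX j hj (by omega)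

end HighestWeight

end Dimension

/-! ### Local endomorphism rings -/

section LocalEndomorphismRings

variable {R : Type u} [Ring R]

/-- If the endomorphism ring of a projective module is local, the radical of the module is its
only maximal submodule. -/
theorem isCoatom_jacobson {P : Type u} [AddCommGroup P] [Module R P] [Module.Projective R P]
    [Module.Finite R P] [Nontrivial P]
    (h : ∀ f g : P →ₗ[R] P, f + g = LinearMap.id →
      Function.Surjective f ∨ Function.Surjective g) :
    IsCoatom (Module.jacobson R P) ∧ ∀ N : Submodule R P, N ≠ ⊤ → N ≤ Module.jacobson R P := by
  obtain ⟨m, hm⟩ := IsCoatomic.exists_coatom (Submodule R P)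
  have huniq : ∀ m' : Submodule R P, IsCoatom m' → m' = m := by
    intro m' hm'
    by_contra hne
    have htop : m' ⊔ m = ⊤ := hm'.sup_eq_top_of_ne hm hne
    obtain ⟨s, hs⟩ := Module.projective_lifting_property (m'.subtype.coprod m.subtype)
      LinearMap.id (LinearMap.range_eq_top.1 (by
        rw [LinearMap.range_coprod, Submodule.range_subtype, Submodule.range_subtype, htop]))
    rcases h (m'.subtype ∘ₗ LinearMap.fst R m' m ∘ₗ s) (m.subtype ∘ₗ LinearMap.snd R m' m ∘ₗ s)
      hs with h' | h'
    · exact hm'.1 (eq_top_iff.2 fun x _ => by obtain ⟨y, rfl⟩ := h' x; exact Subtype.prop _)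
    · exact hm.1 (eq_top_iff.2 fun x _ => by obtain ⟨y, rfl⟩ := h' x; exact Subtype.prop _)
  have hj : Module.jacobson R P = m :=
    le_antisymm (sInf_le hm) (le_sInf fun m' hm' => (huniq m' hm').ge)
  refine ⟨hj ▸ hm, fun N hN => ?_⟩
  obtain ⟨m', hm', hle⟩ := (eq_top_or_exists_le_coatom N).resolve_left hN
  rw [hj, ← huniq m' hm']
  exact hle

/-- Fitting's lemma. -/
theorem IsIndecomposable.isUnit_or_isNilpotent [IsArtinianRing R] {M : ModuleCat.{u} R}
    [Module.Finite R M] (h : IsIndecomposable M) (f : Module.End R M) :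
    IsUnit f ∨ IsNilpotent f := by
  obtain ⟨n, hn0, hn⟩ :
      ∃ n : ℕ, 0 < n ∧ IsCompl (LinearMap.ker (f ^ n)) (LinearMap.range (f ^ n)) :=
    ((Filter.eventually_gt_atTop 0).and (LinearMap.eventually_isCompl_ker_pow_range_pow f)).exists
  rcases h.2 _ _ hn with h0 | h0
  · refine Or.inl ((isUnit_pow_iff hn0.ne').1 ((Module.End.isUnit_iff _).2 ?_))
    exact IsArtinian.bijective_of_injective_endomorphism _ (LinearMap.ker_eq_bot.1 h0)
  · exact Or.inr ⟨n, LinearMap.range_eq_bot.1 h0⟩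

end LocalEndomorphismRings

/-! ### The functor `Hom(T, -)` to modules over the Ringel dual -/

section HomFunctor

variable {S : Type u} [Ring S] (T : ModuleCat.{u} S)

/-- The Ringel dual `End(T)ᵒᵖ`, as a type synonym whose semiring structure is found only through
its ring structure. -/
def EndOp (T : ModuleCat.{u} S) : Type u := RingelDual T

noncomputable instance : Ring (EndOp T) := inferInstanceAs (Ring (RingelDual T))

/-- An endomorphism of `T` as an element of the Ringel dual. -/
def toEndOp {T : ModuleCat.{u} S} : (T →ₗ[S] T) ≃+ EndOp T where
  toFun r := (DomMulAct.mk r : RingelDual T)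
  invFun r := DomMulAct.mk.symm (r : RingelDual T)
  map_add' _ _ := rfl

noncomputable instance (M : Type u) [AddCommGroup M] [Module S M] :
    Module (EndOp T) (T →ₗ[S] M) :=
  inferInstanceAs (Module (RingelDual T) (T →ₗ[S] M))

variable {M N X Y : Type u} [AddCommGroup M] [Module S M] [AddCommGroup N] [Module S N]
  [AddCommGroup X] [Module S X] [AddCommGroup Y] [Module S Y]

/-- The functor `Hom(T, -)` from `S`-modules to modules over the Ringel dual, on morphisms. -/
def homMap (f : M →ₗ[S] N) : (T →ₗ[S] M) →ₗ[EndOp T] (T →ₗ[S] N) where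
  toFun g := f ∘ₗ g
  map_add' _ _ := LinearMap.comp_add _ _ _
  map_smul' _ _ := rfl

variable {T}

@[simp]
theorem homMap_apply (f : M →ₗ[S] N) (g : T →ₗ[S] M) : homMap T f g = f ∘ₗ g := rfl

theorem toEndOp_smul (r : Module.End S T) (g : T →ₗ[S] M) : toEndOp r • g = g ∘ₗ r := rfl

theorem homMap_comp (f : N →ₗ[S] X) (g : M →ₗ[S] N) :
    homMap T (f ∘ₗ g) = homMap T f ∘ₗ homMap T g := rfl

theorem homMap_id : homMap T (LinearMap.id : M →ₗ[S] M) = LinearMap.id := rfl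

theorem homMap_zero : homMap T (0 : M →ₗ[S] N) = 0 := rfl

theorem homMap_sub (f g : M →ₗ[S] N) : homMap T (f - g) = homMap T f - homMap T g := rfl

/-- `Hom(T, -)` on isomorphisms. -/
noncomputable def homEquiv (T : ModuleCat.{u} S) (e : M ≃ₗ[S] N) :
    (T →ₗ[S] M) ≃ₗ[EndOp T] (T →ₗ[S] N) :=
  LinearEquiv.ofLinearMap (homMap T e.toLinearMap) (homMap T e.symm.toLinearMap)
    (by rw [← homMap_comp]; ext; simp) (by rw [← homMap_comp]; ext; simp)

/-- `Hom(T, M)` is a summand of a power of the regular module if `M` is in `add T`. -/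
theorem InAdd.hom (h : InAdd S T M) :
    InAdd (EndOp T) (EndOp T) (T →ₗ[S] M) := by
  obtain ⟨n, i, r, hr⟩ := h
  let i' : (T →ₗ[S] M) →ₗ[EndOp T] (Fin n → EndOp T) :=
    { toFun := fun g k => toEndOp (LinearMap.proj k ∘ₗ i ∘ₗ g)
      map_add' := fun g g' => by
        funext k
        rw [LinearMap.comp_add, LinearMap.comp_add]; rfl
      map_smul' := fun c g => rfl }
  let r' : (Fin n → EndOp T) →ₗ[EndOp T] (T →ₗ[S] M) :=
    Fintype.linearCombination (EndOp T)
      fun k => r ∘ₗ LinearMap.single S (fun _ : Fin n => (T : Type u)) k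
  refine ⟨n, i', r', LinearMap.ext fun g => LinearMap.ext fun t => ?_⟩
  have h1 : ∀ k, (i' g k • (r ∘ₗ LinearMap.single S (fun _ : Fin n => (T : Type u)) k)) t =
      r (Pi.single k (i (g t) k)) := fun k => rfl
  have h2 : r (i (g t)) = g t := LinearMap.congr_fun hr (g t)
  simp only [r', LinearMap.comp_apply, Fintype.linearCombination_apply, LinearMap.sum_apply, h1,
    LinearMap.id_apply]
  rw [← map_sum, Finset.univ_sum_single, h2]

theorem InAdd.projective {R : Type u} [Ring R] {M : Type u} [AddCommGroup M] [Module R M]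
    (h : InAdd R R M) : Module.Projective R M := by
  obtain ⟨n, i, r, hr⟩ := h
  exact Module.Projective.of_split i r hr

theorem InAdd.projective_hom (h : InAdd S T M) :
    Module.Projective (EndOp T) (T →ₗ[S] M) := h.hom.projective

theorem InAdd.finite_hom (h : InAdd S T M) : Module.Finite (EndOp T) (T →ₗ[S] M) :=
  h.hom.finite

/-- `Hom(T, -)` is full on maps out of modules in `add T`. -/
theorem InAdd.exists_homMap_eq (h : InAdd S T M)
    (Φ : (T →ₗ[S] M) →ₗ[EndOp T] (T →ₗ[S] N)) : ∃ φ : M →ₗ[S] N, homMap T φ = Φ := by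
  obtain ⟨n, i, r, hr⟩ := h
  let σ := fun k => LinearMap.single S (fun _ : Fin n => (T : Type u)) k
  let φ : (Fin n → T) →ₗ[S] N := ∑ k, Φ (r ∘ₗ σ k) ∘ₗ LinearMap.proj k
  refine ⟨φ ∘ₗ i, LinearMap.ext fun g => ?_⟩
  have h1 : g = ∑ k : Fin n, toEndOp (LinearMap.proj k ∘ₗ i ∘ₗ g) • (r ∘ₗ σ k) := by
    refine LinearMap.ext fun t => ?_
    have h2 : r (i (g t)) = g t := LinearMap.congr_fun hr (g t)
    have h1 : ∀ k : Fin n, (toEndOp (LinearMap.proj k ∘ₗ i ∘ₗ g) •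
      (r ∘ₗ σ k)) t = r (Pi.single k (i (g t) k)) := fun k => rfl
    simp only [LinearMap.sum_apply, h1]
    rw [← map_sum, Finset.univ_sum_single, h2]
  conv_rhs => rw [h1]
  rw [map_sum]
  simp only [map_smul]
  simp only [toEndOp_smul]
  refine LinearMap.ext fun t => ?_
  simp [φ, LinearMap.sum_apply]

/-- `Hom(T, -)` is faithful on maps out of modules generated by `T`. -/
theorem InAdd.eq_zero_of_homMap (h : InAdd S T M) {p : M →ₗ[S] N} (hp : Function.Surjective p)
    {f : N →ₗ[S] X} (hf : homMap T f = 0) : f = 0 := by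
  obtain ⟨n, i, r, hr⟩ := h
  refine LinearMap.ext fun x => ?_
  obtain ⟨y, rfl⟩ := hp x
  have h2 : r (i y) = y := LinearMap.congr_fun hr y
  rw [← h2, ← Finset.univ_sum_single (i y), map_sum, map_sum, map_sum]
  refine Finset.sum_eq_zero fun k _ => ?_
  exact LinearMap.congr_fun (LinearMap.congr_fun hf
    (p ∘ₗ r ∘ₗ LinearMap.single S (fun _ : Fin n => (T : Type u)) k)) (i y k)

variable {f : X →ₗ[S] M} {g : M →ₗ[S] Y}

/-- `Hom(T, -)` is left exact. -/
theorem SES.homMap_exact (h : SES f g) :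
    Function.Injective (homMap T f) ∧ Function.Exact (homMap T f) (homMap T g) := by
  refine ⟨fun a b hab => LinearMap.ext fun t => h.inj (LinearMap.congr_fun hab t), fun b =>
    ⟨fun hb => ?_, ?_⟩⟩
  · exact h.lift b fun w => LinearMap.congr_fun hb w
  · rintro ⟨a, rfl⟩
    exact LinearMap.ext fun t => h.comp_apply (a t)

theorem SES.homMap (h : SES f g) (hX : ExtVanish S 1 T X) : SES (homMap T f) (homMap T g) :=
  ⟨h.homMap_exact.1, h.homMap_exact.2, fun a => h.exists_lift hX a⟩

end HomFunctor

section FullyFaithful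

variable {S : Type u} [Ring S] [IsArtinianRing S] {Λ : Type v} [PartialOrder Λ]
  {L : Λ → ModuleCat.{u} S} {D : HighestWeight L} {T : ModuleCat.{u} S} {Tl : Λ → ModuleCat.{u} S}

namespace FullTilting

theorem extVanish_T (h : FullTilting D T Tl) {A : Set Λ} {M : ModuleCat.{u} S} (hM : D.FiltC A M)
    (n : ℕ) : ExtVanish S (n + 1) T M :=
  HighestWeight.FiltΔ.extVanish_filtC h.filtΔ hM n

/-- `Hom(T, -)` is exact on modules with a costandard filtration. -/
theorem ses_hom (h : FullTilting D T Tl) {A : Set Λ} {X M Y : ModuleCat.{u} S} {f : X →ₗ[S] M}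
    {g : M →ₗ[S] Y} (hses : SES f g) (hX : D.FiltC A X) : SES (homMap T f) (homMap T g) :=
  hses.homMap (h.extVanish_T hX 0)

/-- `Hom(T, -)` is faithful on maps out of modules with a costandard filtration. -/
theorem eq_zero_of_homMap (h : FullTilting D T Tl) {A : Set Λ} {M : ModuleCat.{u} S}
    (hM : D.FiltC A M) {N : Type u} [AddCommGroup N] [Module S N] {f : M →ₗ[S] N}
    (hf : homMap T f = 0) : f = 0 :=
  let ⟨_, _, hX, hp, _⟩ := h.exists_cover hM
  hX.eq_zero_of_homMap hp hf

/-- `Hom(T, -)` is full on maps out of modules with a costandard filtration. -/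
theorem exists_homMap_eq (h : FullTilting D T Tl) {A : Set Λ} {M : ModuleCat.{u} S}
    (hM : D.FiltC A M) {N : Type u} [AddCommGroup N] [Module S N]
    (Φ : (T →ₗ[S] M) →ₗ[EndOp T] (T →ₗ[S] N)) : ∃ φ : M →ₗ[S] N, homMap T φ = Φ := by
  obtain ⟨X, p, hX, hp, hK⟩ := h.exists_cover hM
  have hses := SES.ker_subtype hp
  obtain ⟨ψ, hψ⟩ := hX.exists_homMap_eq (Φ ∘ₗ homMap T p)
  have h0 : ψ ∘ₗ (LinearMap.ker p).subtype = 0 := by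
    refine h.eq_zero_of_homMap hK ?_
    rw [homMap_comp, hψ, LinearMap.comp_assoc, ← homMap_comp, hses.comp_eq_zero, homMap_zero,
      LinearMap.comp_zero]
  obtain ⟨φ, rfl⟩ := hses.desc ψ fun x => LinearMap.congr_fun h0 x
  refine ⟨φ, LinearMap.ext fun g => ?_⟩
  obtain ⟨g', rfl⟩ := (h.ses_hom (X := ModuleCat.of S (LinearMap.ker p)) hses hK).surj g
  exact LinearMap.congr_fun hψ g'

theorem finite_hom (h : FullTilting D T Tl) {A : Set Λ} {M : ModuleCat.{u} S}
    (hM : D.FiltC A M) : Module.Finite (EndOp T) (T →ₗ[S] M) := by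
  obtain ⟨X, p, hX, hp, hK⟩ := h.exists_cover hM
  have := hX.finite_hom
  exact (h.ses_hom (X := ModuleCat.of S (LinearMap.ker p)) (SES.ker_subtype hp) hK).finite_right

end FullTilting

end FullyFaithful

/-! ### The Ringel dual is quasi-hereditary -/

theorem IsProjectiveCover.comp_equiv {R : Type u} [Ring R] {P M N : ModuleCat.{u} R}
    {p : P →ₗ[R] M} (h : IsProjectiveCover p) (e : M ≃ₗ[R] N) :
    IsProjectiveCover (e.toLinearMap ∘ₗ p) := by
  obtain ⟨h1, h2, h3⟩ := h
  exact ⟨h1, e.surjective.comp h2, by rwa [LinearEquiv.ker_comp]⟩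

section RingelQuasiHereditary

variable {S : Type u} [Ring S] {Λ : Type v}

/-- The modules `ringelSimple T Tl`, over the type synonym `EndOp T` of the Ringel dual. -/
noncomputable def endOpSimple (T : ModuleCat.{u} S) (Tl : Λ → ModuleCat.{u} S) :
    Λᵒᵈ → ModuleCat.{u} (EndOp T) := fun a =>
  ModuleCat.of (EndOp T) ((T →ₗ[S] Tl (OrderDual.ofDual a)) ⧸
    Module.jacobson (EndOp T) (T →ₗ[S] Tl (OrderDual.ofDual a)))

/-- The regular module of the Ringel dual is `Hom(T, T)`. -/
noncomputable def endOpEquiv (T : ModuleCat.{u} S) : EndOp T ≃ₗ[EndOp T] (T →ₗ[S] T) where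
  toFun c := c • LinearMap.id
  map_add' _ _ := add_smul _ _ _
  map_smul' _ _ := mul_smul _ _ _
  invFun := toEndOp
  left_inv _ := rfl
  right_inv _ := rfl

variable [PartialOrder Λ]
  {L : Λ → ModuleCat.{u} S} {D : HighestWeight L} {T : ModuleCat.{u} S} {Tl : Λ → ModuleCat.{u} S}

namespace FullTilting

theorem finite_Tl (h : FullTilting D T Tl) (a : Λ) : Module.Finite S (Tl a) := (h.supp a).finite

theorem nontrivial_hom (h : FullTilting D T Tl) (a : Λ) : Nontrivial (T →ₗ[S] Tl a) := by
  obtain ⟨i, r, hr⟩ := h.summand a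
  have := (h.indec a).1
  obtain ⟨x, hx⟩ := exists_ne (0 : Tl a)
  exact ⟨r, 0, fun h0 => hx (by simpa [h0] using (LinearMap.congr_fun hr x).symm)⟩

/-- The label of `T(a)` is recovered as the highest label of a composition factor. -/
theorem le_of_equiv (h : FullTilting D T Tl) {a b : Λ}
    (e : (T →ₗ[S] Tl a) ≃ₗ[EndOp T] (T →ₗ[S] Tl b)) : a ≤ b := by
  obtain ⟨φ, hφ⟩ := (h.inAdd a).exists_homMap_eq e.toLinearMap
  obtain ⟨ψ, hψ⟩ := (h.inAdd b).exists_homMap_eq e.symm.toLinearMap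
  have hid : ψ ∘ₗ φ - LinearMap.id = 0 := by
    refine (h.inAdd a).eq_zero_of_homMap (T := T) (p := LinearMap.id) Function.surjective_id ?_
    rw [homMap_sub, homMap_comp, hφ, hψ, homMap_id, sub_eq_zero]
    ext x : 1
    simp
  obtain ⟨x, hx⟩ := (h.once a).exists_ne
  refine (h.supp b).mem_of_hom_ne_zero (f := φ ∘ₗ x) fun h0 => hx ?_
  rw [← LinearMap.id_comp x, ← sub_eq_zero.1 hid, LinearMap.comp_assoc, h0, LinearMap.comp_zero]

variable [IsArtinianRing S]

/-- The endomorphism ring of `Hom(T, T(a))` is that of `T(a)`, which is local. -/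
theorem surjective_or (h : FullTilting D T Tl) (a : Λ)
    (f g : (T →ₗ[S] Tl a) →ₗ[EndOp T] (T →ₗ[S] Tl a)) (hfg : f + g = LinearMap.id) :
    Function.Surjective f ∨ Function.Surjective g := by
  have := h.finite_Tl a
  obtain ⟨φ, rfl⟩ := (h.inAdd a).exists_homMap_eq f
  obtain ⟨ψ, rfl⟩ := (h.inAdd a).exists_homMap_eq g
  have hid : ψ = 1 - φ := by
    rw [← sub_eq_zero]
    refine (h.inAdd a).eq_zero_of_homMap (T := T) (p := LinearMap.id) Function.surjective_id ?_
    rw [homMap_sub, homMap_sub, sub_eq_zero, eq_sub_iff_add_eq']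
    exact hfg
  have key : ∀ φ : Module.End S (Tl a), IsUnit φ → Function.Surjective (homMap T φ) := by
    rintro _ ⟨u, rfl⟩ x
    refine ⟨u⁻¹.1 ∘ₗ x, ?_⟩
    rw [homMap_apply, ← LinearMap.comp_assoc]
    have : u.1 ∘ₗ u⁻¹.1 = LinearMap.id := u.mul_inv
    rw [this, LinearMap.id_comp]
  rcases (h.indec a).isUnit_or_isNilpotent φ with hu | hn
  · exact Or.inl (key φ hu)
  · exact Or.inr (key ψ (hid ▸ hn.isUnit_one_sub))

theorem jacobson_hom (h : FullTilting D T Tl) (a : Λ) :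
    IsCoatom (Module.jacobson (EndOp T) (T →ₗ[S] Tl a)) ∧
      ∀ N : Submodule (EndOp T) (T →ₗ[S] Tl a), N ≠ ⊤ →
        N ≤ Module.jacobson (EndOp T) (T →ₗ[S] Tl a) :=
  have := h.nontrivial_hom a
  have := (h.inAdd a).projective_hom
  have := (h.inAdd a).finite_hom
  isCoatom_jacobson (h.surjective_or a)

/-- `Hom(T, X)` is filtered by quotients `Hom(T, C a)` of the modules `Hom(T, T(a))`. -/
theorem extVanish_hom (h : FullTilting D T Tl) {A : Set Λ} {X : ModuleCat.{u} S}
    (hX : D.FiltC A X) {Y : Type u} [AddCommGroup Y] [Module (EndOp T) Y]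
    (hY : ∀ a ∈ A, ExtVanish (EndOp T) 0 (T →ₗ[S] Tl a) Y) :
    ExtVanish (EndOp T) 0 (T →ₗ[S] X) Y := by
  induction hX with
  | zero X hX =>
    exact extVanish_subsingleton_left 0
  | cons f g hses hX hZ ih =>
    obtain ⟨a, ha, ⟨e⟩⟩ := hZ
    obtain ⟨w, hw, hwC⟩ := h.exists_surjective_C a
    have h1 := h.ses_hom (X := ModuleCat.of S (LinearMap.ker w)) (SES.ker_subtype hw) hwC
    exact (h.ses_hom hses hX).con_mid _ ih
      (((hY a ha).of_surjective h1.surj).congr_left (homEquiv T e.symm))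

theorem isProjectiveCover (h : FullTilting D T Tl) (a : Λᵒᵈ) :
    IsProjectiveCover (P := ModuleCat.of (EndOp T) (T →ₗ[S] Tl (OrderDual.ofDual a)))
      (M := endOpSimple T Tl a) (Submodule.mkQ _) := by
  refine ⟨(h.inAdd _).projective_hom, Submodule.mkQ_surjective _, fun N hN => ?_⟩
  by_contra hne
  have hker := Submodule.ker_mkQ (Module.jacobson (EndOp T) (T →ₗ[S] Tl (OrderDual.ofDual a)))
  exact (h.jacobson_hom _).1.1 ((sup_eq_right.2 ((h.jacobson_hom _).2 N hne)).symm.trans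
    ((congrArg (N ⊔ ·) hker).symm.trans hN))

theorem isSimple (h : FullTilting D T Tl) (a : Λᵒᵈ) :
    IsSimpleModule (EndOp T) (endOpSimple T Tl a) :=
  isSimpleModule_iff_isCoatom.2 (h.jacobson_hom _).1

/-- The simple modules of the Ringel dual. They are distinguished by their projective covers
`Hom(T, T(a))`; and every simple module is a quotient of one of these, because the regular module
`Hom(T, T)` is filtered by their quotients. -/
theorem isFullSetOfSimples (h : FullTilting D T Tl) : IsFullSetOfSimples (endOpSimple T Tl) where
  simple := h.isSimple
  injective a b := by
    rintro ⟨e⟩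
    have hb := h.isProjectiveCover b
    obtain ⟨e', -⟩ := ((h.isProjectiveCover a).comp_equiv e).exists_equiv hb
    exact le_antisymm (α := Λ) (h.le_of_equiv e') (h.le_of_equiv e'.symm)
  exhaustive M hM := by
    have : ∃ a, ∃ f : (T →ₗ[S] Tl a) →ₗ[EndOp T] M, f ≠ 0 := by
      by_contra! hcon
      have h0 := h.extVanish_hom h.filtC fun a _ => extVanish_zero_iff.2 (hcon a)
      have := IsSimpleModule.nontrivial (EndOp T) M
      obtain ⟨x, hx⟩ := exists_ne (0 : M)
      have h1 := h0.hom_eq_zero (LinearMap.toSpanSingleton (EndOp T) M x ∘ₗ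
        (endOpEquiv T).symm.toLinearMap)
      have h2 := LinearMap.congr_fun h1 (endOpEquiv T 1)
      exact hx (by simpa using h2)
    obtain ⟨a, f, hf⟩ := this
    have hs := LinearMap.surjective_of_ne_zero hf
    have hker : IsCoatom (LinearMap.ker f) := LinearMap.isCoatom_ker_of_surjective hs
    have hj := (hker.le_iff.1 ((h.jacobson_hom a).2 _ hker.1)).resolve_left (h.jacobson_hom a).1.1
    exact ⟨OrderDual.toDual a, ⟨(f.quotKerEquivOfSurjective hs).symm.trans
      (Submodule.quotEquivOfEq _ _ hj.symm)⟩⟩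

/-- The simple modules of the Ringel dual with their projective covers `Hom(T, T(a))`. -/
noncomputable def covers (h : FullTilting D T Tl) : SimpleCovers (endOpSimple T Tl) where
  full := h.isFullSetOfSimples
  P a := ModuleCat.of (EndOp T) (T →ₗ[S] Tl (OrderDual.ofDual a))
  p _ := Submodule.mkQ _
  cover := h.isProjectiveCover

/-- A nonzero map `T(a) → C a` equals any given surjection with costandardly filtered kernel up to
an automorphism of `T(a)`: it factors through the surjection by an endomorphism, which is not
nilpotent since `L a` occurs only once in `T(a)`. -/
theorem exists_isUnit (h : FullTilting D T Tl) {a : Λ} {A : Set Λ} {g : Tl a →ₗ[S] D.C a}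
    (hg : Function.Surjective g) (hgC : D.FiltC A (ModuleCat.of S (LinearMap.ker g)))
    {ψ : Tl a →ₗ[S] D.C a} (hψ : ψ ≠ 0) :
    ∃ φ : Module.End S (Tl a), IsUnit φ ∧ g ∘ₗ φ = ψ := by
  have := h.finite_Tl a
  obtain ⟨φ, rfl⟩ := (SES.ker_subtype hg).exists_lift
    ((h.filtΔ_of_inAdd (h.inAdd a)).extVanish_filtC hgC 0) ψ
  refine ⟨φ, ((h.indec a).isUnit_or_isNilpotent φ).resolve_right ?_, rfl⟩
  rintro ⟨n, hn⟩
  obtain ⟨f, -, -, hf⟩ := h.exists_injective_Δ a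
  let x : D.P a →ₗ[S] Tl a := f ∘ₗ D.q a
  have hx : φ ∘ₗ x ≠ 0 := fun h0 => hψ <| hf _ <| LinearMap.ext fun y => by
    obtain ⟨z, rfl⟩ := D.q_surj a y
    exact (congrArg g (LinearMap.congr_fun h0 z)).trans (map_zero g)
  obtain ⟨c, hc⟩ := (h.once a).exists_comp _ x hx
  have hpow : ∀ n : ℕ, ∃ c : D.P a →ₗ[S] D.P a, x = (φ ^ n : Module.End S (Tl a)) ∘ₗ x ∘ₗ c := by
    intro n
    induction n with
    | zero => exact ⟨LinearMap.id, rfl⟩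
    | succ n ih =>
      obtain ⟨c', hc'⟩ := ih
      refine ⟨c ∘ₗ c', ?_⟩
      conv_lhs => rw [hc']
      conv_lhs => rw [hc]
      rw [pow_succ]
      rfl
  obtain ⟨c', hc'⟩ := hpow n
  rw [hn] at hc'
  exact hx (by rw [hc', LinearMap.zero_comp, LinearMap.comp_zero])

/-- A nonzero map from `T(b)` to `C a` hits the socle `L a`, so `a ≤ b`. -/
theorem supp_hom_C (h : FullTilting D T Tl) (a : Λ) :
    SupportedOn h.covers (Set.Iic (OrderDual.toDual a)) (T →ₗ[S] D.C a) := by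
  refine ⟨h.finite_hom (A := Set.univ) (.of_mem ⟨a, trivial, ⟨LinearEquiv.refl S _⟩⟩),
    fun b hb => ?_⟩
  refine extVanish_zero_iff.2 fun Φ => by_contra fun hΦ => hb ?_
  obtain ⟨φ, rfl⟩ := (h.inAdd (OrderDual.ofDual b)).exists_homMap_eq Φ
  obtain ⟨x, hx⟩ := D.exists_lift_socle (g := φ) fun h0 => hΦ (by rw [h0]; exact homMap_zero)
  have hle : a ≤ OrderDual.ofDual b := (h.supp (OrderDual.ofDual b)).mem_of_hom_ne_zero (f := x)
    fun h0 => D.l_comp_p_ne_zero a (by rw [← hx, h0, LinearMap.comp_zero])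
  exact hle

variable [IsArtinianRing (EndOp T)]

/-- The standard modules of the Ringel dual are the modules `Hom(T, C a)`. -/
theorem isStandard_hom_C (h : FullTilting D T Tl) (a : Λ) :
    IsStandard (endOpSimple T Tl) (OrderDual.toDual a)
      (ModuleCat.of (EndOp T) (T →ₗ[S] D.C a)) := by
  obtain ⟨g, hg, hgC⟩ := h.exists_surjective_C a
  have hses := h.ses_hom (X := ModuleCat.of S (LinearMap.ker g)) (SES.ker_subtype hg) hgC
  refine ⟨_, _, homMap T g, h.isProjectiveCover (OrderDual.toDual a), hses.surj,
    (factorsLE_iff h.covers).2 (h.supp_hom_C a), fun N hN x hx => ?_⟩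
  obtain ⟨y, rfl⟩ := hses.exists_eq hx
  rw [factorsLE_iff h.covers] at hN
  have h0 := (h.extVanish_hom hgC fun b hb => hN.vanish (OrderDual.toDual b) fun hle =>
    not_le_of_gt (α := Λ) hb hle).hom_eq_zero (N.mkQ ∘ₗ homMap T (LinearMap.ker g).subtype)
  exact (Submodule.Quotient.mk_eq_zero N).1 (LinearMap.congr_fun h0 y)

/-- A nonzero map `T(a) → C a` agrees with a fixed surjection `g` up to an automorphism of `T(a)`,
so it induces a surjection `Hom(T, T(a)) → Hom(T, C a)`. Hence the kernel of `Hom(T, C a) → L'(a)`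
admits no nonzero map from `Hom(T, T(a))`. -/
theorem occursOnce_hom_C (h : FullTilting D T Tl) (a : Λ) :
    OccursOnce (endOpSimple T Tl) (OrderDual.toDual a)
      (ModuleCat.of (EndOp T) (T →ₗ[S] D.C a)) := by
  obtain ⟨g, hg, hgC⟩ := h.exists_surjective_C a
  have hses := h.ses_hom (X := ModuleCat.of S (LinearMap.ker g)) (SES.ker_subtype hg) hgC
  have hne := D.nontrivial_C a
  have : Nontrivial (T →ₗ[S] D.C a) := by
    obtain ⟨x, hx⟩ := exists_ne (0 : D.C a)
    obtain ⟨y, rfl⟩ := hg x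
    obtain ⟨i, r, hr⟩ := h.summand a
    refine ⟨g ∘ₗ r, 0, fun h0 => hx ?_⟩
    have h1 : r (i y) = y := LinearMap.congr_fun hr y
    rw [← h1]
    exact LinearMap.congr_fun h0 (i y)
  obtain ⟨r, hr, hrs⟩ := h.covers.exists_desc (a := OrderDual.toDual a) hses.surj
  have hsupp : SupportedOn h.covers {b | b ≠ OrderDual.toDual a} (LinearMap.ker r) := by
    have := (h.supp_hom_C a).finite
    suffices H : ExtVanish (EndOp T) 0 (T →ₗ[S] Tl a) (LinearMap.ker r) from
      ⟨(SES.ker_subtype hrs).finite_left, fun b hb => by rw [not_not.1 hb]; exact H⟩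
    refine extVanish_zero_iff.2 fun Φ => by_contra fun hΦ => ?_
    obtain ⟨ψ, hψ⟩ := (h.inAdd a).exists_homMap_eq ((LinearMap.ker r).subtype ∘ₗ Φ)
    have hψ0 : ψ ≠ 0 := fun h0 => hΦ <| LinearMap.ext fun x => Subtype.ext <| by
      rw [h0] at hψ
      exact (LinearMap.congr_fun hψ x).symm
    obtain ⟨φ, ⟨u, rfl⟩, rfl⟩ := h.exists_isUnit hg hgC hψ0
    have := h.covers.isSimple (OrderDual.toDual a)
    have := IsSimpleModule.nontrivial (EndOp T) (endOpSimple T Tl (OrderDual.toDual a))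
    obtain ⟨y, hy⟩ := exists_ne (0 : endOpSimple T Tl (OrderDual.toDual a))
    obtain ⟨x, rfl⟩ := hrs y
    obtain ⟨z, rfl⟩ := hses.surj x
    have h2 : homMap T (g ∘ₗ u.1) (u⁻¹.1 ∘ₗ z) = homMap T g z := by
      have : u.1 ∘ₗ u⁻¹.1 = LinearMap.id := u.mul_inv
      rw [homMap_apply, LinearMap.comp_assoc, ← LinearMap.comp_assoc z, this, LinearMap.id_comp,
        homMap_apply]
    refine hy ?_
    rw [← h2, hψ]
    exact (Φ _).2
  obtain ⟨n, s, hs, hne⟩ := (SupportedOn.filt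
    (M := ModuleCat.of (EndOp T) (LinearMap.ker r)) hsupp).exists_hasFiltration iso_closed_L
  refine ⟨n + 1, Fin.snoc (α := fun _ => Λᵒᵈ) s (OrderDual.toDual a),
    HasFiltration.snoc (SES.ker_subtype hrs) hs ⟨LinearEquiv.refl _ _⟩ iso_closed_L,
    Fin.last n, by simp, fun i hi => ?_⟩
  induction i using Fin.lastCases with
  | last => rfl
  | cast i => exact absurd (by simpa using hi) (hne i)

/-- `Hom(T, -)` turns costandard filtrations into standard ones. -/
theorem filt_hom (h : FullTilting D T Tl) {A : Set Λ} {X : ModuleCat.{u} S} (hX : D.FiltC A X) :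
    Filt (fun N => ∃ b : Λᵒᵈ, OrderDual.ofDual b ∈ A ∧ IsStandard (endOpSimple T Tl) b N)
      (ModuleCat.of (EndOp T) (T →ₗ[S] X)) := by
  induction hX with
  | zero X hX => exact .zero _ (inferInstanceAs (Subsingleton (T →ₗ[S] X)))
  | @cons X M Z f g hses hX hZ ih =>
    obtain ⟨a, ha, ⟨e⟩⟩ := hZ
    exact .cons (X := ModuleCat.of (EndOp T) (T →ₗ[S] X)) (Z := ModuleCat.of (EndOp T) (T →ₗ[S] Z))
      _ _ (h.ses_hom hses hX) ih ⟨OrderDual.toDual a, ha,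
        (h.isStandard_hom_C a).congr (homEquiv T e.symm)⟩

/-- The projective module `Hom(T, T(a))` is an extension of the standard module `Hom(T, C a)` by
`Hom(T, K)`, where `K` is the kernel of `T(a) → C a` and has sections `C b` with `b < a`. -/
theorem isQuasiHereditary (h : FullTilting D T Tl) : IsQuasiHereditary (endOpSimple T Tl) where
  full := h.isFullSetOfSimples
  standard a := ⟨_, h.isStandard_hom_C a, h.occursOnce_hom_C a⟩
  projective a := by
    refine ⟨_, _, h.isProjectiveCover a, ?_⟩
    obtain ⟨g, hg, hgC⟩ := h.exists_surjective_C (OrderDual.ofDual a)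
    have hses := h.ses_hom (X := ModuleCat.of S (LinearMap.ker g)) (SES.ker_subtype hg) hgC
    obtain ⟨n, s, hs, hne⟩ := (h.filt_hom hgC).exists_hasFiltration fun _ _ _ h e => h.congr e
    have hlt : ∀ i, a < s i := hne
    refine ⟨n + 1, Fin.snoc (α := fun _ => Λᵒᵈ) s a,
      HasFiltration.snoc (Y := ModuleCat.of (EndOp T) (T →ₗ[S] Tl (OrderDual.ofDual a)))
        hses hs (h.isStandard_hom_C _) fun _ _ _ h e => h.congr e,
      ⟨Fin.last n, by simp, fun i hi => ?_⟩, fun i => ?_⟩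
    · induction i using Fin.lastCases with
      | last => rfl
      | cast i => exact absurd (by simpa using hi) (hlt i).ne'
    · induction i using Fin.lastCases with
      | last => simp
      | cast i => simpa using (hlt i).le

end FullTilting

end RingelQuasiHereditary

theorem enat_eq_of_forall_le_natCast_iff {x y : ℕ∞} (h : ∀ d : ℕ, x ≤ d ↔ y ≤ d) : x = y := by
  have key : ∀ {x y : ℕ∞}, (∀ d : ℕ, y ≤ d → x ≤ d) → x ≤ y := fun {x y} h => by
    induction y using ENat.recTopCoe with
    | top => exact le_top
    | coe d => exact h d le_rfl
  exact le_antisymm (key fun d => (h d).2) (key fun d => (h d).1)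

/-! ### The `Δ`-filtration dimension and projective dimensions over the Ringel dual -/

section HomDimension

variable {S : Type u} [Ring S]

/-- `Hom(T, -)` maps `add X` to `add Hom(T, X)`. -/
theorem InAdd.map_hom {X M : Type u} [AddCommGroup X] [Module S X] [AddCommGroup M] [Module S M]
    (h : InAdd S X M) (T : ModuleCat.{u} S) : InAdd (EndOp T) (T →ₗ[S] X) (T →ₗ[S] M) := by
  obtain ⟨n, i, r, hr⟩ := h
  let e : (Fin n → T →ₗ[S] X) →ₗ[EndOp T] (T →ₗ[S] (Fin n → X)) :=
    { toFun := fun g => LinearMap.pi g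
      map_add' := fun _ _ => rfl
      map_smul' := fun _ _ => rfl }
  refine ⟨n, LinearMap.pi fun k => homMap T (LinearMap.proj k ∘ₗ i), homMap T r ∘ₗ e,
    LinearMap.ext fun g => LinearMap.ext fun t => ?_⟩
  exact LinearMap.congr_fun hr (g t)

variable [IsArtinianRing S] {Λ : Type v} [PartialOrder Λ]
  {L : Λ → ModuleCat.{u} S} {D : HighestWeight L} {T : ModuleCat.{u} S} {Tl : Λ → ModuleCat.{u} S}

theorem IsFiniteCogenerator.filtC {I : ModuleCat.{u} S} (hI : IsFiniteCogenerator S I)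
    (D : HighestWeight L) : D.FiltC Set.univ I :=
  D.filtC_of_injective hI.finite hI.injective

namespace HighestWeight

/-- The cokernel of an embedding of modules with costandard filtrations. -/
theorem FiltC.right {X M Y : ModuleCat.{u} S} {f : X →ₗ[S] M} {g : M →ₗ[S] Y} (h : SES f g)
    (hX : D.FiltC Set.univ X) (hM : D.FiltC Set.univ M) : D.FiltC Set.univ Y :=
  have := hM.finite
  D.filtC_of_extVanish h.finite_right fun a =>
    h.cov_right _ (hM.extVanish_Δ a 0) (hX.extVanish_Δ a 1)

end HighestWeight

namespace FullTilting

/-- A module `M` with a costandard filtration has a standard filtration, hence lies in `add T`, if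
and only if `Hom(T, M)` is projective; dimension shifting along `add T`-resolutions of `M` gives
the general statement. -/
theorem extVanish_C_iff (h : FullTilting D T Tl) [IsArtinianRing (EndOp T)] (d : ℕ)
    {M : ModuleCat.{u} S} (hM : D.FiltC Set.univ M) :
    (∀ a j, d < j → ExtVanish S j M (D.C a)) ↔
      ∀ Y : ModuleCat.{u} (EndOp T), Module.Finite (EndOp T) Y → ∀ j, d < j →
        ExtVanish (EndOp T) j (T →ₗ[S] M) Y := by
  induction d generalizing M with
  | zero =>
    constructor
    · intro hv Y _ j hj
      have hadd := h.inAdd_of_filt (D.filtΔ_of_extVanish hM.finite fun a => hv a 1 one_pos) hM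
      have := hadd.projective_hom
      obtain ⟨j, rfl⟩ := Nat.exists_eq_succ_of_ne_zero (by omega : j ≠ 0)
      exact extVanish_of_projective j
    · intro hv a j hj
      obtain ⟨N, f, hN, hf, hK⟩ := h.exists_cover hM
      have hses := h.ses_hom (X := ModuleCat.of S (LinearMap.ker f)) (SES.ker_subtype hf) hK
      obtain ⟨Φ, hΦ⟩ := hses.exists_lift (W := T →ₗ[S] M)
        (hv (ModuleCat.of (EndOp T) (T →ₗ[S] LinearMap.ker f)) (h.finite_hom hK) 1 one_pos)
        LinearMap.id
      obtain ⟨σ, rfl⟩ := h.exists_homMap_eq hM Φ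
      have hσ : f ∘ₗ σ = LinearMap.id := by
        rw [← sub_eq_zero]
        refine h.eq_zero_of_homMap hM ?_
        rw [homMap_sub, homMap_comp, hΦ, homMap_id, sub_self]
      obtain ⟨j, rfl⟩ := Nat.exists_eq_succ_of_ne_zero (by omega : j ≠ 0)
      exact (h.filtΔ_of_inAdd (hN.retract σ f hσ)).extVanish_C a j
  | succ d ih =>
    obtain ⟨N, f, hN, hf, hK⟩ := h.exists_cover hM
    have hses := SES.ker_subtype hf
    have hses' := h.ses_hom (X := ModuleCat.of S (LinearMap.ker f)) hses hK
    have hN' := hN.projective_hom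
    have hNΔ := h.filtΔ_of_inAdd hN
    trans ∀ a j, d < j → ExtVanish S j (LinearMap.ker f) (D.C a)
    · refine ⟨fun hv a j hj => ?_, fun hv a j hj => ?_⟩
      · obtain ⟨j, rfl⟩ := Nat.exists_eq_succ_of_ne_zero (by omega : j ≠ 0)
        exact hses.con_left _ (hNΔ.extVanish_C a j) (hv a _ (by omega))
      · obtain ⟨j, rfl⟩ := Nat.exists_eq_succ_of_ne_zero (by omega : j ≠ 0)
        exact hses.con_right _ (hv a _ (by omega)) (hNΔ.extVanish_C a j)
    · refine (ih hK).trans ⟨fun hv Y hY j hj => ?_, fun hv Y hY j hj => ?_⟩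
      · obtain ⟨j, rfl⟩ := Nat.exists_eq_succ_of_ne_zero (by omega : j ≠ 0)
        exact hses'.con_right _ (hv Y hY _ (by omega)) (extVanish_of_projective j)
      · obtain ⟨j, rfl⟩ := Nat.exists_eq_succ_of_ne_zero (by omega : j ≠ 0)
        exact hses'.con_left _ (extVanish_of_projective j) (hv Y hY _ (by omega))

/-- Vanishing of `Ext^j(Hom(T, I), Y)` passes to all `Ext^j(Hom(T, M), Y)`, along injective
resolutions. -/
theorem extVanish_hom_of_cogenerator (h : FullTilting D T Tl) {I : ModuleCat.{u} S}
    (hI : IsFiniteCogenerator S I) {d : ℕ} {Y : ModuleCat.{u} (EndOp T)}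
    (hY : ∀ j, d < j → ExtVanish (EndOp T) j (T →ₗ[S] I) Y) {M : ModuleCat.{u} S}
    (hM : D.FiltC Set.univ M) {j : ℕ} (hj : d < j) : ExtVanish (EndOp T) j (T →ₗ[S] M) Y := by
  have := hI.finite
  obtain ⟨n, hn⟩ := D.exists_globalDimension
  -- induction on a bound `m` for the injective dimension of `M`
  have key : ∀ (m : ℕ) (M : ModuleCat.{u} S), D.FiltC Set.univ M →
      (∀ (X : ModuleCat.{u} S), Module.Finite S X → ∀ i, m < i → ExtVanish S i X M) →
      ∀ j, d < j → ExtVanish (EndOp T) j (T →ₗ[S] M) Y := by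
    intro m
    induction m with
    | zero =>
      intro M hM hv j hj
      obtain ⟨r, f, hf⟩ := hI.exists_embedding M hM.finite
      have hses := SES.range_mkQ hf
      obtain ⟨ρ, hρ⟩ := hses.exists_extension (hv (ModuleCat.of S _) hses.finite_right 1 one_pos)
        LinearMap.id
      exact (InAdd.map_hom ⟨r, f, ρ, hρ⟩ T).extVanish_left (hY j hj)
    | succ m ih =>
      intro M hM hv j hj
      obtain ⟨r, f, hf⟩ := hI.exists_embedding M hM.finite
      have hses := SES.range_mkQ hf
      have hIr : InAdd S I (Fin r → I) := ⟨r, LinearMap.id, LinearMap.id, rfl⟩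
      have hQ : D.FiltC Set.univ (ModuleCat.of S ((Fin r → I) ⧸ LinearMap.range f)) :=
        hM.right (M := ModuleCat.of S (Fin r → I)) hses
          (D.filtC_of_extVanish hIr.finite fun a => hIr.extVanish_right
            (extVanish_of_injective hI.injective 0))
      refine (h.ses_hom (M := ModuleCat.of S (Fin r → I))
        (Y := ModuleCat.of S ((Fin r → I) ⧸ LinearMap.range f)) hses hM).con_left _
        ((hIr.map_hom T).extVanish_left (hY j hj)) (ih _ hQ (fun X hX i hi => ?_) _ (by omega))
      obtain ⟨i, rfl⟩ := Nat.exists_eq_succ_of_ne_zero (by omega : i ≠ 0)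
      refine hses.cov_right _ (hIr.extVanish_right (extVanish_of_injective hI.injective i))
        (hv X hX _ (by omega))
  exact key n M hM (fun X hX i hi => hn X M hX i hi) j hj

/-- The invariant `wfd S` is the projective dimension of `Hom(T, I)`, where `I` is an injective
cogenerator, and so is `gfd` of the Ringel dual. -/
theorem wfd_eq (h : FullTilting D T Tl) [IsArtinianRing (EndOp T)] {I : ModuleCat.{u} S}
    (hI : IsFiniteCogenerator S I) (hR : EnoughFiniteInjectives (EndOp T)) :
    wfd L = gfd (endOpSimple T Tl) := by
  obtain ⟨D'⟩ := h.isQuasiHereditary.nonempty_highestWeight hR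
  refine enat_eq_of_forall_le_natCast_iff fun d => ?_
  have hIC := hI.filtC D
  rw [D.wfd_le_iff_cogenerator hI, h.extVanish_C_iff d hIC, D'.gfd_le_iff hR]
  refine ⟨fun hv X hX a j hj => ?_, fun hv Y hY j hj => ?_⟩
  · obtain ⟨e⟩ := D'.isStandard_iff.1 (h.isStandard_hom_C (OrderDual.ofDual a))
    exact (h.extVanish_hom_of_cogenerator hI (hv X hX)
      (.of_mem ⟨_, trivial, ⟨LinearEquiv.refl S _⟩⟩) hj).congr_left e
  · refine (h.filt_hom hIC).extVanish_left ?_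
    rintro N ⟨b, -, hN⟩
    obtain ⟨e⟩ := D'.isStandard_iff.1 hN
    exact (hv Y hY b j hj).congr_left e.symm

end FullTilting

end HomDimension

/-! ### The `Δ`-filtration dimension of the Ringel dual -/

/-- Finitely generated projective modules over the Ringel dual come from `add T`: idempotents of
`End(T^n)` split. -/
theorem exists_inAdd_equiv_hom {S : Type u} [Ring S] {T : ModuleCat.{u} S} {Y : Type u}
    [AddCommGroup Y]
    [Module (EndOp T) Y] [Module.Projective (EndOp T) Y] [Module.Finite (EndOp T) Y] :
    ∃ N : ModuleCat.{u} S, InAdd S T N ∧ Nonempty (Y ≃ₗ[EndOp T] (T →ₗ[S] N)) := by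
  obtain ⟨n, p, hp⟩ := Module.Finite.exists_fin' (EndOp T) Y
  obtain ⟨s, hs⟩ := Module.projective_lifting_property p LinearMap.id hp
  have hTn : InAdd S T (Fin n → T) := ⟨n, LinearMap.id, LinearMap.id, rfl⟩
  let e : (Fin n → EndOp T) ≃ₗ[EndOp T] (T →ₗ[S] (Fin n → T)) :=
    (LinearEquiv.piCongrRight fun _ => endOpEquiv T).trans
      { toFun := fun g => LinearMap.pi g
        map_add' := fun _ _ => rfl
        map_smul' := fun _ _ => rfl
        invFun := fun g k => LinearMap.proj k ∘ₗ g
        left_inv := fun _ => rfl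
        right_inv := fun _ => rfl }
  let i : Y →ₗ[EndOp T] (T →ₗ[S] (Fin n → T)) := e.toLinearMap ∘ₗ s
  let r : (T →ₗ[S] (Fin n → T)) →ₗ[EndOp T] Y := p ∘ₗ e.symm.toLinearMap
  have hri : ∀ y, r (i y) = y := fun y => by
    have : p (s y) = y := LinearMap.congr_fun hs y
    simp [i, r, this]
  obtain ⟨ε, hε⟩ := hTn.exists_homMap_eq (i ∘ₗ r)
  have hε' : ∀ g, homMap T ε g = i (r g) := fun g => LinearMap.congr_fun hε g
  have hεε : ε ∘ₗ ε - ε = 0 := by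
    refine hTn.eq_zero_of_homMap (T := T) (p := LinearMap.id) Function.surjective_id ?_
    refine LinearMap.ext fun g => ?_
    rw [homMap_sub, homMap_comp, LinearMap.sub_apply, LinearMap.comp_apply, hε' g, hε', hri]
    exact sub_self _
  have hidem : ∀ x, ε (ε x) = ε x := fun x => sub_eq_zero.1 (LinearMap.congr_fun hεε x)
  let ι := (LinearMap.range ε).subtype
  let ρ := ε.rangeRestrict
  have hρι : ρ ∘ₗ ι = LinearMap.id := by
    refine LinearMap.ext fun ⟨x, hx⟩ => Subtype.ext ?_
    obtain ⟨y, rfl⟩ := hx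
    exact hidem y
  have hιρ : ι ∘ₗ ρ = ε := rfl
  refine ⟨ModuleCat.of S (LinearMap.range ε), hTn.retract ι ρ hρι,
    ⟨LinearEquiv.ofLinearMap (homMap T ρ ∘ₗ i) (r ∘ₗ homMap T ι) ?_ ?_⟩⟩
  · refine LinearMap.ext fun g => LinearMap.ext fun t => ?_
    simp only [LinearMap.comp_apply]
    rw [← hε']
    have h1 : ρ (ι (g t)) = g t := LinearMap.congr_fun hρι (g t)
    exact (congrArg ρ (congrArg ι h1)).trans h1
  · refine LinearMap.ext fun y => ?_
    simp only [LinearMap.comp_apply]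
    rw [← LinearMap.comp_apply (homMap T ι), ← homMap_comp, hιρ, hε', hri, hri]
    rfl

section InjectiveDimension

variable {S : Type u} [Ring S] [IsArtinianRing S] {Λ : Type v} [PartialOrder Λ]
  {L : Λ → ModuleCat.{u} S} {D : HighestWeight L} {T : ModuleCat.{u} S} {Tl : Λ → ModuleCat.{u} S}

namespace FullTilting

/-- A module `Y` over the Ringel dual with `Ext^j(Y, Hom(T, I)) = 0` for all `j > 0` is of the form
`Hom(T, N)` where `N` has a costandard filtration. -/
theorem exists_equiv_of_extVanish (h : FullTilting D T Tl) [IsArtinianRing (EndOp T)]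
    (D' : HighestWeight (endOpSimple T Tl)) {I : ModuleCat.{u} S}
    (hI : IsFiniteCogenerator S I) (Y : ModuleCat.{u} (EndOp T)) (hY : Module.Finite (EndOp T) Y)
    (hv : ∀ j, 0 < j → ExtVanish (EndOp T) j Y (T →ₗ[S] I)) :
    ∃ N : ModuleCat.{u} S, D.FiltC Set.univ N ∧ Nonempty (Y ≃ₗ[EndOp T] (T →ₗ[S] N)) := by
  -- induction on a bound `m` for the projective dimension of `Y`
  obtain ⟨n, hn⟩ := D'.exists_globalDimension
  have key : ∀ (m : ℕ) (Y : ModuleCat.{u} (EndOp T)), Module.Finite (EndOp T) Y →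
      (∀ j, 0 < j → ExtVanish (EndOp T) j Y (T →ₗ[S] I)) →
      (∀ (Z : ModuleCat.{u} (EndOp T)) j, m < j → ExtVanish (EndOp T) j Y Z) →
      ∃ N : ModuleCat.{u} S, D.FiltC Set.univ N ∧ Nonempty (Y ≃ₗ[EndOp T] (T →ₗ[S] N)) := by
    intro m
    induction m with
    | zero =>
      intro Y hY _ hm
      obtain ⟨P, p, hP, hP', hp⟩ := exists_free_cover Y hY
      have hses := SES.ker_subtype hp
      obtain ⟨s, hs⟩ := hses.exists_lift (hm (ModuleCat.of _ (LinearMap.ker p)) 1 one_pos)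
        LinearMap.id
      have := Module.Projective.of_split s p hs
      obtain ⟨N, hN, e⟩ := exists_inAdd_equiv_hom (T := T) (Y := Y)
      exact ⟨N, h.filtC_of_inAdd hN, e⟩
    | succ m ih =>
      intro Y hY hv hm
      obtain ⟨P, p, hP, hP', hp⟩ := exists_free_cover Y hY
      have hses := SES.ker_subtype hp
      obtain ⟨N, hN, ⟨e⟩⟩ := ih (ModuleCat.of _ (LinearMap.ker p)) hses.finite_left
        (fun j hj => by
          obtain ⟨j, rfl⟩ := Nat.exists_eq_succ_of_ne_zero hj.ne'
          exact hses.con_left _ (extVanish_of_projective j) (hv _ (by omega)))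
        (fun Z j hj => by
          obtain ⟨j, rfl⟩ := Nat.exists_eq_succ_of_ne_zero (by omega : j ≠ 0)
          exact hses.con_left _ (extVanish_of_projective j) (hm Z _ (by omega)))
      obtain ⟨M, hM, ⟨e'⟩⟩ := exists_inAdd_equiv_hom (T := T) (Y := P)
      -- the presentation `Hom(T, N) → Hom(T, M)` of `Y` comes from a map `φ : N → M`; this is an
      -- embedding since `Ext¹(Y, Hom(T, I)) = 0` allows maps `N → I` to be extended to `M`
      obtain ⟨φ, hφ⟩ := h.exists_homMap_eq hN
        (e'.toLinearMap ∘ₗ (LinearMap.ker p).subtype ∘ₗ e.symm.toLinearMap)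
      have hφ' : ∀ g, homMap T φ g = e' (e.symm g).1 := fun g => LinearMap.congr_fun hφ g
      have hses' : SES (homMap T φ) (p ∘ₗ e'.symm.toLinearMap) := by
        refine ⟨fun a b hab => ?_, fun g => ⟨fun hg => ⟨e ⟨e'.symm g, hg⟩, ?_⟩, ?_⟩,
          hp.comp e'.symm.surjective⟩
        · rw [hφ', hφ'] at hab
          exact e.symm.injective (Subtype.ext (e'.injective hab))
        · rw [hφ']
          simp
        · rintro ⟨a, rfl⟩
          rw [hφ']
          simp
      have hinj : Function.Injective φ := by
        obtain ⟨r, i, hi⟩ := hI.exists_embedding N hN.finite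
        have hext : ∀ k : Fin r, ∃ ψ : M →ₗ[S] I, ψ ∘ₗ φ = LinearMap.proj k ∘ₗ i := by
          intro k
          obtain ⟨Ψ, hΨ⟩ := hses'.exists_extension (hv 1 one_pos)
            (homMap T (LinearMap.proj k ∘ₗ i))
          obtain ⟨ψ, rfl⟩ := hM.exists_homMap_eq Ψ
          refine ⟨ψ, sub_eq_zero.1 (h.eq_zero_of_homMap hN ?_)⟩
          rw [homMap_sub, homMap_comp, hΨ, sub_self]
        choose ψ hψ using hext
        refine Function.Injective.of_comp (f := LinearMap.pi ψ) ?_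
        have : LinearMap.pi ψ ∘ φ = i := by
          funext x k
          exact LinearMap.congr_fun (hψ k) x
        rwa [this]
      have hsesφ := SES.range_mkQ hinj
      have hQ : D.FiltC Set.univ (ModuleCat.of S (M ⧸ LinearMap.range φ)) :=
        hN.right hsesφ (h.filtC_of_inAdd hM)
      have hG := h.ses_hom (Y := ModuleCat.of S (M ⧸ LinearMap.range φ)) hsesφ hN
      refine ⟨_, hQ, ⟨?_⟩⟩
      exact ((p ∘ₗ e'.symm.toLinearMap).quotKerEquivOfSurjective hses'.surj).symm.trans
        ((Submodule.quotEquivOfEq _ _ (hses'.exact.linearMap_ker_eq.trans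
          hG.exact.linearMap_ker_eq.symm)).trans
          ((homMap T (LinearMap.range φ).mkQ).quotKerEquivOfSurjective hG.surj))
  exact key n Y hY hv fun Z j hj => hn Y Z hY j hj

/-- The module `Hom(T, I)` has a costandard filtration: maps to `I` extend from the kernel of
`T(a) → C a` to `T(a)`, hence `Ext¹(Hom(T, C a), Hom(T, I)) = 0`. -/
theorem filtC_hom_cogenerator (h : FullTilting D T Tl) [IsArtinianRing (EndOp T)]
    (D' : HighestWeight (endOpSimple T Tl)) {I : ModuleCat.{u} S}
    (hI : IsFiniteCogenerator S I) :
    D'.FiltC Set.univ (ModuleCat.of (EndOp T) (T →ₗ[S] I)) := by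
  refine D'.filtC_of_extVanish (h.finite_hom (hI.filtC D)) fun a => ?_
  obtain ⟨e⟩ := D'.isStandard_iff.1 (h.isStandard_hom_C (OrderDual.ofDual a))
  refine ExtVanish.congr_left ?_ e
  obtain ⟨g, hg, hgC⟩ := h.exists_surjective_C (OrderDual.ofDual a)
  have hses := SES.ker_subtype hg
  have := (h.inAdd (OrderDual.ofDual a)).projective_hom
  refine (h.ses_hom (X := ModuleCat.of S (LinearMap.ker g)) hses hgC).extVanish_of_extension
    (extVanish_of_projective 0) fun Φ => ?_
  obtain ⟨φ, rfl⟩ := h.exists_homMap_eq hgC Φ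
  obtain ⟨ψ, hψ⟩ := hses.exists_extension (extVanish_of_injective hI.injective 0) φ
  exact ⟨homMap T ψ, by rw [← homMap_comp, hψ]⟩

/-- The invariant `wfd` of the Ringel dual is the injective dimension of `Hom(T, I)`: if this is
`d`, then a `d`-th syzygy of any module is of the form `Hom(T, N)` with `N` costandardly filtered, so
it has a standard filtration. -/
theorem wfd_le_iff_hom_cogenerator (h : FullTilting D T Tl) [IsArtinianRing (EndOp T)]
    (D' : HighestWeight (endOpSimple T Tl)) {I : ModuleCat.{u} S}
    (hI : IsFiniteCogenerator S I) (d : ℕ) :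
    wfd (endOpSimple T Tl) ≤ d ↔ ∀ Y : ModuleCat.{u} (EndOp T), Module.Finite (EndOp T) Y →
      ∀ j, d < j → ExtVanish (EndOp T) j Y (T →ₗ[S] I) := by
  rw [D'.wfd_le_iff]
  constructor
  · intro hv Y hY j hj
    refine (h.filtC_hom_cogenerator D' hI).extVanish_right ?_
    rintro N ⟨b, -, ⟨e⟩⟩
    exact (hv Y hY b j hj).congr_right e.symm
  · intro hv Y hY a
    have key : ∀ (d : ℕ) (Y : ModuleCat.{u} (EndOp T)), Module.Finite (EndOp T) Y →
        (∀ j, d < j → ExtVanish (EndOp T) j Y (T →ₗ[S] I)) →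
        ∀ j, d < j → ExtVanish (EndOp T) j Y (D'.C a) := by
      intro d
      induction d with
      | zero =>
        intro Y hY hv j hj
        obtain ⟨N, hN, ⟨e⟩⟩ := h.exists_equiv_of_extVanish D' hI Y hY hv
        obtain ⟨j, rfl⟩ := Nat.exists_eq_succ_of_ne_zero hj.ne'
        refine ExtVanish.congr_left ?_ e.symm
        refine (h.filt_hom hN).extVanish_left ?_
        rintro X ⟨b, -, hX⟩
        obtain ⟨e⟩ := D'.isStandard_iff.1 hX
        exact (D'.extVanish_Δ_C a b j).congr_left e.symm
      | succ d ih =>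
        intro Y hY hv j hj
        obtain ⟨P, p, hP, hP', hp⟩ := exists_free_cover Y hY
        have hses := SES.ker_subtype hp
        obtain ⟨j, rfl⟩ := Nat.exists_eq_succ_of_ne_zero (by omega : j ≠ 0)
        refine hses.con_right _ (ih (ModuleCat.of _ (LinearMap.ker p)) hses.finite_left
          (fun j hj => ?_) j (by omega)) (extVanish_of_projective j)
        obtain ⟨j, rfl⟩ := Nat.exists_eq_succ_of_ne_zero (by omega : j ≠ 0)
        exact hses.con_left _ (extVanish_of_projective j) (hv _ (by omega))
    exact key d Y hY (hv Y hY)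

end FullTilting

end InjectiveDimension

/-! ### Finite-dimensional algebras have enough injectives -/

section FiniteDimensionalAlgebras

variable {k R : Type u} [Field k] [Ring R] [Algebra k R]

/-- The dual `Hom_k(R, k)` of the right regular module of a `k`-algebra `R`, as a left module: the
element `r` acts by `(r • ξ) x = ξ (x * r)`. -/
def RegDual (k R : Type u) [Field k] [Ring R] [Algebra k R] : Type u := Module.Dual k R

noncomputable instance : AddCommGroup (RegDual k R) := inferInstanceAs (AddCommGroup (R →ₗ[k] k))

/-- The value of a linear form. -/
def RegDual.eval (ξ : RegDual k R) : R →ₗ[k] k := ξ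

noncomputable instance : Module R (RegDual k R) where
  smul r ξ := ξ.eval ∘ₗ LinearMap.mulRight k r
  one_smul ξ := LinearMap.ext fun x => congrArg ξ.eval (mul_one x)
  mul_smul r s ξ := LinearMap.ext fun x => congrArg ξ.eval (mul_assoc x r s).symm
  smul_zero _ := rfl
  smul_add _ _ _ := rfl
  add_smul r s ξ := LinearMap.ext fun x =>
    (congrArg ξ.eval (mul_add x r s)).trans (map_add ξ.eval _ _)
  zero_smul ξ := LinearMap.ext fun x => (congrArg ξ.eval (mul_zero x)).trans (map_zero ξ.eval)

/-- The `k`-vector space structure of `Hom_k(R, k)`. -/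
noncomputable abbrev RegDual.vectorSpace : Module k (RegDual k R) :=
  inferInstanceAs (Module k (R →ₗ[k] k))

theorem RegDual.eval_smul (r : R) (ξ : RegDual k R) (x : R) :
    (r • ξ).eval x = ξ.eval (x * r) := rfl

theorem RegDual.eval_add (ξ η : RegDual k R) : (ξ + η).eval = ξ.eval + η.eval := rfl

theorem RegDual.ext {ξ η : RegDual k R} (h : ∀ x, ξ.eval x = η.eval x) : ξ = η := LinearMap.ext h

/-- Linear forms on an `R`-module correspond to homomorphisms to `Hom_k(R, k)`. -/
def RegDual.lift {X : Type u} [AddCommGroup X] [Module R X] [Module k X] [IsScalarTower k R X]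
    (ξ : X →ₗ[k] k) : X →ₗ[R] RegDual k R where
  toFun x := ξ ∘ₗ (LinearMap.toSpanSingleton R X x).restrictScalars k
  map_add' x y := LinearMap.ext fun r => (congrArg ξ (smul_add r x y)).trans (map_add ξ _ _)
  map_smul' s x := RegDual.ext fun r => congrArg ξ (mul_smul r s x).symm

theorem RegDual.eval_lift {X : Type u} [AddCommGroup X] [Module R X] [Module k X]
    [IsScalarTower k R X] (ξ : X →ₗ[k] k) (x : X) (r : R) :
    (RegDual.lift (R := R) ξ x).eval r = ξ (r • x) := rfl

/-- Homomorphisms to `Hom_k(R, k)` correspond to linear forms, and linear forms on subspaces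
extend. -/
theorem RegDual.injective : Module.Injective R (RegDual k R) := by
  refine ⟨fun X Y _ _ _ _ f hf g => ?_⟩
  let _ : Module k X := Module.compHom X (algebraMap k R)
  let _ : Module k Y := Module.compHom Y (algebraMap k R)
  have : IsScalarTower k R X := ⟨fun c r x => by
    rw [Algebra.smul_def, mul_smul]; rfl⟩
  have : IsScalarTower k R Y := ⟨fun c r x => by
    rw [Algebra.smul_def, mul_smul]; rfl⟩
  obtain ⟨l, hl⟩ := (f.restrictScalars k).exists_leftInverse_of_injective
    (LinearMap.ker_eq_bot.2 hf)
  have hl' : ∀ x, l (f x) = x := fun x => LinearMap.congr_fun hl x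
  let ξ : X →ₗ[k] k :=
    { toFun := fun x => (g x).eval 1
      map_add' := fun x y => by rw [map_add, RegDual.eval_add, LinearMap.add_apply]
      map_smul' := fun c x => by
        rw [← algebraMap_smul R c x, map_smul, RegDual.eval_smul, one_mul,
          Algebra.algebraMap_eq_smul_one, map_smul, RingHom.id_apply] }
  refine ⟨RegDual.lift (ξ ∘ₗ l), fun x => RegDual.ext fun r => ?_⟩
  rw [RegDual.eval_lift, ← map_smul, LinearMap.comp_apply, hl']
  change (g (r • x)).eval 1 = _
  rw [map_smul, RegDual.eval_smul, one_mul]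

variable [Module.Finite k R]

theorem RegDual.finite : Module.Finite R (RegDual k R) := by
  let _ : Module k (RegDual k R) := RegDual.vectorSpace
  have : Module.Finite k (RegDual k R) := inferInstanceAs (Module.Finite k (R →ₗ[k] k))
  have : IsScalarTower k R (RegDual k R) := ⟨fun c r ξ => RegDual.ext fun x => by
    rw [RegDual.eval_smul, mul_smul_comm, map_smul]
    rfl⟩
  exact Module.Finite.of_restrictScalars_finite k R _

/-- The coordinate forms of a `k`-basis of a module embed it into a power of `Hom_k(R, k)`. -/
theorem RegDual.isFiniteCogenerator :
    IsFiniteCogenerator R (ModuleCat.of R (RegDual k R)) where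
  finite := RegDual.finite
  injective := RegDual.injective
  exists_embedding X hX := by
    let _ : Module k X := Module.compHom X (algebraMap k R)
    have : IsScalarTower k R X := ⟨fun c r x => by rw [Algebra.smul_def, mul_smul]; rfl⟩
    have : Module.Finite k X := Module.Finite.trans R X
    let b := Module.finBasis k X
    refine ⟨_, LinearMap.pi fun i => RegDual.lift (b.coord i),
      (injective_iff_map_eq_zero _).2 fun x hx => ?_⟩
    refine b.repr.injective (Finsupp.ext fun i => ?_)
    have h : (RegDual.lift (R := R) (b.coord i) x).eval 1 = 0 :=
      congrArg (fun ξ => RegDual.eval ξ 1) (congrFun hx i)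
    rw [RegDual.eval_lift, one_smul] at h
    simpa using h

theorem IsFiniteCogenerator.enoughFiniteInjectives {R : Type u} [Ring R] {I : ModuleCat.{u} R}
    (hI : IsFiniteCogenerator R I) : EnoughFiniteInjectives R := fun M _ _ hM => by
  obtain ⟨n, i, hi⟩ := hI.exists_embedding (ModuleCat.of R M) hM
  have := hI.finite
  have := hI.injective
  exact ⟨ModuleCat.of R (Fin n → I), i, inferInstanceAs (Module.Finite R (Fin n → I)),
    inferInstanceAs (Module.Injective R (Fin n → I)), hi⟩

end FiniteDimensionalAlgebras

/-! ### The Ringel dual as a finite-dimensional algebra -/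

section RingelDualAlgebra

variable {k S : Type u} [Field k] [Ring S] [Algebra k S]

theorem finite_linearMap [Module.Finite k S] (M N : Type u) [AddCommGroup M] [Module S M]
    [AddCommGroup N] [Module S N] [Module k N] [IsScalarTower k S N] [Module.Finite S M]
    [Module.Finite S N] : Module.Finite k (M →ₗ[S] N) := by
  let _ : Module k M := Module.compHom M (algebraMap k S)
  have : IsScalarTower k S M := ⟨fun c r x => by rw [Algebra.smul_def, mul_smul]; rfl⟩
  have : Module.Finite k M := Module.Finite.trans S M
  have : Module.Finite k N := Module.Finite.trans S N
  exact Module.Finite.of_injective (LinearMap.restrictScalarsₗ k S M N k)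
    (LinearMap.restrictScalars_injective k)

variable (T : ModuleCat.{u} S) [Module k T] [IsScalarTower k S T]

noncomputable instance : Algebra k (EndOp T) :=
  inferInstanceAs (Algebra k (Module.End S T)ᵐᵒᵖ)

theorem EndOp.finite [Module.Finite k S] [Module.Finite S T] : Module.Finite k (EndOp T) := by
  have := finite_linearMap (k := k) (S := S) T T
  exact inferInstanceAs (Module.Finite k (Module.End S T)ᵐᵒᵖ)

end RingelDualAlgebra

/-! ### The contravariant functor `Hom(-, T)` -/

section ContravariantHom

variable {S : Type u} [Ring S]
variable {M N T : Type u} [AddCommGroup M] [Module S M] [AddCommGroup N] [Module S N]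
  [AddCommGroup T] [Module S T]

/-- Every `End(T)`-linear map `Hom(M, T) → Hom(N, T)` is induced by a map `N → M` if
`M` is in `add T`. -/
theorem InAdd.exists_comp_eq (h : InAdd S T M) (σ : (M →ₗ[S] T) →+ (N →ₗ[S] T))
    (hσ : ∀ (c : T →ₗ[S] T) g, σ (c ∘ₗ g) = c ∘ₗ σ g) :
    ∃ φ : N →ₗ[S] M, ∀ g, σ g = g ∘ₗ φ := by
  obtain ⟨n, i, r, hr⟩ := h
  refine ⟨r ∘ₗ LinearMap.pi fun j => σ (LinearMap.proj j ∘ₗ i), fun g => ?_⟩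
  have h1 : g = ∑ j : Fin n, (g ∘ₗ r ∘ₗ LinearMap.single S (fun _ : Fin n => T) j) ∘ₗ
      (LinearMap.proj j ∘ₗ i) := by
    refine LinearMap.ext fun x => ?_
    have h2 : r (i x) = x := LinearMap.congr_fun hr x
    simp only [LinearMap.sum_apply, LinearMap.comp_apply, LinearMap.proj_apply,
      LinearMap.single_apply]
    rw [← map_sum, ← map_sum, Finset.univ_sum_single, h2]
  conv_lhs => rw [h1]
  rw [map_sum]
  refine LinearMap.ext fun x => ?_
  simp only [hσ, LinearMap.sum_apply, LinearMap.comp_apply, LinearMap.single_apply]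
  rw [← map_sum, ← map_sum]
  exact congrArg (fun y => g (r y)) (Finset.univ_sum_single fun j => σ (LinearMap.proj j ∘ₗ i) x)

variable [IsArtinianRing S] {Λ : Type v} [PartialOrder Λ]
  {L : Λ → ModuleCat.{u} S} {D : HighestWeight L} {T : ModuleCat.{u} S} {Tl : Λ → ModuleCat.{u} S}

namespace FullTilting

/-- A module with a standard filtration is cogenerated by `T`. -/
theorem eq_zero_of_forall_comp (h : FullTilting D T Tl) {A : Set Λ} {M : ModuleCat.{u} S}
    (hM : D.FiltΔ A M) {f : N →ₗ[S] M} (hf : ∀ g : M →ₗ[S] T, g ∘ₗ f = 0) : f = 0 := by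
  obtain ⟨X, u, ⟨n, i, r, hr⟩, hu, -⟩ := h.exists_embedding hM
  refine LinearMap.ext fun x => hu ?_
  have h1 : ∀ y, r (i y) = y := fun y => LinearMap.congr_fun hr y
  have h2 : i (u (f x)) = 0 := funext fun j =>
    LinearMap.congr_fun (hf (LinearMap.proj j ∘ₗ i ∘ₗ u)) x
  rw [← h1 (u (f x)), h2, map_zero, LinearMap.zero_apply, map_zero]

/-- `Hom(-, T)` is full on maps into modules with a standard filtration. -/
theorem exists_comp_eq (h : FullTilting D T Tl) {A : Set Λ} {M : ModuleCat.{u} S}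
    (hM : D.FiltΔ A M) (σ : (M →ₗ[S] T) →+ (N →ₗ[S] T))
    (hσ : ∀ (c : T →ₗ[S] T) g, σ (c ∘ₗ g) = c ∘ₗ σ g) :
    ∃ φ : N →ₗ[S] M, ∀ g, σ g = g ∘ₗ φ := by
  obtain ⟨X, u, hX, hu, hext⟩ := h.exists_embedding hM
  have hses := SES.range_mkQ hu
  have hQ : D.FiltΔ Set.univ (ModuleCat.of S (X ⧸ LinearMap.range u)) :=
    hext.filtΔ hses (h.filtΔ_of_inAdd hX)
  let σ' : (X →ₗ[S] T) →+ (N →ₗ[S] T) :=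
    { toFun := fun g => σ (g ∘ₗ u)
      map_zero' := by rw [LinearMap.zero_comp, map_zero]
      map_add' := fun g g' => by rw [LinearMap.add_comp, map_add] }
  obtain ⟨ψ, hψ⟩ := hX.exists_comp_eq σ' fun c g => by
    change σ ((c ∘ₗ g) ∘ₗ u) = c ∘ₗ σ (g ∘ₗ u)
    rw [LinearMap.comp_assoc, hσ]
  have h0 : (LinearMap.range u).mkQ ∘ₗ ψ = 0 := by
    refine h.eq_zero_of_forall_comp hQ fun g => ?_
    have h1 := hψ (g ∘ₗ (LinearMap.range u).mkQ)
    change σ ((g ∘ₗ (LinearMap.range u).mkQ) ∘ₗ u) = _ at h1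
    rw [LinearMap.comp_assoc, hses.comp_eq_zero, LinearMap.comp_zero, map_zero] at h1
    rw [← LinearMap.comp_assoc, ← h1]
  obtain ⟨φ, rfl⟩ := hses.lift ψ fun x => LinearMap.congr_fun h0 x
  refine ⟨φ, fun g => ?_⟩
  obtain ⟨g', rfl⟩ := hses.exists_extension (hQ.extVanish_filtC h.filtC 0) g
  rw [LinearMap.comp_assoc]
  exact hψ g'

end FullTilting

end ContravariantHom

/-! ### The functor `Hom_k(Hom(-, T), k)` -/

section HomDuals

variable (k : Type u) {S : Type u} [Field k] [Ring S] [Algebra k S] (T : ModuleCat.{u} S)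
  [Module k T] [IsScalarTower k S T]
variable {M N X Y : Type u} [AddCommGroup M] [Module S M] [AddCommGroup N] [Module S N]
  [AddCommGroup X] [Module S X] [AddCommGroup Y] [Module S Y]

/-- Composition with an endomorphism of `T`, as a `k`-linear map. -/
def homPost (c : T →ₗ[S] T) : (M →ₗ[S] T) →ₗ[k] (M →ₗ[S] T) where
  toFun g := c ∘ₗ g
  map_add' _ _ := LinearMap.comp_add _ _ _
  map_smul' a g := LinearMap.ext fun x => LinearMap.map_smul_of_tower c a (g x)

/-- The contravariant functor `Hom(-, T)` on morphisms, as a `k`-linear map. -/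
def homPre (f : M →ₗ[S] N) : (N →ₗ[S] T) →ₗ[k] (M →ₗ[S] T) where
  toFun g := g ∘ₗ f
  map_add' _ _ := rfl
  map_smul' _ _ := rfl

/-- The module `Hom_k(Hom_S(M, T), k)` over the Ringel dual. An endomorphism `c` of `T` acts by
`(c • ξ) g = ξ (c ∘ g)`. -/
def HomDual (M : Type u) [AddCommGroup M] [Module S M] : Type u := (M →ₗ[S] T) →ₗ[k] k

noncomputable instance : AddCommGroup (HomDual k T M) :=
  inferInstanceAs (AddCommGroup ((M →ₗ[S] T) →ₗ[k] k))

variable {k T}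

/-- A linear form on `Hom_S(M, T)` as an element of its dual. -/
def HomDual.of (ξ : (M →ₗ[S] T) →ₗ[k] k) : HomDual k T M := ξ

/-- The value of a linear form on `Hom_S(M, T)`. -/
def HomDual.eval (ξ : HomDual k T M) : (M →ₗ[S] T) →ₗ[k] k := ξ

noncomputable instance : Module (EndOp T) (HomDual k T M) where
  smul c ξ := ξ.eval ∘ₗ homPost k T (toEndOp.symm c)
  one_smul _ := rfl
  mul_smul _ _ _ := rfl
  smul_zero _ := rfl
  smul_add _ _ _ := rfl
  add_smul c c' ξ := LinearMap.ext fun g =>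
    map_add ξ.eval (toEndOp.symm c ∘ₗ g) (toEndOp.symm c' ∘ₗ g)
  zero_smul ξ := LinearMap.ext fun _ => map_zero ξ.eval

/-- The `k`-vector space structure of `Hom_k(Hom_S(M, T), k)`. -/
noncomputable abbrev HomDual.vectorSpace : Module k (HomDual k T M) :=
  inferInstanceAs (Module k ((M →ₗ[S] T) →ₗ[k] k))

theorem HomDual.ext {ξ η : HomDual k T M} (h : ∀ g, ξ.eval g = η.eval g) : ξ = η :=
  LinearMap.ext h

theorem HomDual.eval_algebraMap_smul (a : k) (ξ : HomDual k T M) :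
    (algebraMap k (EndOp T) a • ξ).eval = a • ξ.eval :=
  LinearMap.ext fun g => map_smul ξ.eval a g

/-- The covariant functor `Hom_k(Hom_S(-, T), k)` on morphisms. -/
def HomDual.map (f : M →ₗ[S] N) : HomDual k T M →ₗ[EndOp T] HomDual k T N where
  toFun ξ := ξ.eval ∘ₗ homPre k T f
  map_add' _ _ := rfl
  map_smul' _ _ := rfl

theorem HomDual.eval_map (f : M →ₗ[S] N) (ξ : HomDual k T M) (g : N →ₗ[S] T) :
    (HomDual.map f ξ).eval g = ξ.eval (g ∘ₗ f) := rfl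

theorem HomDual.map_comp_id {f : M →ₗ[S] N} {g : N →ₗ[S] M} (h : g ∘ₗ f = LinearMap.id) :
    HomDual.map (k := k) (T := T) g ∘ₗ HomDual.map f = LinearMap.id :=
  LinearMap.ext fun ξ => HomDual.ext fun a => by
    rw [LinearMap.comp_apply, HomDual.eval_map, HomDual.eval_map, LinearMap.comp_assoc, h]
    rfl

variable {f : X →ₗ[S] M} {g : M →ₗ[S] Y}

theorem SES.homPre (h : SES f g) (hY : ExtVanish S 1 Y T) :
    SES (homPre k T g) (homPre k T f) := by
  refine ⟨fun a b hab => LinearMap.ext fun y => ?_, fun a => ⟨fun ha => ?_, ?_⟩, fun a => ?_⟩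
  · obtain ⟨x, rfl⟩ := h.surj y
    exact LinearMap.congr_fun hab x
  · exact h.desc a fun x => LinearMap.congr_fun ha x
  · rintro ⟨b, rfl⟩
    exact LinearMap.ext fun x => (congrArg b (h.comp_apply x)).trans (map_zero b)
  · exact h.exists_extension hY a

theorem SES.homDual (h : SES f g) (hY : ExtVanish S 1 Y T) :
    SES (HomDual.map (k := k) (T := T) f) (HomDual.map g) := by
  have hses := h.homPre (k := k) hY
  refine ⟨fun ξ η hξη => HomDual.ext fun a => ?_, fun ξ => ⟨fun hξ => ?_, ?_⟩, fun η => ?_⟩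
  · obtain ⟨b, rfl⟩ := hses.surj a
    exact congrArg (fun ζ => HomDual.eval ζ b) hξη
  · obtain ⟨η, hη⟩ := hses.desc ξ.eval fun b => congrArg (fun ζ => HomDual.eval ζ b) hξ
    exact ⟨η, hη⟩
  · rintro ⟨η, rfl⟩
    refine HomDual.ext fun a => ?_
    rw [HomDual.eval_map, HomDual.eval_map, LinearMap.comp_assoc, h.comp_eq_zero,
      LinearMap.comp_zero, map_zero]
    rfl
  · obtain ⟨l, hl⟩ := (RingelDuality.homPre k T g).exists_leftInverse_of_injective
      (LinearMap.ker_eq_bot.2 hses.inj)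
    refine ⟨(η.eval ∘ₗ l : (M →ₗ[S] T) →ₗ[k] k), HomDual.ext fun a => ?_⟩
    exact congrArg η.eval (LinearMap.congr_fun hl a)

/-- The dual of `End(T)` is the injective cogenerator of the Ringel dual. -/
noncomputable def homDualSelf (k : Type u) {S : Type u} [Field k] [Ring S] [Algebra k S]
    (T : ModuleCat.{u} S) [Module k T] [IsScalarTower k S T] :
    HomDual k T T ≃ₗ[EndOp T] RegDual k (EndOp T) where
  toFun ξ := { toFun := fun c => ξ.eval (toEndOp.symm c)
               map_add' := fun c _ => map_add ξ.eval (toEndOp.symm c) _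
               map_smul' := fun a c => map_smul ξ.eval a (toEndOp.symm c) }
  map_add' _ _ := rfl
  map_smul' _ _ := rfl
  invFun η := { toFun := fun g => η.eval (toEndOp g)
                map_add' := fun g _ => map_add η.eval (toEndOp g) _
                map_smul' := fun a g => map_smul η.eval a (toEndOp g) }
  left_inv _ := rfl
  right_inv _ := rfl

theorem extVanish_homDual_self (V : Type u) [AddCommGroup V] [Module (EndOp T) V] (j : ℕ) :
    ExtVanish (EndOp T) (j + 1) V (HomDual k T T) :=
  (extVanish_of_injective RegDual.injective j).congr_right (homDualSelf k T).symm

/-- The functor `Hom_k(Hom(-, T), k)` takes `add T` to injective modules. -/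
theorem extVanish_homDual (hT : ExtVanish S 1 T T) (h : InAdd S T M)
    (V : Type u) [AddCommGroup V] [Module (EndOp T) V] (j : ℕ) :
    ExtVanish (EndOp T) (j + 1) V (HomDual k T M) := by
  obtain ⟨n, i, r, hr⟩ := h
  have hn : ExtVanish (EndOp T) (j + 1) V (HomDual k T (Fin n → T)) := by
    clear hr i r
    induction n with
    | zero =>
      have : Subsingleton (HomDual k T (Fin 0 → T)) :=
        ⟨fun ξ η => HomDual.ext fun g => by
          rw [Subsingleton.elim g 0, map_zero, map_zero]⟩
      exact extVanish_subsingleton_right _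
    | succ n ih =>
      exact ((SES.pi_succ S T n).homDual (hT.pi_left n)).cov_mid _
        (extVanish_homDual_self V j) ih
  exact hn.retract_right _ _ (HomDual.map_comp_id hr)

/-- Linear maps between the duals of finite-dimensional spaces are transposes. -/
theorem exists_transpose {k : Type u} [Field k] {V W : Type u} [AddCommGroup V] [Module k V]
    [Module.Finite k V] [AddCommGroup W] [Module k W]
    (ρ : Module.Dual k V →ₗ[k] Module.Dual k W) : ∃ σ : W →ₗ[k] V, ∀ ξ w, ρ ξ w = ξ (σ w) := by
  refine ⟨(Module.evalEquiv k V).symm.toLinearMap ∘ₗ ρ.dualMap ∘ₗ Module.Dual.eval k W,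
    fun ξ w => ?_⟩
  have h := LinearEquiv.apply_symm_apply (Module.evalEquiv k V) (ρ.dualMap (Module.Dual.eval k W w))
  exact (LinearMap.congr_fun h ξ).symm

end HomDuals

/-! ### The `∇`-filtration dimension and injective dimensions over the Ringel dual -/

section Contravariant

variable {k S : Type u} [Field k] [Ring S] [Algebra k S] [Module.Finite k S]
  {Λ : Type v} [PartialOrder Λ] {L : Λ → ModuleCat.{u} S} {D : HighestWeight L}
  {T : ModuleCat.{u} S} {Tl : Λ → ModuleCat.{u} S} [Module k T] [IsScalarTower k S T]

namespace FullTilting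

theorem finite_homDual (h : FullTilting D T Tl) (M : Type u) [AddCommGroup M] [Module S M]
    [Module.Finite S M] : Module.Finite (EndOp T) (HomDual k T M) := by
  have := h.finite
  have := finite_linearMap (k := k) (S := S) M T
  let _ : Module k (HomDual k T M) := HomDual.vectorSpace
  have : Module.Finite k (HomDual k T M) :=
    inferInstanceAs (Module.Finite k ((M →ₗ[S] T) →ₗ[k] k))
  have : IsScalarTower k (EndOp T) (HomDual k T M) := ⟨fun a c ξ => HomDual.ext fun g =>
    map_smul ξ.eval a (toEndOp.symm c ∘ₗ g)⟩
  exact Module.Finite.of_restrictScalars_finite k (EndOp T) _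

variable [IsArtinianRing S]

/-- A module `M` with a standard filtration has a costandard filtration, hence lies in `add T`, if
and only if the dual of `Hom(M, T)` is injective: a splitting of the dual of
`Hom(N, T) → Hom(M, T)`, for an embedding of `M` into `N` in `add T`, comes from a retraction `N → M`. Dimension
shifting along `add T`-coresolutions of `M` gives the general statement. -/
theorem extVanish_Δ_iff (h : FullTilting D T Tl) (d : ℕ)
    {M : ModuleCat.{u} S} (hM : D.FiltΔ Set.univ M) :
    (∀ a j, d < j → ExtVanish S j (D.Δ a) M) ↔
      ∀ Y : ModuleCat.{u} (EndOp T), Module.Finite (EndOp T) Y → ∀ j, d < j →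
        ExtVanish (EndOp T) j Y (HomDual k T M) := by
  have hT := h.extVanish_T h.filtC 0
  induction d generalizing M with
  | zero =>
    constructor
    · intro hv Y _ j hj
      have hadd := h.inAdd_of_filt hM (D.filtC_of_extVanish hM.finite fun a => hv a 1 one_pos)
      obtain ⟨j, rfl⟩ := Nat.exists_eq_succ_of_ne_zero (by omega : j ≠ 0)
      exact extVanish_homDual hT hadd Y j
    · intro hv a j hj
      obtain ⟨N, f, hN, hf, hext⟩ := h.exists_embedding hM
      have hses := SES.range_mkQ hf
      have hNΔ := h.filtΔ_of_inAdd hN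
      have hQ : D.FiltΔ Set.univ (ModuleCat.of S (N ⧸ LinearMap.range f)) := hext.filtΔ hses hNΔ
      have hfin := hNΔ.finite
      have hfin' := hQ.finite
      have hfinM := hM.finite
      have hfinT := h.finite
      have hdual := hses.homDual (k := k) (hQ.extVanish_filtC h.filtC 0)
      obtain ⟨ρ, hρ⟩ := hdual.exists_extension
        (hv (ModuleCat.of _ (HomDual k T (N ⧸ LinearMap.range f))) (h.finite_homDual _) 1 one_pos)
        LinearMap.id
      have hρ' : ∀ ξ, ρ (HomDual.map f ξ) = ξ := fun ξ => LinearMap.congr_fun hρ ξ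
      -- the retraction `ρ` is the transpose of an `End(T)`-linear section `σ`
      have := finite_linearMap (k := k) (S := S) N T
      have := finite_linearMap (k := k) (S := S) M T
      let _ : Module k (HomDual k T N) := HomDual.vectorSpace
      let _ : Module k (HomDual k T M) := HomDual.vectorSpace
      let ρ' : Module.Dual k (N →ₗ[S] T) →ₗ[k] Module.Dual k (M →ₗ[S] T) :=
        { toFun := fun ξ => (ρ ξ).eval
          map_add' := fun ξ η => map_add ρ ξ η
          map_smul' := fun a ξ => by
            have h1 : (a • ξ : Module.Dual k (N →ₗ[S] T)) =
              (algebraMap k (EndOp T) a • HomDual.of ξ).eval :=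
              (HomDual.eval_algebraMap_smul a (HomDual.of ξ)).symm
            rw [h1]
            exact (congrArg HomDual.eval
              (map_smul ρ (algebraMap k (EndOp T) a) (HomDual.of ξ))).trans
              (HomDual.eval_algebraMap_smul a _) }
      obtain ⟨σ, hσ⟩ := exists_transpose ρ'
      have hσ' : ∀ (ξ : HomDual k T N) g, (ρ ξ).eval g = ξ.eval (σ g) := hσ
      obtain ⟨φ, hφ⟩ := h.exists_comp_eq hM σ.toAddMonoidHom fun c g => by
        refine sub_eq_zero.1 ((Module.forall_dual_apply_eq_zero_iff k _).1 fun ξ => ?_)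
        rw [map_sub, sub_eq_zero]
        have h1 := hσ' ξ (c ∘ₗ g)
        have h2 := hσ' (toEndOp c • HomDual.of ξ) g
        rw [map_smul] at h2
        exact h1.symm.trans h2
      have hφ' : ∀ g, σ g = g ∘ₗ φ := hφ
      have hφf : φ ∘ₗ f = LinearMap.id := by
        refine sub_eq_zero.1 (h.eq_zero_of_forall_comp hM fun g => ?_)
        rw [LinearMap.comp_sub, ← LinearMap.comp_assoc, ← hφ', LinearMap.comp_id]
        refine (Module.forall_dual_apply_eq_zero_iff k _).1 fun η => ?_
        rw [map_sub, sub_eq_zero]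
        have h1 := hσ' (HomDual.map f (HomDual.of η)) g
        rw [hρ'] at h1
        exact h1.symm
      obtain ⟨j, rfl⟩ := Nat.exists_eq_succ_of_ne_zero (by omega : j ≠ 0)
      exact (h.filtC_of_inAdd (hN.retract f φ hφf)).extVanish_Δ a j
  | succ d ih =>
    obtain ⟨N, f, hN, hf, hext⟩ := h.exists_embedding hM
    have hses := SES.range_mkQ hf
    have hNΔ := h.filtΔ_of_inAdd hN
    have hNC := h.filtC_of_inAdd hN
    have hQ : D.FiltΔ Set.univ (ModuleCat.of S (N ⧸ LinearMap.range f)) := hext.filtΔ hses hNΔ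
    have hdual := hses.homDual (k := k) (hQ.extVanish_filtC h.filtC 0)
    trans ∀ a j, d < j → ExtVanish S j (D.Δ a) (N ⧸ LinearMap.range f)
    · refine ⟨fun hv a j hj => ?_, fun hv a j hj => ?_⟩
      · obtain ⟨j, rfl⟩ := Nat.exists_eq_succ_of_ne_zero (by omega : j ≠ 0)
        exact hses.cov_right _ (hNC.extVanish_Δ a j) (hv a _ (by omega))
      · obtain ⟨j, rfl⟩ := Nat.exists_eq_succ_of_ne_zero (by omega : j ≠ 0)
        exact hses.cov_left _ (hv a _ (by omega)) (hNC.extVanish_Δ a j)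
    · refine (ih hQ).trans ⟨fun hv Y hY j hj => ?_, fun hv Y hY j hj => ?_⟩
      · obtain ⟨j, rfl⟩ := Nat.exists_eq_succ_of_ne_zero (by omega : j ≠ 0)
        exact hdual.cov_left _ (hv Y hY _ (by omega)) (extVanish_homDual hT hN Y j)
      · obtain ⟨j, rfl⟩ := Nat.exists_eq_succ_of_ne_zero (by omega : j ≠ 0)
        exact hdual.cov_right _ (extVanish_homDual hT hN Y j) (hv Y hY _ (by omega))

variable (k) in
/-- The dual of `Hom(S, T) = T` is `Hom(T, I)`, where `I` is the dual of `S`. -/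
noncomputable def homDualRegular (T : ModuleCat.{u} S) [Module k T] [IsScalarTower k S T] :
    HomDual k T S ≃ₗ[EndOp T] (T →ₗ[S] RegDual k S) :=
  let e : T →ₗ[k] (S →ₗ[S] T) := (LinearMap.ringLmapEquivSelf S k T).symm
  { toFun := fun ξ => RegDual.lift (ξ.eval ∘ₗ e)
    map_add' := fun _ _ => rfl
    map_smul' := fun c ξ => LinearMap.ext fun t => RegDual.ext fun r =>
      congrArg ξ.eval (LinearMap.ext fun s => by
        change toEndOp.symm c (s • r • t) = s • r • toEndOp.symm c t
        rw [map_smul, map_smul])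
    invFun := fun φ => HomDual.of
      { toFun := fun g => (φ (g 1)).eval 1
        map_add' := fun g g' => by
          rw [LinearMap.add_apply, map_add, RegDual.eval_add, LinearMap.add_apply]
        map_smul' := fun a g => by
          rw [LinearMap.smul_apply, ← algebraMap_smul S a (g 1), map_smul, RegDual.eval_smul,
            one_mul, Algebra.algebraMap_eq_smul_one, map_smul, RingHom.id_apply] }
    left_inv := fun ξ => HomDual.ext fun g => congrArg ξ.eval (LinearMap.ext fun s => by
      change s • (1 : S) • g 1 = g s
      rw [one_smul, ← map_smul, smul_eq_mul, mul_one])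
    right_inv := fun φ => LinearMap.ext fun t => RegDual.ext fun r => by
      change (φ ((1 : S) • r • t)).eval 1 = (φ t).eval r
      rw [one_smul, map_smul, RegDual.eval_smul, one_mul] }

/-- The invariant `gfd S` is the injective dimension of `Hom(T, I)`, where `I` is the dual of `S`,
and so is `wfd` of the Ringel dual. -/
theorem gfd_eq (k : Type u) [Field k] [Algebra k S] [Module.Finite k S] [Module k T]
    [IsScalarTower k S T] (h : FullTilting D T Tl) :
    gfd L = wfd (endOpSimple T Tl) := by
  have := h.finite
  have := EndOp.finite (k := k) T
  have := IsArtinianRing.of_finite k (EndOp T)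
  have hI := RegDual.isFiniteCogenerator (k := k) (R := S)
  have hR := RegDual.isFiniteCogenerator (k := k) (R := EndOp T)
  obtain ⟨D'⟩ := h.isQuasiHereditary.nonempty_highestWeight hR.enoughFiniteInjectives
  refine enat_eq_of_forall_le_natCast_iff fun d => ?_
  have hSΔ : D.FiltΔ Set.univ (ModuleCat.of S S) :=
    D.filtΔ_of_projective (M := ModuleCat.of S S) inferInstance
      (inferInstanceAs (Module.Projective S S))
  rw [D.gfd_le_iff_self hI.enoughFiniteInjectives, h.wfd_le_iff_hom_cogenerator D' hI]
  refine (h.extVanish_Δ_iff (k := k) d hSΔ).trans ?_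
  have e := homDualRegular k T
  exact ⟨fun hv Y hY j hj => (hv Y hY j hj).congr_right e,
    fun hv Y hY j hj => (hv Y hY j hj).congr_right e.symm⟩

end FullTilting

end Contravariant

/-! ### Contravariant self-equivalences -/

section Duality

open Opposite

variable {S : Type u} [Ring S]

/-- The value of a contravariant self-equivalence of the category of finitely generated modules on
a module. -/
noncomputable def contraObj (E : (FGModuleCat.{u} S)ᵒᵖ ≌ FGModuleCat.{u} S) (M : Type u)
    [AddCommGroup M] [Module S M] [Module.Finite S M] : FGModuleCat.{u} S :=
  E.functor.obj (op (FGModuleCat.of S M))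

variable (E : (FGModuleCat.{u} S)ᵒᵖ ≌ FGModuleCat.{u} S)
variable {X Y Z : Type u} [AddCommGroup X] [Module S X] [Module.Finite S X]
  [AddCommGroup Y] [Module S Y] [Module.Finite S Y] [AddCommGroup Z] [Module S Z]
  [Module.Finite S Z]

/-- The value of a contravariant self-equivalence of the category of finitely generated modules on
a linear map. -/
noncomputable def contraMap (f : X →ₗ[S] Y) : contraObj E Y →ₗ[S] contraObj E X :=
  (E.functor.map (FGModuleCat.ofHom f).op).hom.hom

theorem contraMap_id : contraMap E (LinearMap.id : X →ₗ[S] X) = LinearMap.id := by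
  have h : FGModuleCat.ofHom (LinearMap.id : X →ₗ[S] X) = 𝟙 (FGModuleCat.of S X) := rfl
  rw [contraMap, h, op_id, E.functor.map_id]
  rfl

theorem contraMap_comp (g : Y →ₗ[S] Z) (f : X →ₗ[S] Y) :
    contraMap E (g ∘ₗ f) = contraMap E f ∘ₗ contraMap E g := by
  have h : FGModuleCat.ofHom (g ∘ₗ f) = FGModuleCat.ofHom f ≫ FGModuleCat.ofHom g := rfl
  rw [contraMap, h, op_comp, E.functor.map_comp]
  rfl

theorem contraMap_injective {f g : X →ₗ[S] Y} (h : contraMap E f = contraMap E g) : f = g := by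
  have h1 : (FGModuleCat.ofHom f).op = (FGModuleCat.ofHom g).op :=
    E.functor.map_injective (FGModuleCat.hom_ext h)
  exact congrArg (fun t : FGModuleCat.of S X ⟶ FGModuleCat.of S Y => t.hom.hom)
    (Quiver.Hom.op_inj h1)

theorem exists_contraMap_eq (g : contraObj E Y →ₗ[S] contraObj E X) :
    ∃ f : X →ₗ[S] Y, contraMap E f = g := by
  obtain ⟨t, ht⟩ := E.functor.map_surjective
    (X := op (FGModuleCat.of S Y)) (Y := op (FGModuleCat.of S X)) (FGModuleCat.ofHom g)
  exact ⟨t.unop.hom.hom,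
    congrArg (fun t : contraObj E Y ⟶ contraObj E X => t.hom.hom) ht⟩

theorem nonempty_equiv_contraObj_symm (X : Type u) [AddCommGroup X] [Module S X]
    [Module.Finite S X] : Nonempty (contraObj E (contraObj E.symm.leftOp X) ≃ₗ[S] X) :=
  ⟨FGModuleCat.isoToLinearEquiv (E.counitIso.app (FGModuleCat.of S X))⟩

/-- Every map between finitely generated modules with target a dual is the dual of a map, up to an
identification of its domain. -/
theorem exists_contraMap_equiv (f : X →ₗ[S] contraObj E Y) :
    ∃ (B : FGModuleCat.{u} S) (e : contraObj E B ≃ₗ[S] X) (g : Y →ₗ[S] B),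
      contraMap E g = f ∘ₗ e.toLinearMap := by
  obtain ⟨e⟩ := nonempty_equiv_contraObj_symm E X
  obtain ⟨g, hg⟩ := exists_contraMap_eq E
    (X := Y) (Y := contraObj E.symm.leftOp X) (f ∘ₗ e.toLinearMap)
  exact ⟨_, e, g, hg⟩

theorem contraObj_subsingleton [Subsingleton X] : Subsingleton (contraObj E X) := by
  obtain ⟨f, hf⟩ := exists_contraMap_eq E (X := X) (Y := X) 0
  have hid : f = LinearMap.id := LinearMap.ext fun x => Subsingleton.elim _ _
  rw [hid, contraMap_id] at hf
  exact subsingleton_of_forall_eq 0 fun x => LinearMap.congr_fun hf x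

theorem contraMap_zero : contraMap E (0 : X →ₗ[S] Y) = 0 := by
  have h : (0 : X →ₗ[S] Y) = (0 : PUnit.{u + 1} →ₗ[S] Y) ∘ₗ (0 : X →ₗ[S] PUnit.{u + 1}) := by
    rw [LinearMap.comp_zero]
  have := contraObj_subsingleton E (S := S) (X := PUnit.{u + 1})
  rw [h, contraMap_comp]
  ext x
  have : contraMap E (0 : PUnit.{u + 1} →ₗ[S] Y) x = 0 := Subsingleton.elim _ _
  rw [LinearMap.comp_apply, this, map_zero, LinearMap.zero_apply]

theorem eq_zero_of_contraMap {f : X →ₗ[S] Y} (h : contraMap E f = 0) : f = 0 :=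
  contraMap_injective E (h.trans (contraMap_zero E).symm)

theorem nonempty_equiv_of_contraObj (e : contraObj E Y ≃ₗ[S] contraObj E X) :
    Nonempty (X ≃ₗ[S] Y) := by
  obtain ⟨f, hf⟩ := exists_contraMap_eq E e.toLinearMap
  obtain ⟨g, hg⟩ := exists_contraMap_eq E e.symm.toLinearMap
  refine ⟨LinearEquiv.ofLinearMap f g (contraMap_injective E ?_) (contraMap_injective E ?_)⟩
  · rw [contraMap_comp, hf, hg, contraMap_id]
    ext x
    simp
  · rw [contraMap_comp, hf, hg, contraMap_id]
    ext x
    simp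

theorem surjective_of_contraMap {f : X →ₗ[S] Y} (hf : Function.Injective (contraMap E f)) :
    Function.Surjective f := by
  have h : (LinearMap.range f).mkQ ∘ₗ f = 0 := LinearMap.range_mkQ_comp f
  have h1 : contraMap E (LinearMap.range f).mkQ = 0 := by
    refine LinearMap.ext fun x => hf ?_
    rw [← LinearMap.comp_apply, ← contraMap_comp, h, contraMap_zero]
    simp
  have h2 := eq_zero_of_contraMap E h1
  rw [← LinearMap.range_eq_top, ← Submodule.ker_mkQ (LinearMap.range f), h2, LinearMap.ker_zero]

section Exact

theorem contraMap_surjective {f : X →ₗ[S] Y} (hf : Function.Injective f) :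
    Function.Surjective (contraMap E f) := by
  rw [← LinearMap.range_eq_top]
  set R := LinearMap.range (contraMap E f)
  obtain ⟨e⟩ := nonempty_equiv_contraObj_symm E (contraObj E X ⧸ R)
  obtain ⟨g, hg⟩ := exists_contraMap_eq E (Y := X)
    (X := contraObj E.symm.leftOp (contraObj E X ⧸ R))
    (e.symm.toLinearMap ∘ₗ R.mkQ)
  have h0 : g = 0 := by
    have : f ∘ₗ g = 0 := by
      apply eq_zero_of_contraMap E
      rw [contraMap_comp, hg, LinearMap.comp_assoc, LinearMap.range_mkQ_comp, LinearMap.comp_zero]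
    exact LinearMap.ext fun x => hf (by simpa using LinearMap.congr_fun this x)
  rw [h0, contraMap_zero] at hg
  rw [eq_top_iff]
  intro x _
  have := LinearMap.congr_fun hg x
  rw [← R.ker_mkQ, LinearMap.mem_ker]
  exact e.symm.injective (by rw [map_zero]; exact this.symm)

variable [IsNoetherianRing S]

/-- A contravariant equivalence is exact. -/
theorem SES.contraMap {f : X →ₗ[S] Y} {g : Y →ₗ[S] Z} (h : SES f g) :
    SES (contraMap E g) (contraMap E f) := by
  -- a submodule of the dual of `Y` that is killed by the dual of `f` is in the range of that of `g`
  have key : ∀ (N : Submodule S (contraObj E Y)), (∀ x ∈ N, RingelDuality.contraMap E f x = 0) →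
      ∃ (B : FGModuleCat.{u} S) (e : contraObj E B ≃ₗ[S] N) (b : Z →ₗ[S] B),
        RingelDuality.contraMap E g ∘ₗ RingelDuality.contraMap E b =
          N.subtype ∘ₗ e.toLinearMap := by
    intro N hN
    obtain ⟨B, e, b, hb⟩ := exists_contraMap_equiv E N.subtype
    obtain ⟨c, rfl⟩ := h.desc b fun x => by
      have : b ∘ₗ f = 0 := by
        apply eq_zero_of_contraMap E
        rw [contraMap_comp, hb]
        exact LinearMap.ext fun x => hN _ (e x).2
      exact LinearMap.congr_fun this x
    exact ⟨B, e, c, by rw [← contraMap_comp, hb]⟩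
  refine ⟨?_, fun y => ⟨fun hy => ?_, ?_⟩, contraMap_surjective E h.inj⟩
  · rw [← LinearMap.ker_eq_bot, ← Submodule.range_subtype (LinearMap.ker _)]
    obtain ⟨B, e, b, hb⟩ :=
      exists_contraMap_equiv E (LinearMap.ker (RingelDuality.contraMap E g)).subtype
    have h0 : b = 0 := by
      have : b ∘ₗ g = 0 := by
        apply eq_zero_of_contraMap E
        rw [contraMap_comp, hb]
        exact LinearMap.ext fun x => (e x).2
      refine LinearMap.ext fun z => ?_
      obtain ⟨y, rfl⟩ := h.surj z
      exact LinearMap.congr_fun this y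
    rw [h0, contraMap_zero] at hb
    rw [LinearMap.range_eq_bot]
    refine LinearMap.ext fun x => ?_
    have := LinearMap.congr_fun hb (e.symm x)
    simpa using this.symm
  · obtain ⟨B, e, b, hb⟩ := key (Submodule.span S {y}) fun x hx => by
      obtain ⟨s, rfl⟩ := Submodule.mem_span_singleton.1 hx
      rw [map_smul, hy, smul_zero]
    have := LinearMap.congr_fun hb (e.symm ⟨y, Submodule.mem_span_singleton_self y⟩)
    exact ⟨_, this.trans (by simp)⟩
  · rintro ⟨x, rfl⟩
    rw [← LinearMap.comp_apply, ← contraMap_comp, h.comp_eq_zero, contraMap_zero]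
    rfl

/-- The dual of a projective module is injective. By Baer's criterion, only maps defined on ideals
have to be extended; these are finitely generated. -/
theorem contraObj_injective (hX : Module.Projective S X) : Module.Injective S (contraObj E X) := by
  refine Module.Baer.injective fun I g => ?_
  obtain ⟨B, e, b, hb⟩ := exists_contraMap_equiv E g
  obtain ⟨e'⟩ := nonempty_equiv_contraObj_symm E S
  obtain ⟨c, hc⟩ := exists_contraMap_eq E (Y := B) (X := contraObj E.symm.leftOp S)
    (e'.symm.toLinearMap ∘ₗ I.subtype ∘ₗ e.toLinearMap)
  have hs : Function.Surjective c := surjective_of_contraMap E <| by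
    rw [hc]
    exact e'.symm.injective.comp (I.injective_subtype.comp e.injective)
  obtain ⟨t, ht⟩ := Module.projective_lifting_property c b hs
  refine ⟨contraMap E t ∘ₗ e'.symm.toLinearMap, fun x hx => ?_⟩
  have h1 := LinearMap.congr_fun hc (e.symm ⟨x, hx⟩)
  have h2 := LinearMap.congr_fun hb (e.symm ⟨x, hx⟩)
  rw [← ht, contraMap_comp] at h2
  simp only [LinearMap.comp_apply, LinearEquiv.coe_coe, LinearEquiv.apply_symm_apply,
    Submodule.subtype_apply] at h1 h2 ⊢
  rw [← h1, h2]

end Exact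

section Dimension

variable [IsNoetherianRing S]

theorem projective_of_extVanish (h : ∀ M : ModuleCat.{u} S, Module.Finite S M → ExtVanish S 1 X M) :
    Module.Projective S X := by
  obtain ⟨P, p, hP, hP', hp⟩ := exists_free_cover (S := S) X inferInstance
  have hs := SES.ker_subtype hp
  obtain ⟨s, hs⟩ := hs.exists_lift
    (h (ModuleCat.of S (LinearMap.ker p)) hs.finite_left) LinearMap.id
  exact Module.Projective.of_split s p hs

/-- The projective dimension of a module, tested on finitely generated modules, is the injective
dimension of its dual. -/
theorem extVanish_iff_contraObj (d : ℕ) :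
    (∀ M : ModuleCat.{u} S, Module.Finite S M → ∀ j, d < j → ExtVanish S j X M) ↔
      ∀ M : ModuleCat.{u} S, Module.Finite S M → ∀ j, d < j →
        ExtVanish S j M (contraObj E X) := by
  obtain ⟨P, p, hP, hP', hp⟩ := exists_free_cover (S := S) X inferInstance
  have hs := SES.ker_subtype hp
  have := hs.finite_left
  have hs' := hs.contraMap E
  have hI := contraObj_injective E hP'
  induction d generalizing X P with
  | zero =>
    constructor
    · intro h M _ j hj
      obtain ⟨j, rfl⟩ := Nat.exists_eq_succ_of_ne_zero hj.ne'
      exact extVanish_of_injective (contraObj_injective E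
        (projective_of_extVanish fun M hM => h M hM 1 one_pos)) j
    · intro h M _ j hj
      obtain ⟨j, rfl⟩ := Nat.exists_eq_succ_of_ne_zero hj.ne'
      obtain ⟨b, hb⟩ := hs'.exists_extension
        (h (contraObj E (LinearMap.ker p)).obj inferInstance 1 one_pos) LinearMap.id
      obtain ⟨s, rfl⟩ := exists_contraMap_eq E b
      rw [← contraMap_comp, ← contraMap_id] at hb
      have := Module.Projective.of_split s p (contraMap_injective E hb)
      exact extVanish_of_projective j
  | succ d ih =>
    obtain ⟨Q, q, hQ, hQ', hq⟩ := exists_free_cover (S := S) (LinearMap.ker p) inferInstance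
    have ht := SES.ker_subtype hq
    have := ht.finite_left
    have ih' := ih Q q hQ hQ' hq ht this (ht.contraMap E) (contraObj_injective E hQ')
    have h1 : (∀ M : ModuleCat.{u} S, Module.Finite S M → ∀ j, d + 1 < j → ExtVanish S j X M) ↔
        ∀ M : ModuleCat.{u} S, Module.Finite S M → ∀ j, d < j →
          ExtVanish S j (LinearMap.ker p) M := by
      constructor
      · intro h M hM j hj
        obtain ⟨j, rfl⟩ := Nat.exists_eq_succ_of_ne_zero (by omega : j ≠ 0)
        exact hs.con_left _ (extVanish_of_projective j) (h M hM _ (by omega))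
      · intro h M hM j hj
        obtain ⟨j, rfl⟩ := Nat.exists_eq_succ_of_ne_zero (by omega : j ≠ 0)
        exact hs.con_right _ (h M hM _ (by omega)) (extVanish_of_projective j)
    have h2 : (∀ M : ModuleCat.{u} S, Module.Finite S M → ∀ j, d + 1 < j →
        ExtVanish S j M (contraObj E X)) ↔
        ∀ M : ModuleCat.{u} S, Module.Finite S M → ∀ j, d < j →
          ExtVanish S j M (contraObj E (LinearMap.ker p)) := by
      constructor
      · intro h M hM j hj
        obtain ⟨j, rfl⟩ := Nat.exists_eq_succ_of_ne_zero (by omega : j ≠ 0)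
        exact hs'.cov_right _ (extVanish_of_injective hI j) (h M hM _ (by omega))
      · intro h M hM j hj
        obtain ⟨j, rfl⟩ := Nat.exists_eq_succ_of_ne_zero (by omega : j ≠ 0)
        exact hs'.cov_left _ (h M hM _ (by omega)) (extVanish_of_injective hI j)
    exact h1.trans (ih'.trans h2.symm)

end Dimension

/-! ### Simple-preserving dualities -/

section SimplePreserving

variable {Λ : Type v} {L : Λ → ModuleCat.{u} S}

/-- The contravariant equivalence fixes the simple modules `L a`. -/
def FixesSimples (E : (FGModuleCat.{u} S)ᵒᵖ ≌ FGModuleCat.{u} S) (L : Λ → ModuleCat.{u} S) : Prop :=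
  ∀ (a : Λ) (M : FGModuleCat.{u} S), Nonempty (M ≃ₗ[S] L a) → Nonempty (contraObj E M ≃ₗ[S] L a)

variable {E}

theorem FixesSimples.symm (h : FixesSimples E L) : FixesSimples E.symm.leftOp L := by
  rintro a M ⟨e⟩
  obtain ⟨e1⟩ := nonempty_equiv_contraObj_symm E M
  obtain ⟨e2⟩ := h a M ⟨e⟩
  obtain ⟨e3⟩ := nonempty_equiv_of_contraObj E
    (X := contraObj E.symm.leftOp M) (Y := M) (e2.trans (e.symm.trans e1.symm))
  exact ⟨e3.trans e⟩

variable [IsArtinianRing S]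

theorem FixesSimples.filt (h : FixesSimples E L) {A : Set Λ} {M : ModuleCat.{u} S}
    (hM : Module.Finite S M)
    (hf : Filt (fun N => ∃ a, a ∈ A ∧ Nonempty (N ≃ₗ[S] L a)) M) :
    Filt (fun N => ∃ a, a ∈ A ∧ Nonempty (N ≃ₗ[S] L a)) (contraObj E M).obj := by
  induction hf with
  | zero M _ => exact .zero _ (contraObj_subsingleton E (X := M))
  | @cons X Y Z f g hs _ hZ ih =>
    have := hs.finite_left
    have := hs.finite_right
    obtain ⟨a, ha, hZ⟩ := hZ
    exact .of_ses (X := (contraObj E Z).obj) (hs.contraMap E)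
      (.of_mem ⟨a, ha, h a (FGModuleCat.of S Z) hZ⟩) (ih inferInstance)

theorem FixesSimples.supportedOn (h : FixesSimples E L) {D : SimpleCovers L} {A : Set Λ}
    {M : Type u} [AddCommGroup M] [Module S M] [Module.Finite S M]
    (hM : SupportedOn D A M) : SupportedOn D A (contraObj E M) := by
  refine SupportedOn.of_filt (M := (contraObj E M).obj)
    (h.filt (M := ModuleCat.of S M) inferInstance (SupportedOn.filt (M := ModuleCat.of S M) hM)) ?_
  rintro N ⟨b, hb, ⟨e⟩⟩
  exact (SupportedOn.simple (D := D) hb).congr e.symm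

variable [PartialOrder Λ]

/-- The dual of a standard module is costandard. With `C a` identified with the dual of a module
`A`, the socle of `C a` is dual to a map `A → L a`. The maximality of `C a` gives an embedding of
the dual of `Δ a` into `C a`, that of `Δ a` a map `Δ a → A` whose dual embeds `C a` into the dual of
`Δ a`. -/
theorem FixesSimples.nonempty_equiv_C (h : FixesSimples E L) (D : HighestWeight L) (a : Λ)
    [Module.Finite S (D.Δ a)] : Nonempty (contraObj E (D.Δ a) ≃ₗ[S] D.C a) := by
  have := D.finite_C a
  have := D.finite_L a
  have := D.nontrivial_L a
  have hr := D.ses_r a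
  have := hr.finite_left
  set A := contraObj E.symm.leftOp (D.C a)
  have hA : SupportedOn D.toSimpleCovers (Set.Iic a) A := h.symm.supportedOn (D.supp_C a)
  obtain ⟨e⟩ := nonempty_equiv_contraObj_symm E (D.C a)
  obtain ⟨e0⟩ := h a (FGModuleCat.of S (L a)) ⟨LinearEquiv.refl S (L a)⟩
  have hr' := hr.contraMap E
  obtain ⟨φ, hφ⟩ := hr'.exists_extension (D.extVanish_C_of_supp (h.supportedOn
    ((D.supp_Δ a).of_injective hr.inj))) (D.l a ∘ₗ e0.toLinearMap)
  obtain ⟨θ, hθ⟩ := exists_contraMap_eq E (X := A) (e.symm.toLinearMap ∘ₗ φ)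
  have hφ' : ∀ x, φ (contraMap E (D.r a) x) = D.l a (e0 x) := fun x => LinearMap.congr_fun hφ x
  have hθ' : ∀ x, contraMap E θ x = e.symm (φ x) := fun x => LinearMap.congr_fun hθ x
  have hθs : Function.Surjective θ := by
    refine D.surjective_of_r_comp_ne_zero fun h0 => ?_
    obtain ⟨x, hx⟩ := exists_ne (0 : L a)
    have h1 : contraMap E (D.r a ∘ₗ θ) (e0.symm x) = 0 := by
      rw [h0, contraMap_zero]; rfl
    rw [contraMap_comp, LinearMap.comp_apply, hθ', hφ', LinearEquiv.apply_symm_apply] at h1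
    exact hx (D.l_inj a (e.symm.injective (by rw [h1, map_zero, map_zero])))
  have hθi : Function.Injective (contraMap E θ) :=
    ((SES.ker_subtype hθs).contraMap E).inj
  obtain ⟨m, hm⟩ := exists_contraMap_eq E (X := A) (Y := L a)
    (e.symm.toLinearMap ∘ₗ D.l a ∘ₗ e0.toLinearMap)
  have hms : Function.Surjective m := surjective_of_contraMap E <| by
    rw [hm]
    exact e.symm.injective.comp ((D.l_inj a).comp e0.injective)
  obtain ⟨t, ht⟩ := (SES.ker_subtype hms).exists_lift (D.extVanish_Δ_of_supp
    (hA.of_injective (LinearMap.ker m).injective_subtype)) (D.r a)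
  have hti : Function.Injective (contraMap E t ∘ₗ e.symm.toLinearMap) := by
    refine D.injective_of_comp_l_ne_zero fun h0 => ?_
    obtain ⟨x, hx⟩ := exists_ne (0 : L a)
    have h1 := LinearMap.congr_fun (congrArg (contraMap E) ht) (e0.symm x)
    rw [contraMap_comp, hm] at h1
    have h2 := LinearMap.congr_fun h0 x
    simp only [LinearMap.comp_apply, LinearEquiv.coe_coe, LinearEquiv.apply_symm_apply] at h1 h2
    rw [h2] at h1
    exact hx (e0.symm.injective ((hr'.inj (h1.symm.trans (map_zero _).symm)).trans
      (map_zero _).symm))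
  have hφi : Function.Injective φ := fun x y hxy => hθi (by rw [hθ', hθ', hxy])
  have hsurj := IsArtinian.surjective_of_injective_endomorphism
    (φ ∘ₗ contraMap E t ∘ₗ e.symm.toLinearMap) (hφi.comp hti)
  exact ⟨LinearEquiv.ofBijective φ ⟨hφi, fun y => (hsurj y).imp' _ fun _ hx => hx⟩⟩

/-- For an algebra with a simple-preserving duality the two filtration dimensions agree. -/
theorem HighestWeight.gfd_eq_wfd (D : HighestWeight L) (hS : EnoughFiniteInjectives S)
    (h : HasSimplePreservingDuality L) : gfd L = wfd L := by
  obtain ⟨E, hE⟩ := h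
  have hE : FixesSimples E L := hE
  refine enat_eq_of_forall_le_natCast_iff fun d => ?_
  rw [D.gfd_le_iff hS, D.wfd_le_iff]
  have key : ∀ a, (∀ M : ModuleCat.{u} S, Module.Finite S M → ∀ j, d < j →
      ExtVanish S j (D.Δ a) M) ↔ ∀ M : ModuleCat.{u} S, Module.Finite S M → ∀ j, d < j →
        ExtVanish S j M (D.C a) := fun a => by
    have := D.finite_Δ a
    obtain ⟨e⟩ := hE.nonempty_equiv_C D a
    rw [extVanish_iff_contraObj E d]
    exact ⟨fun h M hM j hj => (h M hM j hj).congr_right e,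
      fun h M hM j hj => (h M hM j hj).congr_right e.symm⟩
  exact ⟨fun h M hM a => (key a).1 (fun M hM => h M hM a) M hM,
    fun h M hM a => (key a).2 (fun M hM => h M hM a) M hM⟩

end SimplePreserving

end Duality

end RingelDuality

theorem corollary3p1p2 {k S : Type u} [Field k] [Ring S] [Algebra k S] [Module.Finite k S]
    {Λ : Type v} [PartialOrder Λ] (L : Λ → ModuleCat.{u} S)
    (hS : RingelDuality.IsQuasiHereditary L)
    (Tl : Λ → ModuleCat.{u} S)
    (hTl : ∀ a, RingelDuality.IsIndecomposableTilting L a (Tl a))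
    (T : ModuleCat.{u} S) (hT : RingelDuality.IsTilting L T)
    (hfull : ∀ a, RingelDuality.IsDirectSummand (Tl a) T) :
    RingelDuality.IsQuasiHereditary (RingelDuality.ringelSimple T Tl) ∧
    RingelDuality.gfd L = RingelDuality.wfd (RingelDuality.ringelSimple T Tl) ∧
    RingelDuality.wfd L = RingelDuality.gfd (RingelDuality.ringelSimple T Tl) ∧
    (RingelDuality.HasSimplePreservingDuality L →
      RingelDuality.gfd L = RingelDuality.wfd L ∧
      RingelDuality.wfd L = RingelDuality.wfd (RingelDuality.ringelSimple T Tl) ∧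
      RingelDuality.wfd (RingelDuality.ringelSimple T Tl) =
        RingelDuality.gfd (RingelDuality.ringelSimple T Tl)) := by
  have := IsArtinianRing.of_finite k S
  have hI := RingelDuality.RegDual.isFiniteCogenerator (k := k) (R := S)
  obtain ⟨D⟩ := hS.nonempty_highestWeight hI.enoughFiniteInjectives
  have h := RingelDuality.FullTilting.of_isTilting D hTl hT hfull
  let _ : Module k T := Module.compHom T (algebraMap k S)
  have : IsScalarTower k S T := ⟨fun c r x => by
    rw [Algebra.smul_def, mul_smul]
    rfl⟩
  have := h.finite
  have := RingelDuality.EndOp.finite (k := k) T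
  have := IsArtinianRing.of_finite k (RingelDuality.EndOp T)
  have hR := (RingelDuality.RegDual.isFiniteCogenerator (k := k)
    (R := RingelDuality.EndOp T)).enoughFiniteInjectives
  have hg : RingelDuality.gfd L = RingelDuality.wfd (RingelDuality.ringelSimple T Tl) :=
    h.gfd_eq k
  have hw : RingelDuality.wfd L = RingelDuality.gfd (RingelDuality.ringelSimple T Tl) :=
    h.wfd_eq hI hR
  refine ⟨h.isQuasiHereditary, hg, hw, fun hdual => ?_⟩
  have e := D.gfd_eq_wfd hI.enoughFiniteInjectives hdual
  exact ⟨e, e.symm.trans hg, hg.symm.trans (e.trans hw)⟩
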